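/- Let $d\ge 1$, $a>0$, and let $G$ be a probability distribution on $\mathbb R^d$ with Lebesgue density $g$. For $Y,Y'$ independent with law $G$, suppose that $\log g(Y)$ and $\log\|Y-Y'\|$ have finite second moments ($\|\cdot\|$ is the Euclidean norm). Let $Y_1,Y_2,\dots$ be i.i.d. with law $G$ and, for each $N\ge 1$, let $(J_{1,N},\dots,J_{N,N})\sim\mathrm{Dirichlet}(a/N,\dots,a/N)$ be independent of $(Y_i)_{i\ge1}$. For $1\le k\le N-1$ let $R_{i,k,N-1}$ be the distance between $Y_i$ and its $k$-th closest neighbour among the $Y_j$, $1\le j\le N$, $j\ne i$, and define $$H^{pri}_{N,a,k}=\sum_{i=1}^{N}J_{i,N}\log\frac{(N-1)\,\pi^{d/2}\,R_{i,k,N-1}^{d}}{k\,\Gamma(\frac d2+1)}-L_{k-1}+\gamma+\log k,\qquad L_m=\sum_{r=1}^{m}\frac1r,$$ where $\gamma$ is Euler's constant. Then $H^{pri}_{N,a,k}$ has a finite second moment for all $1\le k\le N-1$, and, for fixed $a$, letting first $N\to\infty$ and then $k\to\infty$, $$\mathrm{Var}\big(H^{pri}_{N,a,k}\big)\longrightarrow\frac{1}{a+1}\,\mathrm{Var}\big(\log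 g(Y)\big).$$ More precisely, for every $k\ge1$, $\lim_{N\to\infty}\mathrm{Var}(H^{pri}_{N,a,k})=\frac{1}{a+1}\big\{Q_k+\mathrm{Var}(\log g(Y))\big\}$ with $Q_k=\sum_{j\ge k}1/j^2$, where $Q_k\to0$ as $k\to\infty$, so that these limits tend to $\frac{1}{a+1}\mathrm{Var}(\log g(Y))$. -/

import Mathlib

open MeasureTheory ProbabilityTheory Filter Topology

noncomputable section

/-- The Dirichlet distribution with parameters `α i > 0`: the law of `(Γ i / ∑ j, Γ j) i`
for independent `Γ i` with the gamma distribution of shape `α i` and rate `1`. -/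
def dirichletMeasure {ι : Type*} [Fintype ι] (α : ι → ℝ) : Measure (ι → ℝ) :=
  (Measure.pi fun i => gammaMeasure (α i) 1).map fun x i => x i / ∑ j, x j

/-- The distance between `y i` and its `k`-th closest neighbour among the other points `y j`,
`j ≠ i` (for `1 ≤ k ≤ N - 1`): the smallest `r` such that at least `k` of the other points
lie within distance `r` of `y i`. -/
def knnDist {E : Type*} [PseudoMetricSpace E] {N : ℕ} (k : ℕ) (y : Fin N → E) (i : Fin N) : ℝ :=
  sInf {r : ℝ | k ≤ (Finset.univ.filter fun j => j ≠ i ∧ dist (y j) (y i) ≤ r).card}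

/-- The statistic `T_i = log ((N - 1) π^(d/2) R_i^d / (k Γ(d/2 + 1)))`, where `R_i` is the
distance from `y i` to its `k`-th closest neighbour. -/
def knnLogVol {d N : ℕ} (k : ℕ) (y : Fin N → EuclideanSpace ℝ (Fin d)) (i : Fin N) : ℝ :=
  Real.log (((N : ℝ) - 1) * Real.pi ^ ((d : ℝ) / 2) * knnDist k y i ^ d /
    ((k : ℝ) * Real.Gamma ((d : ℝ) / 2 + 1)))

/-- The `k`-nearest-neighbour prior of entropy with weights `J i` at the points `y i`:
`∑ i, J i * T_i - L_{k-1} + γ + log k`, where `L_m = ∑_{r=1}^m 1/r`. -/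
def entropyPrior {d N : ℕ} (k : ℕ) (J : Fin N → ℝ)
    (y : Fin N → EuclideanSpace ℝ (Fin d)) : ℝ :=
  (∑ i, J i * knnLogVol k y i) - (harmonic (k - 1) : ℝ) + Real.eulerMascheroniConstant
    + Real.log k

/-- `Q_k = ∑_{j ≥ k} 1 / j ^ 2`, for `k ≥ 1`. -/
def inverseSquareTail (k : ℕ) : ℝ := ∑' j : ℕ, 1 / ((k + j : ℕ) : ℝ) ^ 2

end

set_option linter.unusedSectionVars false

/-! ### Nearest-neighbour distances -/

/-! Write T_i for `knnLogVol`, the logarithm of (N-1)/k times the volume of the k-th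
nearest-neighbour ball of Y_i. The T_i are exchangeable and independent of the weights, which sum to
one, so the variance of ∑ J_i T_i is c + (v - c) ∑ E J_i² with v = Var T_1 and c = Cov(T_1, T_2)
(`variance_sum_weight_mul`). Dirichlet weights have ∑ E J_i² = (a/N + 1)/(a + 1), which tends to
1/(a + 1). It remains to see that v tends to Q_k + Var log g(Y) and c to 0.

For v: the volume of the ball is its G-mass U divided by the mean density of G on it
(`knnLogVol_eq`). Given Y_1, the probability integral transform for the distance to Y_1 makes U the
k-th smallest of n = N - 1 independent uniform variables; so U is independent of Y_1
(`measurePreserving_knnMass`) and Var log U = ∑ 1/j² over k ≤ j ≤ n. The balls shrink to Y_1, so the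
mean density converges to g(Y_1) by Lebesgue differentiation. For L² convergence of the logarithms
there is a square-integrable majorant uniform in n (`exists_majorant_knnLogDensity`): by Besicovitch
covering, the points with some ball of mean density above e^j, or some ball of radius at most 1 of
mean density below e^(-j), have exponentially small measure up to tails of log g and of a log
distance; radii above 1 are controlled by the distances to k fixed sample points.

For c: truncate T_i to [-M, M]. The truncated variable depends only on points within a radius of
order n^(-1/d). For two distinct centres these balls are eventually disjoint, with masses O(1/n),
and functions of an i.i.d. sample that look only into disjoint sets A and B have covariance at most
4 M² n G(A) G(B) (`abs_integral_pi_mul_sub_le`), here O(1/n). Dominated convergence over pairs of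
centres finishes the truncated case (`tendsto_covariance_clip_knnLogVol`). The truncation error is
small in L² uniformly in n, since log(nU/k) has bounded fourth moments and the log mean density has
its majorant (`exists_clip_knnLogVol`). -/

/-- The number of points other than `y i` within distance `r` of `y i`. -/
noncomputable def nbrCount {E : Type*} [PseudoMetricSpace E] {N : ℕ} (y : Fin N → E) (i : Fin N) (r : ℝ) : ℕ :=
  (Finset.univ.filter fun j => j ≠ i ∧ dist (y j) (y i) ≤ r).card

section knn

variable {E : Type*} [PseudoMetricSpace E] {N k : ℕ}

lemma nbrCount_mono (y : Fin N → E) (i : Fin N) : Monotone (nbrCount y i) := fun r s hrs =>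
  Finset.card_le_card fun j => by
    simp only [Finset.mem_filter, Finset.mem_univ, true_and]
    exact fun h => ⟨h.1, h.2.trans hrs⟩

lemma nbrCount_of_neg (y : Fin N → E) (i : Fin N) {r : ℝ} (hr : r < 0) : nbrCount y i r = 0 := by
  rw [nbrCount, Finset.card_eq_zero, Finset.filter_eq_empty_iff]
  rintro j - ⟨-, h⟩
  exact absurd (dist_nonneg.trans h) (not_le.2 hr)

lemma nbrCount_eq_of_forall_le {y : Fin N → E} {i : Fin N} {r : ℝ}
    (h : ∀ j, dist (y j) (y i) ≤ r) : nbrCount y i r = N - 1 := by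
  have : (Finset.univ.filter fun j => j ≠ i ∧ dist (y j) (y i) ≤ r) = Finset.univ.erase i := by
    ext j; simp [h j]
  rw [nbrCount, this, Finset.card_erase_of_mem (Finset.mem_univ _), Finset.card_univ,
    Fintype.card_fin]

lemma exists_forall_dist_le (y : Fin N → E) (i : Fin N) : ∃ r, ∀ j, dist (y j) (y i) ≤ r :=
  ⟨∑ j, dist (y j) (y i), fun j =>
    Finset.single_le_sum (f := fun j => dist (y j) (y i)) (fun _ _ => dist_nonneg)
      (Finset.mem_univ j)⟩

/-- Within slightly larger distances there are no further points. -/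
lemma nbrCount_eventually_eq (y : Fin N → E) (i : Fin N) (r : ℝ) :
    ∀ᶠ s in 𝓝[>] r, nbrCount y i s = nbrCount y i r := by
  have h : ∀ j, ∀ᶠ s in 𝓝[>] r, (dist (y j) (y i) ≤ s ↔ dist (y j) (y i) ≤ r) := by
    intro j
    rcases le_or_gt (dist (y j) (y i)) r with hj | hj
    · filter_upwards [self_mem_nhdsWithin] with s hs
      exact iff_of_true (hj.trans (le_of_lt hs)) hj
    · filter_upwards [nhdsWithin_le_nhds (Iio_mem_nhds hj)] with s hs
      exact iff_of_false (not_le.2 hs) (not_le.2 hj)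
  filter_upwards [eventually_all.2 h] with s hs
  simp only [nbrCount, hs]

/-- The distance to the `k`-th nearest neighbour is at most `r` exactly when there are at least
`k` neighbours within distance `r`. -/
lemma knnDist_le_iff (hk : 1 ≤ k) (hN : k < N) (y : Fin N → E) (i : Fin N) (r : ℝ) :
    knnDist k y i ≤ r ↔ k ≤ nbrCount y i r := by
  have hbdd : BddBelow {r : ℝ | k ≤ nbrCount y i r} := ⟨0, fun s hs => by
    by_contra hlt
    have := nbrCount_of_neg y i (not_le.1 hlt)
    simp only [Set.mem_ofPred_eq] at hs
    omega⟩
  have hne : {r : ℝ | k ≤ nbrCount y i r}.Nonempty := by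
    obtain ⟨R, hR⟩ := exists_forall_dist_le y i
    exact ⟨R, by simp only [Set.mem_ofPred_eq, nbrCount_eq_of_forall_le hR]; omega⟩
  refine ⟨fun h => ?_, fun h => csInf_le hbdd h⟩
  -- The infimum is attained: the count is constant just to the right of `r`, so passing from `r` to
  -- a slightly larger radius loses nothing.
  obtain ⟨s, hs, hrs⟩ := ((nbrCount_eventually_eq y i r).and self_mem_nhdsWithin).exists
  obtain ⟨t, ht, hts⟩ := (csInf_lt_iff hbdd hne).1 (lt_of_le_of_lt h hrs)
  exact hs ▸ le_trans ht (nbrCount_mono y i hts.le)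

lemma knnDist_nonneg (hk : 1 ≤ k) (hN : k < N) (y : Fin N → E) (i : Fin N) :
    0 ≤ knnDist k y i := by
  by_contra h
  push Not at h
  have h1 := (knnDist_le_iff hk hN y i _).1 le_rfl
  have h2 := nbrCount_of_neg y i h
  omega

lemma knnDist_pos (hk : 1 ≤ k) (hN : k < N) (y : Fin N → E) (i : Fin N)
    (h : ∀ j, j ≠ i → 0 < dist (y j) (y i)) : 0 < knnDist k y i := by
  refine lt_of_not_ge fun h0 => ?_
  rw [knnDist_le_iff hk hN] at h0
  have : nbrCount y i 0 = 0 := by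
    rw [nbrCount, Finset.card_eq_zero, Finset.filter_eq_empty_iff]
    rintro j - ⟨hj, h'⟩
    exact absurd h' (not_le.2 (h j hj))
  omega

lemma nbrCount_comp_perm (y : Fin N → E) (σ : Equiv.Perm (Fin N)) (i : Fin N) (r : ℝ) :
    nbrCount (y ∘ σ) i r = nbrCount y (σ i) r := by
  refine Finset.card_bij (fun j _ => σ j) ?_ ?_ ?_
  · intro j; simp
  · intro a _ b _ h; exact σ.injective h
  · intro b hb
    refine ⟨σ.symm b, ?_, by simp⟩
    simp only [Finset.mem_filter, Finset.mem_univ, true_and, Function.comp_apply,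
      Equiv.apply_symm_apply] at hb ⊢
    exact ⟨fun h => hb.1 (by simp [← h]), hb.2⟩

lemma knnDist_comp_perm (y : Fin N → E) (σ : Equiv.Perm (Fin N)) (i : Fin N) :
    knnDist k (y ∘ σ) i = knnDist k y (σ i) := by
  change sInf {r | k ≤ nbrCount (y ∘ σ) i r} = sInf {r | k ≤ nbrCount y (σ i) r}
  simp only [nbrCount_comp_perm]

/-- A sublevel set of the distance is a superlevel set of a finite sum of indicators of measurable
conditions. -/
lemma measurable_knnDist [MeasurableSpace E] [OpensMeasurableSpace E]
    [SecondCountableTopology E] (hk : 1 ≤ k) (hN : k < N) (i : Fin N) :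
    Measurable fun y : Fin N → E => knnDist k y i := by
  refine measurable_of_Iic fun r => ?_
  have : (fun y : Fin N → E => knnDist k y i) ⁻¹' Set.Iic r =
      (fun y : Fin N → E => ∑ j, if j ≠ i ∧ dist (y j) (y i) ≤ r then 1 else 0) ⁻¹' Set.Ici k := by
    ext y
    simp only [Set.mem_preimage, Set.mem_Iic, Set.mem_Ici, knnDist_le_iff hk hN, nbrCount,
      Finset.card_filter]
  rw [this]
  refine (Finset.measurable_sum _ fun j _ => ?_) (Set.to_countable _).measurableSet
  refine Measurable.ite ?_ measurable_const measurable_const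
  refine (MeasurableSet.const _).inter ?_
  exact measurableSet_le ((measurable_pi_apply j).dist (measurable_pi_apply i)) measurable_const

/-- Truncated at `ρ`, the distance to the `k`-th nearest neighbour of `y i` does not depend on
the points at distance at least `ρ` from `y i`. -/
lemma min_knnDist_eq (hk : 1 ≤ k) (hN : k < N) {y y' : Fin N → E} {i : Fin N} {ρ : ℝ}
    (hi : y i = y' i)
    (h : ∀ j, y j = y' j ∨ (ρ ≤ dist (y j) (y i) ∧ ρ ≤ dist (y' j) (y' i))) :
    min (knnDist k y i) ρ = min (knnDist k y' i) ρ := by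
  have hc : ∀ r < ρ, nbrCount y i r = nbrCount y' i r := by
    intro r hr
    unfold nbrCount
    congr 1
    ext j
    simp only [Finset.mem_filter, Finset.mem_univ, true_and]
    rcases h j with h | h
    · rw [h, hi]
    · have h1 := h.1; have h2 := h.2
      constructor <;> rintro ⟨-, h'⟩ <;> linarith
  refine le_antisymm ?_ ?_
  · refine le_min ?_ (min_le_right _ _)
    by_contra hlt
    push Not at hlt
    have h1 := lt_of_lt_of_le hlt (min_le_right _ _)
    have h2 := (knnDist_le_iff hk hN y' i _).1 le_rfl
    rw [← hc _ h1, ← knnDist_le_iff hk hN] at h2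
    exact absurd (lt_of_lt_of_le hlt (min_le_left _ _)) (not_lt.2 h2)
  · refine le_min ?_ (min_le_right _ _)
    by_contra hlt
    push Not at hlt
    have h1 := lt_of_lt_of_le hlt (min_le_right _ _)
    have h2 := (knnDist_le_iff hk hN y i _).1 le_rfl
    rw [hc _ h1, ← knnDist_le_iff hk hN] at h2
    exact absurd (lt_of_lt_of_le hlt (min_le_left _ _)) (not_lt.2 h2)

lemma nbrCount_cons_zero {n : ℕ} (x : E) (z : Fin n → E) (r : ℝ) :
    nbrCount (Fin.cons x z : Fin (n + 1) → E) 0 r =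
      (Finset.univ.filter fun j => dist (z j) x ≤ r).card := by
  unfold nbrCount
  rw [Finset.card_filter, Finset.card_filter, Fin.sum_univ_succ]
  simp [Fin.succ_ne_zero]

/-- The samples are initial segments of one sequence, so that different sample sizes can be compared
pointwise. -/
lemma knnDist_zero_le_iff {n : ℕ} (hk : 1 ≤ k) (hn : k ≤ n) (u : ℕ → E) (r : ℝ) :
    knnDist k (fun i : Fin (n + 1) => u i) 0 ≤ r ↔
      k ≤ ((Finset.range n).filter fun j => dist (u (j + 1)) (u 0) ≤ r).card := by
  rw [knnDist_le_iff hk (by omega)]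
  unfold nbrCount
  rw [Finset.card_filter, Finset.card_filter, Fin.sum_univ_succ, Finset.sum_range]
  simp [Fin.succ_ne_zero]

lemma knnDist_zero_antitone {n m : ℕ} (hk : 1 ≤ k) (hn : k ≤ n) (hnm : n ≤ m) (u : ℕ → E) :
    knnDist k (fun i : Fin (m + 1) => u i) 0 ≤ knnDist k (fun i : Fin (n + 1) => u i) 0 := by
  rw [knnDist_zero_le_iff hk (by omega)]
  exact ((knnDist_zero_le_iff hk hn u _).1 le_rfl).trans
    (Finset.card_le_card (Finset.filter_subset_filter _ (by simpa using hnm)))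

/-- Bounds the distance for all `n` at once by quantities of the first `k` further points; this
feeds the majorant uniform in `n`. -/
lemma knnDist_zero_le_of_forall {n : ℕ} (hk : 1 ≤ k) (hn : k ≤ n) (u : ℕ → E) {r : ℝ}
    (h : ∀ j < k, dist (u (j + 1)) (u 0) ≤ r) :
    knnDist k (fun i : Fin (n + 1) => u i) 0 ≤ r := by
  rw [knnDist_zero_le_iff hk hn]
  calc k = (Finset.range k).card := by simp
    _ ≤ _ := Finset.card_le_card fun j hj => by
      simp only [Finset.mem_range, Finset.mem_filter] at hj ⊢
      exact ⟨by omega, h j hj⟩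

end knn

/-! ### The law of the mass of the nearest-neighbour ball -/

lemma continuous_cdf_of_noAtoms (ν : Measure ℝ) [IsProbabilityMeasure ν] [NullSingletonClass ν] :
    Continuous (cdf ν) := by
  refine continuous_iff_continuousAt.2 fun x => ?_
  rw [(monotone_cdf ν).continuousAt_iff_leftLim_eq_rightLim, StieltjesFunction.rightLim_eq]
  have h := (cdf ν).measure_singleton x
  rw [measure_cdf, measure_singleton] at h
  refine le_antisymm ((monotone_cdf ν).leftLim_le le_rfl) ?_
  have := ENNReal.ofReal_eq_zero.1 h.symm
  linarith

/-- The probability integral transform. -/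
lemma measure_cdf_le (ν : Measure ℝ) [IsProbabilityMeasure ν] [NullSingletonClass ν] {v : ℝ} (h0 : 0 ≤ v)
    (h1 : v ≤ 1) : ν {t | cdf ν t ≤ v} = ENNReal.ofReal v := by
  rcases h1.eq_or_lt with rfl | h1
  · simp [cdf_le_one]
  set S := {t | cdf ν t ≤ v}
  have hc := continuous_cdf_of_noAtoms ν
  have hS : IsClosed S := isClosed_le hc continuous_const
  rcases S.eq_empty_or_nonempty with he | hne
  · have : v ≤ 0 := by
      refine ge_of_tendsto' (tendsto_cdf_atBot ν) fun t => le_of_lt (not_le.1 fun h => ?_)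
      have : t ∈ S := h
      simp [he] at this
    simp [he, le_antisymm this h0]
  -- The sublevel set is a half-line closed at its supremum, where the continuous distribution
  -- function takes the value `v` exactly.
  · have hb : BddAbove S := by
      obtain ⟨T, hT⟩ := ((tendsto_cdf_atTop ν).eventually (lt_mem_nhds h1)).exists
      refine ⟨T, fun t ht => le_of_lt (not_le.1 fun h => ?_)⟩
      exact absurd (hT.trans_le ((monotone_cdf ν) h)) (not_lt.2 ht)
    have hmem : sSup S ∈ S := hS.csSup_mem hne hb
    have hSI : S = Set.Iic (sSup S) := by
      ext t
      exact ⟨fun h => le_csSup hb h, fun h => ((monotone_cdf ν) h).trans hmem⟩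
    have hval : cdf ν (sSup S) = v := by
      refine le_antisymm hmem ?_
      refine ge_of_tendsto (hc.continuousAt.tendsto.mono_left
        (nhdsWithin_le_nhds : 𝓝[>] (sSup S) ≤ _)) ?_
      filter_upwards [self_mem_nhdsWithin] with t ht
      exact le_of_lt (not_le.1 fun h => absurd (le_csSup hb h) (not_le.2 ht))
    rw [hSI, ← ofReal_cdf, hval]

/-! ### Binomial counts and uniform order statistics -/

section binomial

variable {E : Type*} [MeasurableSpace E]

/-- The number of points of an i.i.d. sample in a given set is binomial. -/
lemma measure_pi_card_eq (μ : Measure E) [IsProbabilityMeasure μ] {n : ℕ} {A : Set E}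
    [DecidablePred (· ∈ A)] (hA : MeasurableSet A) (m : ℕ) :
    (Measure.pi fun _ : Fin n => μ).real
      {z | (Finset.univ.filter fun j => z j ∈ A).card = m} =
      n.choose m * μ.real A ^ m * (1 - μ.real A) ^ (n - m) := by
  -- Split according to the set `s` of indices whose points fall in `A`; each piece is a box.
  have hset : {z : Fin n → E | (Finset.univ.filter fun j => z j ∈ A).card = m} =
      ⋃ s ∈ (Finset.univ : Finset (Fin n)).powersetCard m,
        Set.univ.pi fun j => if j ∈ s then A else Aᶜ := by
    ext z
    simp only [Set.mem_ofPred_eq, Set.mem_iUnion, Set.mem_pi, Set.mem_univ, true_imp_iff,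
      Finset.mem_powersetCard_univ, exists_prop]
    constructor
    · intro h
      refine ⟨_, h, fun j => ?_⟩
      by_cases hj : z j ∈ A <;> simp [hj]
    · rintro ⟨s, hs, h⟩
      rw [← hs]
      congr 1
      ext j
      have := h j
      by_cases hj : j ∈ s <;> simp_all
  rw [hset, measureReal_biUnion_finset]
  · have : ∀ s ∈ (Finset.univ : Finset (Fin n)).powersetCard m,
        (Measure.pi fun _ : Fin n => μ).real (Set.univ.pi fun j => if j ∈ s then A else Aᶜ) =
          μ.real A ^ m * (1 - μ.real A) ^ (n - m) := by
      intro s hs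
      rw [Finset.mem_powersetCard_univ] at hs
      rw [measureReal_def, Measure.pi_pi, ENNReal.toReal_prod]
      have : ∀ j, (μ (if j ∈ s then A else Aᶜ)).toReal =
          if j ∈ s then μ.real A else 1 - μ.real A := by
        intro j
        split_ifs
        · rfl
        · exact probReal_compl_eq_one_sub hA
      simp_rw [this]
      rw [Finset.prod_ite]
      simp only [Finset.prod_const, Finset.filter_mem_eq_inter, Finset.univ_inter, hs]
      congr 2
      rw [Finset.filter_not, Finset.filter_mem_eq_inter, Finset.univ_inter,
        Finset.card_sdiff_of_subset (Finset.subset_univ s), hs, Finset.card_univ,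
        Fintype.card_fin]
    rw [Finset.sum_congr rfl this, Finset.sum_const, Finset.card_powersetCard, Finset.card_univ,
      Fintype.card_fin, nsmul_eq_mul, mul_assoc]
  · intro s hs t ht hst
    refine Set.disjoint_left.2 fun z hz hz' => hst ?_
    ext j
    have h1 := hz j trivial
    have h2 := hz' j trivial
    by_cases hj : j ∈ s <;> by_cases hj' : j ∈ t <;> simp_all
  · intro s _
    refine MeasurableSet.univ_pi fun j => ?_
    split_ifs
    exacts [hA, hA.compl]

lemma measure_pi_le_card (μ : Measure E) [IsProbabilityMeasure μ] {n : ℕ} {A : Set E}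
    [DecidablePred (· ∈ A)] (hA : MeasurableSet A) (k : ℕ) :
    (Measure.pi fun _ : Fin n => μ).real
      {z | k ≤ (Finset.univ.filter fun j => z j ∈ A).card} =
      ∑ m ∈ Finset.Ico k (n + 1), n.choose m * μ.real A ^ m * (1 - μ.real A) ^ (n - m) := by
  have hset : {z : Fin n → E | k ≤ (Finset.univ.filter fun j => z j ∈ A).card} =
      ⋃ m ∈ Finset.Ico k (n + 1), {z | (Finset.univ.filter fun j => z j ∈ A).card = m} := by
    ext z
    have := Finset.card_le_univ (Finset.univ.filter fun j => z j ∈ A)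
    simp only [Fintype.card_fin] at this
    simp
    omega
  rw [hset, measureReal_biUnion_finset]
  · exact Finset.sum_congr rfl fun m _ => measure_pi_card_eq μ hA m
  · intro s hs t ht hst
    exact Set.disjoint_left.2 fun z hz hz' => hst (hz.symm.trans hz')
  · intro m _
    have : Measurable fun z : Fin n → E => ∑ j, if z j ∈ A then 1 else 0 :=
      Finset.measurable_sum _ fun j _ => Measurable.ite
        (measurable_pi_apply j hA) measurable_const measurable_const
    simp only [Finset.card_filter]
    exact this (Set.to_countable {m}).measurableSet

end binomial

/-- The density of the `k`-th smallest of `n` independent uniform variables. -/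
noncomputable def orderDensity (k n : ℕ) (v : ℝ) : ℝ :=
  n * (n - 1).choose (k - 1) * v ^ (k - 1) * (1 - v) ^ (n - k)

/-- The law of the `k`-th smallest of `n` independent uniform variables. -/
noncomputable def orderMeasure (k n : ℕ) : Measure ℝ :=
  (volume.restrict (Set.Ioc 0 1)).withDensity fun v => ENNReal.ofReal (orderDensity k n v)

lemma continuous_orderDensity (k n : ℕ) : Continuous (orderDensity k n) := by
  unfold orderDensity; fun_prop

lemma orderDensity_nonneg (k n : ℕ) {v : ℝ} (h0 : 0 ≤ v) (h1 : v ≤ 1) :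
    0 ≤ orderDensity k n v := by
  unfold orderDensity
  have := sub_nonneg.2 h1
  positivity

/-- The derivative of a Bernstein polynomial is a multiple of a difference of two neighbouring ones
of degree `n - 1`, so the derivative of the tail sum telescopes to a single term. -/
lemma hasDerivAt_binomialTail {k n : ℕ} (hk : 1 ≤ k) (hn : k ≤ n) (v : ℝ) :
    HasDerivAt (fun v : ℝ => ∑ m ∈ Finset.Ico k (n + 1),
      (n.choose m : ℝ) * v ^ m * (1 - v) ^ (n - m)) (orderDensity k n v) v := by
  have hfun : (fun v : ℝ => ∑ m ∈ Finset.Ico k (n + 1),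
      (n.choose m : ℝ) * v ^ m * (1 - v) ^ (n - m)) =
      fun v => (∑ m ∈ Finset.Ico k (n + 1), bernsteinPolynomial ℝ n m).eval v := by
    ext v
    simp [Polynomial.eval_finsetSum, bernsteinPolynomial]
  rw [hfun]
  suffices h : orderDensity k n v =
      (Polynomial.derivative (∑ m ∈ Finset.Ico k (n + 1), bernsteinPolynomial ℝ n m)).eval v by
    rw [h]
    exact Polynomial.hasDerivAt _ v
  obtain ⟨k, rfl⟩ : ∃ l, k = l + 1 := ⟨k - 1, by omega⟩
  rw [← Finset.sum_Ico_add' (fun m => bernsteinPolynomial ℝ n m) k n 1, Polynomial.derivative_sum]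
  simp_rw [bernsteinPolynomial.derivative_succ]
  rw [← Finset.mul_sum]
  have : ∑ m ∈ Finset.Ico k n, (bernsteinPolynomial ℝ (n - 1) m - bernsteinPolynomial ℝ (n - 1) (m + 1))
      = bernsteinPolynomial ℝ (n - 1) k := by
    have h := Finset.sum_Ico_sub (fun m => bernsteinPolynomial ℝ (n - 1) m) (by omega : k ≤ n)
    rw [bernsteinPolynomial.eq_zero_of_lt ℝ (show n - 1 < n by omega)] at h
    rw [← neg_inj, ← Finset.sum_neg_distrib]
    simpa using h
  rw [this]
  simp only [orderDensity, bernsteinPolynomial, Polynomial.eval_mul, Polynomial.eval_natCast,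
    Polynomial.eval_pow, Polynomial.eval_X, Polynomial.eval_sub, Polynomial.eval_one,
    add_tsub_cancel_right]
  rw [show n - 1 - k = n - (k + 1) by omega]
  ring

lemma orderMeasure_Iic {k n : ℕ} (hk : 1 ≤ k) (hn : k ≤ n) {v : ℝ} (h0 : 0 ≤ v) (h1 : v ≤ 1) :
    orderMeasure k n (Set.Iic v) = ENNReal.ofReal (∑ m ∈ Finset.Ico k (n + 1),
      (n.choose m : ℝ) * v ^ m * (1 - v) ^ (n - m)) := by
  rw [orderMeasure, withDensity_apply _ measurableSet_Iic,
    Measure.restrict_restrict measurableSet_Iic]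
  have hs : Set.Iic v ∩ Set.Ioc (0 : ℝ) 1 = Set.Ioc 0 v := by
    ext t; simp only [Set.mem_inter_iff, Set.mem_Iic, Set.mem_Ioc]
    constructor
    · rintro ⟨a, b, c⟩; exact ⟨b, a⟩
    · rintro ⟨a, b⟩; exact ⟨b, a, b.trans h1⟩
  rw [hs, ← ofReal_integral_eq_lintegral_ofReal, ← intervalIntegral.integral_of_le h0,
    intervalIntegral.integral_eq_sub_of_hasDerivAt
      (fun x _ => hasDerivAt_binomialTail hk hn x)
      ((continuous_orderDensity k n).intervalIntegrable _ _)]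
  · congr 1
    rw [sub_eq_self]
    refine Finset.sum_eq_zero fun m hm => ?_
    rw [Finset.mem_Ico] at hm
    rw [zero_pow (by omega)]; simp
  · exact (continuous_orderDensity k n).integrableOn_Ioc
  · filter_upwards [ae_restrict_mem measurableSet_Ioc] with t ht
    exact orderDensity_nonneg k n ht.1.le (ht.2.trans h1)

instance (k n : ℕ) : IsFiniteMeasure (orderMeasure k n) := by
  refine isFiniteMeasure_withDensity_ofReal ?_
  exact (continuous_orderDensity k n).integrableOn_Ioc.2

/-- Integrals against the law of an order statistic. -/
lemma integral_orderMeasure (k n : ℕ) (f : ℝ → ℝ) :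
    ∫ v, f v ∂(orderMeasure k n) = ∫ v in (0 : ℝ)..1, orderDensity k n v * f v := by
  rw [orderMeasure, integral_withDensity_eq_integral_toReal_smul
    (continuous_orderDensity k n).measurable.ennreal_ofReal (by simp),
    intervalIntegral.integral_of_le zero_le_one]
  refine setIntegral_congr_fun measurableSet_Ioc fun v hv => ?_
  simp [ENNReal.toReal_ofReal (orderDensity_nonneg k n hv.1.le hv.2)]

lemma integrable_orderMeasure (k n : ℕ) (f : ℝ → ℝ) :
    Integrable f (orderMeasure k n) ↔
      IntervalIntegrable (fun v => orderDensity k n v * f v) volume 0 1 := by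
  rw [orderMeasure, integrable_withDensity_iff_integrable_smul'
    (continuous_orderDensity k n).measurable.ennreal_ofReal (by simp),
    intervalIntegrable_iff_integrableOn_Ioc_of_le zero_le_one]
  refine integrableOn_congr_fun (fun v hv => ?_) measurableSet_Ioc
  simp [ENNReal.toReal_ofReal (orderDensity_nonneg k n hv.1.le hv.2)]

/-! ### The mass of the nearest-neighbour ball -/

section mass

variable {E : Type*} [PseudoMetricSpace E] [MeasurableSpace E]

/-- The mass of the ball around `y 0` that reaches its `k`-th nearest neighbour. -/
noncomputable def knnMass (G : Measure E) (k : ℕ) {n : ℕ} (y : Fin (n + 1) → E) : ℝ :=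
  G.real (Metric.closedBall (y 0) (knnDist k y 0))

/-- Ball mass is monotone in the radius, so the mass of the ball to the `k`-th nearest point is the
`k`-th smallest of the masses of the balls to the individual points. -/
lemma knnMass_cons_le_iff (G : Measure E) [IsFiniteMeasure G] {k n : ℕ} (hk : 1 ≤ k) (hn : k ≤ n)
    (x : E) (z : Fin n → E) (v : ℝ) :
    knnMass G k (Fin.cons x z : Fin (n + 1) → E) ≤ v ↔
      k ≤ (Finset.univ.filter fun j => G.real (Metric.closedBall x (dist (z j) x)) ≤ v).card := by
  have hmono : Monotone fun r => G.real (Metric.closedBall x r) := fun r s h =>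
    measureReal_mono (Metric.closedBall_subset_closedBall h)
  have hiff := fun r => (knnDist_le_iff hk (by omega : k < n + 1) (Fin.cons x z) 0 r)
  simp only [nbrCount_cons_zero] at hiff
  unfold knnMass
  simp only [Fin.cons_zero]
  constructor
  · intro h
    refine ((hiff _).1 le_rfl).trans (Finset.card_le_card fun j => ?_)
    simp only [Finset.mem_filter, Finset.mem_univ, true_and]
    exact fun hj => (hmono hj).trans h
  · intro h
    have hne : (Finset.univ.filter fun j =>
        G.real (Metric.closedBall x (dist (z j) x)) ≤ v).Nonempty := by
      rw [← Finset.card_pos]; omega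
    -- The mass may be constant over a range of radii, so the comparison radius is that of the
    -- farthest point whose mass is at most `v`.
    obtain ⟨i, hi, hmax⟩ := Finset.exists_max_image _ (fun j => dist (z j) x) hne
    refine (hmono ((hiff (dist (z i) x)).2 (h.trans (Finset.card_le_card fun j hj => ?_)))).trans
      (Finset.mem_filter.1 hi).2
    simpa using hmax j hj

variable [OpensMeasurableSpace E] [SecondCountableTopology E]

/-- Given `y 0`, the mass of its nearest-neighbour ball is a uniform order statistic. -/
lemma map_knnMass_cons (G : Measure E) [IsProbabilityMeasure G] {k n : ℕ} (hk : 1 ≤ k)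
    (hn : k ≤ n) (x : E) (hs : ∀ r, G (Metric.sphere x r) = 0)
    (hmeas : Measurable fun z : Fin n → E => knnMass G k (Fin.cons x z : Fin (n + 1) → E)) :
    (Measure.pi fun _ : Fin n => G).map (fun z => knnMass G k (Fin.cons x z : Fin (n + 1) → E)) =
      orderMeasure k n := by
  have hd : Measurable fun z : E => dist z x := measurable_id.dist measurable_const
  have := Measure.isProbabilityMeasure_map (μ := G) hd.aemeasurable
  have hna : NullSingletonClass (G.map fun z => dist z x) := ⟨fun r => by
    rw [Measure.map_apply hd (measurableSet_singleton r)]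
    exact hs r⟩
  have hcdf : ∀ r, cdf (G.map fun z => dist z x) r = G.real (Metric.closedBall x r) := by
    intro r
    rw [cdf_eq_real, map_measureReal_apply hd measurableSet_Iic]
    rfl
  have hq : Measurable fun z : E => G.real (Metric.closedBall x (dist z x)) := by
    simp_rw [← hcdf]
    exact (monotone_cdf _).measurable.comp hd
  -- Null spheres make the distance to `x` atomless, so the mass of the ball reaching a random point
  -- is uniform; the number of points with mass at most `v` is then binomial with success
  -- probability `v`.
  have hunif : ∀ v, 0 ≤ v → v ≤ 1 →
      G.real {z | G.real (Metric.closedBall x (dist z x)) ≤ v} = v := by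
    intro v h0 h1
    have h := measure_cdf_le (G.map fun z => dist z x) h0 h1
    rw [Measure.map_apply hd (measurableSet_le (monotone_cdf _).measurable measurable_const)] at h
    simp only [hcdf] at h
    have h' := congrArg ENNReal.toReal h
    rwa [ENNReal.toReal_ofReal h0] at h'
  have hIic : ∀ v, 0 ≤ v → v ≤ 1 →
      (Measure.pi fun _ : Fin n => G).map
        (fun z => knnMass G k (Fin.cons x z : Fin (n + 1) → E)) (Set.Iic v) =
      orderMeasure k n (Set.Iic v) := by
    intro v h0 h1
    rw [Measure.map_apply hmeas measurableSet_Iic, orderMeasure_Iic hk hn h0 h1]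
    have hb := measure_pi_le_card G (n := n) (A := {z | G.real (Metric.closedBall x (dist z x)) ≤ v})
      (measurableSet_le hq measurable_const) k
    rw [hunif v h0 h1] at hb
    rw [← hb, ofReal_measureReal]
    congr 1
    ext z
    simp only [Set.mem_preimage, Set.mem_Iic, knnMass_cons_le_iff G hk hn x z v, Set.mem_ofPred_eq]
  have hle1 : ∀ z : Fin n → E, knnMass G k (Fin.cons x z : Fin (n + 1) → E) ≤ 1 :=
    fun z => measureReal_le_one
  have hge0 : ∀ z : Fin n → E, 0 ≤ knnMass G k (Fin.cons x z : Fin (n + 1) → E) :=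
    fun z => measureReal_nonneg
  refine Measure.ext_of_Iic _ _ fun v => ?_
  rcases lt_or_ge v 0 with h | h
  · rw [Measure.map_apply hmeas measurableSet_Iic]
    have h1 : (fun z : Fin n → E => knnMass G k (Fin.cons x z : Fin (n + 1) → E)) ⁻¹' Set.Iic v = ∅ := by
      ext z
      simp only [Set.mem_preimage, Set.mem_Iic, Set.mem_empty_iff_false, iff_false, not_le]
      exact h.trans_le (hge0 z)
    have h2 : orderMeasure k n (Set.Iic v) ≤ orderMeasure k n (Set.Iic 0) :=
      measure_mono (Set.Iic_subset_Iic.2 h.le)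
    have h3 : orderMeasure k n (Set.Iic 0) = 0 := by
      rw [orderMeasure_Iic hk hn le_rfl zero_le_one, ENNReal.ofReal_eq_zero]
      refine (Finset.sum_eq_zero fun m hm => ?_).le
      rw [Finset.mem_Ico] at hm
      rw [zero_pow (by omega)]; simp
    rw [h1, measure_empty]
    exact (le_antisymm (h2.trans h3.le) (zero_le)).symm
  · rcases le_or_gt v 1 with h1 | h1
    · exact hIic v h h1
    · have e1 := hIic 1 zero_le_one le_rfl
      rw [Measure.map_apply hmeas measurableSet_Iic] at e1 ⊢
      have e2 : (fun z : Fin n → E => knnMass G k (Fin.cons x z : Fin (n + 1) → E)) ⁻¹' Set.Iic v =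
          (fun z : Fin n → E => knnMass G k (Fin.cons x z : Fin (n + 1) → E)) ⁻¹' Set.Iic 1 := by
        ext z
        simp only [Set.mem_preimage, Set.mem_Iic]
        exact iff_of_true ((hle1 z).trans h1.le) (hle1 z)
      rw [e2, e1, orderMeasure, withDensity_apply _ measurableSet_Iic,
        withDensity_apply _ measurableSet_Iic, Measure.restrict_restrict measurableSet_Iic,
        Measure.restrict_restrict measurableSet_Iic]
      have : ∀ w : ℝ, 1 ≤ w → Set.Iic w ∩ Set.Ioc (0 : ℝ) 1 = Set.Ioc 0 1 := fun w hw =>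
        Set.inter_eq_right.2 fun t ht => ht.2.trans hw
      rw [this 1 le_rfl, this v h1.le]

end mass

/-! ### Moments of the logarithm of a uniform order statistic -/

/-- Four factors |log v| ≤ 8 v^(-1/8) leave an inverse square root, still integrable at 0. -/
lemma abs_log_pow_le {v : ℝ} (h0 : 0 < v) (h1 : v ≤ 1) {j : ℕ} (hj : j ≤ 4) :
    |Real.log v ^ j| ≤ 8 ^ 4 * v ^ (-(1 / 2) : ℝ) := by
  have h := Real.abs_log_mul_self_rpow_lt v (1 / 8) h0 h1 (by norm_num)
  have hv : (0 : ℝ) < v ^ (1 / 8 : ℝ) := Real.rpow_pos_of_pos h0 _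
  have hb : |Real.log v| ≤ 8 * v ^ (-(1 / 8) : ℝ) := by
    rw [abs_mul, abs_of_pos hv] at h
    rw [Real.rpow_neg h0.le, ← div_eq_mul_inv, le_div_iff₀ hv]
    norm_num at h ⊢
    exact h.le
  have h1' : (1 : ℝ) ≤ v ^ (-(1 / 8) : ℝ) :=
    Real.one_le_rpow_of_pos_of_le_one_of_nonpos h0 h1 (by norm_num)
  calc |Real.log v ^ j| = |Real.log v| ^ j := abs_pow _ _
    _ ≤ (8 * v ^ (-(1 / 8) : ℝ)) ^ j := by gcongr
    _ ≤ (8 * v ^ (-(1 / 8) : ℝ)) ^ 4 := pow_le_pow_right₀ (by linarith) hj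
    _ = 8 ^ 4 * v ^ (-(1 / 2) : ℝ) := by
      rw [mul_pow, ← Real.rpow_natCast (v ^ _), ← Real.rpow_mul h0.le]
      norm_num

lemma intervalIntegrable_mul_log_pow {p : ℝ → ℝ} (hp : Continuous p) {j : ℕ} (hj : j ≤ 4) :
    IntervalIntegrable (fun v => p v * Real.log v ^ j) volume 0 1 := by
  refine IntervalIntegrable.continuousOn_mul ?_ hp.continuousOn
  have hi : IntervalIntegrable (fun v : ℝ => 8 ^ 4 * v ^ (-(1 / 2) : ℝ)) volume 0 1 :=
    (intervalIntegral.intervalIntegrable_rpow' (by norm_num)).const_mul _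
  refine hi.mono_fun' ((Real.measurable_log.pow_const j).aestronglyMeasurable) ?_
  rw [Set.uIoc_of_le zero_le_one]
  filter_upwards [ae_restrict_mem measurableSet_Ioc] with v hv
  exact abs_log_pow_le hv.1 hv.2 hj

/-- Rewriting v log² v as 4 (√v log √v)² reduces continuity at 0 to that of x log x. -/
lemma continuous_mul_log_sq : ContinuousOn (fun v : ℝ => v * Real.log v ^ 2) (Set.Icc 0 1) := by
  have h : ContinuousOn (fun v : ℝ => 4 * (√v * Real.log √v) ^ 2) (Set.Icc 0 1) :=
    ((Real.continuous_mul_log.comp Real.continuous_sqrt).pow 2 |>.const_mul 4).continuousOn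
  refine h.congr fun v hv => ?_
  simp only [Real.log_sqrt hv.1, mul_pow, Real.sq_sqrt hv.1]
  ring

lemma integral_pow_mul_log (l : ℕ) :
    ∫ v in (0 : ℝ)..1, v ^ l * Real.log v ^ 1 = -(1 / (l + 1 : ℝ) ^ 2) := by
  have hl : (l + 1 : ℝ) ≠ 0 := by positivity
  rw [intervalIntegral.integral_eq_sub_of_hasDerivAt_of_le zero_le_one
    (f := fun v : ℝ => v ^ l * (v * Real.log v) / (l + 1) - v ^ (l + 1) / (l + 1) ^ 2)]
  · simp
  · have := Real.continuous_mul_log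
    fun_prop
  · intro v hv
    have h0 : v ≠ 0 := hv.1.ne'
    have h1 := ((hasDerivAt_pow (l + 1) v).mul (Real.hasDerivAt_log h0)).div_const (l + 1 : ℝ)
    have h2 := (hasDerivAt_pow (l + 1) v).div_const ((l + 1 : ℝ) ^ 2)
    have h3 := h1.sub h2
    convert h3 using 1
    · ext w; simp [pow_succ]; ring
    · simp; field_simp; ring
  · exact intervalIntegrable_mul_log_pow (continuous_pow l) (by norm_num)

lemma integral_pow_mul_log_sq (l : ℕ) :
    ∫ v in (0 : ℝ)..1, v ^ l * Real.log v ^ 2 = 2 / (l + 1 : ℝ) ^ 3 := by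
  have hl : (l + 1 : ℝ) ≠ 0 := by positivity
  rw [intervalIntegral.integral_eq_sub_of_hasDerivAt_of_le zero_le_one
    (f := fun v : ℝ => v ^ l * (v * Real.log v ^ 2) / (l + 1)
      - 2 * (v ^ l * (v * Real.log v)) / (l + 1) ^ 2 + 2 * v ^ (l + 1) / (l + 1) ^ 3)]
  · simp
  · have h1 := Real.continuous_mul_log
    have h2 := continuous_mul_log_sq
    fun_prop
  · intro v hv
    have h0 : v ≠ 0 := hv.1.ne'
    have hL := Real.hasDerivAt_log h0
    have h1 := ((hasDerivAt_pow (l + 1) v).mul (hL.pow 2)).div_const (l + 1 : ℝ)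
    have h2 := (((hasDerivAt_pow (l + 1) v).mul hL).const_mul 2).div_const ((l + 1 : ℝ) ^ 2)
    have h3 := ((hasDerivAt_pow (l + 1) v).const_mul 2).div_const ((l + 1 : ℝ) ^ 3)
    have h4 := (h1.sub h2).add h3
    convert h4 using 1
    · ext w; simp [pow_succ]; ring
    · simp; field_simp; ring
  · exact intervalIntegrable_mul_log_pow (continuous_pow l) (by norm_num)

lemma orderDensity_succ_succ (l m : ℕ) (v : ℝ) :
    orderDensity (l + 1) (l + 1 + m) v = (l + 1 + m) * (l + m).choose l * v ^ l * (1 - v) ^ m := by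
  rw [orderDensity, show l + 1 + m - (l + 1) = m by omega, show l + 1 + m - 1 = l + m by omega]
  push_cast
  simp

/-- Writing one factor of (1 - v)^(m+1) as 1 - v gives two densities with exponent `m`. Induction on
`m`, for all `l` at once, thus reduces moments to integrals against pure powers of v. -/
lemma orderDensity_recurrence (l m : ℕ) (v : ℝ) :
    (m + 1) * orderDensity (l + 1) (l + 1 + (m + 1)) v =
      (l + m + 2) * orderDensity (l + 1) (l + 1 + m) v
        - (l + 1) * orderDensity (l + 1 + 1) (l + 1 + 1 + m) v := by
  have h1 : ((l + m + 1).choose (l + 1) : ℝ) * (l + 1) = (l + m + 1) * (l + m).choose l := by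
    exact_mod_cast (Nat.add_one_mul_choose_eq (l + m) l).symm
  have h2 : ((l + m + 1).choose l : ℝ) * (m + 1) = (l + m + 1) * (l + m).choose l := by
    have := (Nat.add_one_mul_choose_eq (l + m) m).symm
    rw [← Nat.choose_symm_of_eq_add (show l + m + 1 = l + (m + 1) by ring),
      ← Nat.choose_symm_of_eq_add (show l + m = l + m by ring)] at this
    exact_mod_cast this
  rw [orderDensity_succ_succ, orderDensity_succ_succ, orderDensity_succ_succ,
    show l + (m + 1) = l + m + 1 by ring, show l + 1 + m = l + m + 1 by ring]
  push_cast
  linear_combination (l + 1 + (m + 1)) * v ^ l * (1 - v) ^ (m + 1) * h2 +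
    (l + 1 + 1 + m) * v ^ (l + 1) * (1 - v) ^ m * h1

lemma integral_orderDensity_recurrence (l m : ℕ) {f : ℝ → ℝ}
    (hf : ∀ p : ℝ → ℝ, Continuous p → IntervalIntegrable (fun v => p v * f v) volume 0 1) :
    (m + 1) * ∫ v in (0 : ℝ)..1, orderDensity (l + 1) (l + 1 + (m + 1)) v * f v =
      (l + m + 2) * (∫ v in (0 : ℝ)..1, orderDensity (l + 1) (l + 1 + m) v * f v)
        - (l + 1) * ∫ v in (0 : ℝ)..1, orderDensity (l + 1 + 1) (l + 1 + 1 + m) v * f v := by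
  rw [← intervalIntegral.integral_const_mul, ← intervalIntegral.integral_const_mul,
    ← intervalIntegral.integral_const_mul, ← intervalIntegral.integral_sub
      ((hf _ (continuous_orderDensity _ _)).const_mul _)
      ((hf _ (continuous_orderDensity _ _)).const_mul _)]
  refine intervalIntegral.integral_congr fun v _ => ?_
  linear_combination f v * orderDensity_recurrence l m v

lemma integral_orderDensity_mul_self (l m : ℕ) :
    ∫ v in (0 : ℝ)..1, orderDensity (l + 1) (l + 1 + m) v * v = (l + 1) / (l + m + 2) := by
  induction m generalizing l with
  | zero =>
    simp_rw [orderDensity_succ_succ]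
    simp only [add_zero, Nat.choose_self, CharP.cast_eq_zero, Nat.cast_one, mul_one, pow_zero,
      mul_assoc, ← pow_succ]
    rw [intervalIntegral.integral_const_mul, integral_pow]
    simp
    field_simp
    ring
  | succ m ih =>
    have h := integral_orderDensity_recurrence l m (f := fun v => v)
      fun p hp => (hp.mul continuous_id).intervalIntegrable _ _
    rw [ih, ih] at h
    have hm : (m + 1 : ℝ) ≠ 0 := by positivity
    refine mul_left_cancel₀ hm (h.trans ?_)
    push_cast
    field_simp
    ring

/-- The sum `1 / (l + 1) ^ p + ⋯ + 1 / (l + m + 1) ^ p`. -/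
noncomputable def recipSum (p l m : ℕ) : ℝ := ∑ i ∈ Finset.range (m + 1), 1 / (l + 1 + i : ℝ) ^ p

lemma recipSum_succ (p l m : ℕ) :
    recipSum p l (m + 1) = recipSum p l m + 1 / (l + m + 2 : ℝ) ^ p := by
  rw [recipSum, Finset.sum_range_succ, ← recipSum]
  push_cast
  ring_nf

lemma recipSum_shift (p l m : ℕ) :
    recipSum p (l + 1) m = recipSum p l m + 1 / (l + m + 2 : ℝ) ^ p - 1 / (l + 1 : ℝ) ^ p := by
  rw [← recipSum_succ, recipSum, recipSum, Finset.sum_range_succ' _ (m + 1)]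
  push_cast
  ring_nf

lemma integral_orderDensity_mul_log (l m : ℕ) :
    ∫ v in (0 : ℝ)..1, orderDensity (l + 1) (l + 1 + m) v * Real.log v ^ 1 = -recipSum 1 l m := by
  induction m generalizing l with
  | zero =>
    simp_rw [orderDensity_succ_succ]
    simp only [add_zero, Nat.choose_self, CharP.cast_eq_zero, Nat.cast_one, mul_one, pow_zero,
      mul_assoc]
    rw [intervalIntegral.integral_const_mul, integral_pow_mul_log]
    simp [recipSum]
    field_simp
  | succ m ih =>
    have h := integral_orderDensity_recurrence l m (f := fun v => Real.log v ^ 1)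
      fun p hp => intervalIntegrable_mul_log_pow hp (by norm_num)
    rw [ih, ih, recipSum_shift] at h
    have hm : (m + 1 : ℝ) ≠ 0 := by positivity
    refine mul_left_cancel₀ hm (h.trans ?_)
    rw [recipSum_succ]
    field_simp
    ring

/-- The moments are those of a sum of independent exponentials of rates l + 1, …, l + m + 1;
subtracting the squared mean leaves the variance `recipSum 2 l m`. -/
lemma integral_orderDensity_mul_log_sq (l m : ℕ) :
    ∫ v in (0 : ℝ)..1, orderDensity (l + 1) (l + 1 + m) v * Real.log v ^ 2 =
      recipSum 1 l m ^ 2 + recipSum 2 l m := by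
  induction m generalizing l with
  | zero =>
    simp_rw [orderDensity_succ_succ]
    simp only [add_zero, Nat.choose_self, CharP.cast_eq_zero, Nat.cast_one, mul_one, pow_zero,
      mul_assoc]
    rw [intervalIntegral.integral_const_mul, integral_pow_mul_log_sq]
    simp [recipSum]
    field_simp
    ring
  | succ m ih =>
    have h := integral_orderDensity_recurrence l m (f := fun v => Real.log v ^ 2)
      fun p hp => intervalIntegrable_mul_log_pow hp (by norm_num)
    rw [ih, ih, recipSum_shift, recipSum_shift] at h
    have hm : (m + 1 : ℝ) ≠ 0 := by positivity
    refine mul_left_cancel₀ hm (h.trans ?_)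
    rw [recipSum_succ, recipSum_succ]
    field_simp
    ring

lemma integrable_log_mul_pow (k n : ℕ) {c : ℝ} (hc : 0 < c) :
    Integrable (fun v => Real.log (c * v) ^ 4) (orderMeasure k n) := by
  rw [integrable_orderMeasure]
  have hp := continuous_orderDensity k n
  have hi := fun j (hj : j ≤ 4) (b : ℝ) =>
    (intervalIntegrable_mul_log_pow hp hj).const_mul b
  have := (((hi 0 (by norm_num) (Real.log c ^ 4)).add (hi 1 (by norm_num) (4 * Real.log c ^ 3))).add
    (hi 2 (by norm_num) (6 * Real.log c ^ 2))).add (hi 3 (by norm_num) (4 * Real.log c)) |>.add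
    (hi 4 le_rfl 1)
  rw [intervalIntegrable_iff_integrableOn_Ioc_of_le zero_le_one] at this ⊢
  refine this.congr_fun (fun v hv => ?_) measurableSet_Ioc
  simp only [Real.log_mul hc.ne' hv.1.ne']
  ring

lemma log_pow_four_le {x : ℝ} (hx : 1 ≤ x) : Real.log x ^ 4 ≤ 24 * x := by
  have h := Real.pow_div_factorial_le_exp (Real.log x) (Real.log_nonneg hx) 4
  rw [Real.exp_log (by linarith)] at h
  norm_num [Nat.factorial] at h
  linarith

/-- Uses that the binomial coefficient is at most n^(k-1) and that n v ≤ k: on the scale k/n the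
density is at most n times a constant depending on k. -/
lemma orderDensity_le {k n : ℕ} (hk : 1 ≤ k) (hn : k ≤ n) {v : ℝ} (h0 : 0 ≤ v) (h1 : v ≤ k / n) :
    orderDensity k n v ≤ n * (k : ℝ) ^ (k - 1) := by
  have hn' : (0 : ℝ) < n := by exact_mod_cast (by omega : 0 < n)
  have hv1 : v ≤ 1 := h1.trans (by rw [div_le_one hn']; exact_mod_cast hn)
  have hch : ((n - 1).choose (k - 1) : ℝ) ≤ (n : ℝ) ^ (k - 1) := by
    have h1 := Nat.choose_le_pow (n - 1) (k - 1)
    have h2 : (n - 1) ^ (k - 1) ≤ n ^ (k - 1) := Nat.pow_le_pow_left (by omega) _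
    exact_mod_cast h1.trans h2
  calc orderDensity k n v ≤ n * (n : ℝ) ^ (k - 1) * v ^ (k - 1) * 1 := by
        unfold orderDensity
        gcongr
        exact pow_le_one₀ (by linarith) (by linarith)
    _ = n * (n * v) ^ (k - 1) := by ring
    _ ≤ n * (k : ℝ) ^ (k - 1) := by
        gcongr
        rw [le_div_iff₀ hn'] at h1
        linarith

/-- The fourth moment of the logarithm of the normalized order statistic is bounded in `n`. -/
lemma integral_log_pow_four_le {k n : ℕ} (hk : 1 ≤ k) (hn : k ≤ n) :
    ∫ v, Real.log (n / k * v) ^ 4 ∂(orderMeasure k n) ≤ 24 + 8 ^ 4 * 2 * k ^ k := by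
  have hn0 : (0 : ℝ) < n := by exact_mod_cast (by omega : 0 < n)
  have hk0 : (0 : ℝ) < k := by exact_mod_cast hk
  have hc : (0 : ℝ) < n / k := by positivity
  have hs0 : (0 : ℝ) ≤ k / n := by positivity
  have hs1 : (k / n : ℝ) ≤ 1 := by rw [div_le_one hn0]; exact_mod_cast hn
  have hint := (integrable_orderMeasure k n _).1 (integrable_log_mul_pow k n hc)
  have hsub1 : Set.uIcc (0 : ℝ) (k / n) ⊆ Set.uIcc 0 1 := by
    rw [Set.uIcc_of_le hs0, Set.uIcc_of_le zero_le_one]; exact Set.Icc_subset_Icc le_rfl hs1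
  have hsub2 : Set.uIcc (k / n : ℝ) 1 ⊆ Set.uIcc 0 1 := by
    rw [Set.uIcc_of_le hs1, Set.uIcc_of_le zero_le_one]; exact Set.Icc_subset_Icc hs0 le_rfl
  have hcd : Continuous fun v => orderDensity k n v * (24 * (n / k * v)) :=
    (continuous_orderDensity k n).mul (by fun_prop)
  -- Split at v = k/n, where the argument of the logarithm is 1. Above, log⁴ x ≤ 24 x and the mean
  -- of v is k/(n+1). Below, the density is O(n) and log⁴ is dominated by an inverse square root.
  rw [integral_orderMeasure, ← intervalIntegral.integral_add_adjacent_intervals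
    (hint.mono_set hsub1) (hint.mono_set hsub2), add_comm]
  refine add_le_add ?_ ?_
  · calc ∫ v in (k / n : ℝ)..1, orderDensity k n v * Real.log (n / k * v) ^ 4
        ≤ ∫ v in (k / n : ℝ)..1, orderDensity k n v * (24 * (n / k * v)) := by
          refine intervalIntegral.integral_mono_on hs1 (hint.mono_set hsub2)
            (hcd.intervalIntegrable _ _) fun v hv => ?_
          refine mul_le_mul_of_nonneg_left (log_pow_four_le ?_)
            (orderDensity_nonneg k n (hs0.trans hv.1) hv.2)
          have := hv.1
          rw [div_le_iff₀ hn0] at this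
          rw [div_mul_eq_mul_div, le_div_iff₀ hk0]
          linarith
      _ ≤ ∫ v in (0 : ℝ)..1, orderDensity k n v * (24 * (n / k * v)) := by
          rw [← intervalIntegral.integral_add_adjacent_intervals
            (hcd.intervalIntegrable 0 (k / n)) (hcd.intervalIntegrable (k / n) 1)]
          refine le_add_of_nonneg_left (intervalIntegral.integral_nonneg hs0 fun v hv => ?_)
          exact mul_nonneg (orderDensity_nonneg k n hv.1 (hv.2.trans hs1))
            (by have := hv.1; positivity)
      _ = 24 * (n / k) * ∫ v in (0 : ℝ)..1, orderDensity k n v * v := by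
          rw [← intervalIntegral.integral_const_mul]
          refine intervalIntegral.integral_congr fun v _ => ?_
          ring
      _ ≤ 24 := by
          obtain ⟨l, rfl⟩ : ∃ l, k = l + 1 := ⟨k - 1, by omega⟩
          obtain ⟨m, rfl⟩ : ∃ m, n = l + 1 + m := ⟨n - (l + 1), by omega⟩
          rw [integral_orderDensity_mul_self]
          push_cast
          have h1 : (24 : ℝ) * ((l + 1 + m) / (l + 1)) * ((l + 1) / (l + m + 2)) =
              24 * ((l + 1 + m) / (l + m + 2)) := by field_simp
          have h2 : (l + 1 + m : ℝ) / (l + m + 2) ≤ 1 := by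
            rw [div_le_one (by positivity)]; linarith
          rw [h1]
          linarith
  · calc ∫ v in (0 : ℝ)..(k / n), orderDensity k n v * Real.log (n / k * v) ^ 4
        ≤ ∫ v in (0 : ℝ)..(k / n), n * (k : ℝ) ^ (k - 1) * 8 ^ 4 * (n / k : ℝ) ^ (-(1 / 2) : ℝ) *
            v ^ (-(1 / 2) : ℝ) := by
          refine intervalIntegral.integral_mono_on_of_le_Ioo hs0 (hint.mono_set hsub1)
            ((intervalIntegral.intervalIntegrable_rpow' (by norm_num)).const_mul _) fun v hv => ?_
          have hx : 0 < n / k * v := mul_pos hc hv.1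
          have hx1 : n / k * v ≤ 1 := by
            have := hv.2.le
            rw [le_div_iff₀ hn0] at this
            rw [div_mul_eq_mul_div, div_le_one hk0]
            linarith
          have h1 := abs_log_pow_le hx hx1 (le_refl 4)
          rw [Real.mul_rpow hc.le hv.1.le] at h1
          have h2 := orderDensity_le hk hn hv.1.le hv.2.le
          calc orderDensity k n v * Real.log (n / k * v) ^ 4
              ≤ (n * (k : ℝ) ^ (k - 1)) *
                (8 ^ 4 * ((n / k : ℝ) ^ (-(1 / 2) : ℝ) * v ^ (-(1 / 2) : ℝ))) := by
                refine mul_le_mul h2 ((le_abs_self _).trans h1) (by positivity) (by positivity)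
            _ = _ := by ring
      _ = 8 ^ 4 * 2 * k ^ k := by
          rw [intervalIntegral.integral_const_mul, integral_rpow (Or.inl (by norm_num))]
          have h1 : (n / k : ℝ) ^ (-(1 / 2) : ℝ) = (k / n : ℝ) ^ (1 / 2 : ℝ) := by
            rw [Real.rpow_neg hc.le, ← Real.inv_rpow hc.le, inv_div]
          have h2 : (-(1 / 2) + 1 : ℝ) = 1 / 2 := by norm_num
          have h3 : (k / n : ℝ) ^ (1 / 2 : ℝ) * (k / n : ℝ) ^ (1 / 2 : ℝ) = k / n := by
            rw [← Real.sqrt_eq_rpow, Real.mul_self_sqrt hs0]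
          rw [h1, h2, Real.zero_rpow (by norm_num), sub_zero]
          calc _ = n * (k : ℝ) ^ (k - 1) * 8 ^ 4 * 2 *
                ((k / n : ℝ) ^ (1 / 2 : ℝ) * (k / n : ℝ) ^ (1 / 2 : ℝ)) := by ring
            _ = 8 ^ 4 * 2 * (k ^ (k - 1) * k) := by rw [h3]; field_simp
            _ = _ := by rw [← pow_succ, Nat.sub_add_cancel hk]

/-! ### Square-integrable majorants of the logarithm of the mean density of balls -/

/-- If every point of `A` is the centre of a ball in `K` whose `μ`-measure is at most its
`ν`-measure, then `μ A` is at most a constant times `ν K`. -/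
lemma exists_besicovitch_measure_le (β : Type*) [MetricSpace β] [SecondCountableTopology β]
    [MeasurableSpace β] [OpensMeasurableSpace β] [HasBesicovitchCovering β] :
    ∃ N : ℕ, ∀ (μ ν : Measure β) (A K : Set β) (R : ℝ),
      (∀ x ∈ A, ∃ r, 0 < r ∧ r ≤ R ∧ Metric.closedBall x r ⊆ K ∧
        μ (Metric.closedBall x r) ≤ ν (Metric.closedBall x r)) → μ A ≤ N * ν K := by
  obtain ⟨N, τ, hτ, hN⟩ := HasBesicovitchCovering.no_satelliteConfig (α := β)
  refine ⟨N, fun μ ν A K R h => ?_⟩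
  choose! r hr0 hrR hrK hr using h
  let a : Besicovitch.BallPackage A β :=
    { c := fun x => x
      r := fun x => r x
      rpos := fun x => hr0 x x.2
      r_bound := R
      r_le := fun x => hrR x x.2 }
  obtain ⟨u, hu, hcov⟩ := Besicovitch.exist_disjoint_covering_families hτ hN a
  have hcount : ∀ i, (u i).Countable := fun i =>
    (hu i).countable_of_nonempty_interior fun j _ =>
      ((Metric.nonempty_ball.2 (a.rpos j)).mono Metric.ball_subset_interior_closedBall)
  -- Each of the `N` families consists of disjoint balls, so its ν-masses add up to at most ν K;
  -- together the families cover `A`.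
  have hi : ∀ i, μ (⋃ j ∈ u i, Metric.ball (a.c j) (a.r j)) ≤ ν K := by
    intro i
    calc μ (⋃ j ∈ u i, Metric.ball (a.c j) (a.r j))
        ≤ ∑' j : u i, μ (Metric.ball (a.c j) (a.r j)) := measure_biUnion_le _ (hcount i) _
      _ ≤ ∑' j : u i, ν (Metric.closedBall (a.c j) (a.r j)) := by
          refine ENNReal.tsum_le_tsum fun j => ?_
          exact (measure_mono Metric.ball_subset_closedBall).trans (hr _ j.1.2)
      _ = ν (⋃ j ∈ u i, Metric.closedBall (a.c j) (a.r j)) :=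
          (measure_biUnion (hcount i) (hu i) fun j _ => Metric.isClosed_closedBall.measurableSet).symm
      _ ≤ ν K := measure_mono (Set.iUnion₂_subset fun j _ => hrK _ j.2)
  calc μ A ≤ μ (⋃ i, ⋃ j ∈ u i, Metric.ball (a.c j) (a.r j)) := by
        refine measure_mono fun x hx => hcov ⟨⟨x, hx⟩, rfl⟩
    _ ≤ ∑ i, μ (⋃ j ∈ u i, Metric.ball (a.c j) (a.r j)) := measure_iUnion_fintype_le _ _
    _ ≤ ∑ _i : Fin N, ν K := Finset.sum_le_sum fun i _ => hi i
    _ = N * ν K := by simp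

lemma sum_range_two_mul_add_one (n : ℕ) : ∑ j ∈ Finset.range n, (2 * (j : ℝ) + 1) = (n : ℝ) ^ 2 := by
  induction n with
  | zero => simp
  | succ n ih => rw [Finset.sum_range_succ, ih]; push_cast; ring

/-- A decreasing sequence of sets whose measures are small enough gives a square-integrable
function that is larger than `j` on the `j`-th set. -/
lemma exists_memLp_two_of_tail {α : Type*} [MeasurableSpace α] {μ : Measure α} [IsFiniteMeasure μ]
    {A : ℕ → Set α} (hA : Antitone A) {h : α → ℝ} (hh : MemLp h 2 μ) {c C : ℝ} (hc : 0 < c)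
    (hb : ∀ j : ℕ, μ (A j) ≤ ENNReal.ofReal (C * Real.exp (-(j / 2))) + μ {x | c * j ≤ |h x|}) :
    ∃ F : α → ℝ, MemLp F 2 μ ∧ (∀ x, 0 ≤ F x) ∧ ∀ᵐ x ∂μ, ∀ j : ℕ, x ∈ A j → (j : ℝ) + 1 ≤ F x := by
  obtain ⟨h', hm', hae⟩ := hh.1
  have hh' : MemLp h' 2 μ := hh.ae_eq hae
  have hmeas : Measurable fun x => |h' x| := hm'.measurable.abs
  set w : ℕ → ENNReal := fun j => ENNReal.ofReal (2 * j + 1)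
  -- The square of the majorant, as a layer-cake sum: the weights 2j + 1 have squares as partial
  -- sums. Measurable hulls stand in for the `A j`, whose measurability is not assumed.
  let F2 : α → ENNReal := fun x => ∑' j, (toMeasurable μ (A j)).indicator (fun _ => w j) x
  have hF2m : Measurable F2 := Measurable.tsum fun j =>
    measurable_const.indicator (measurableSet_toMeasurable _ _)
  have hsum : Summable fun j : ℕ => (2 * (j : ℝ) + 1) * (C * Real.exp (-(j / 2))) := by
    have h1 := Real.summable_pow_mul_exp_neg_nat_mul 1 (show (0 : ℝ) < 1 / 2 by norm_num)
    have h2 := Real.summable_pow_mul_exp_neg_nat_mul 0 (show (0 : ℝ) < 1 / 2 by norm_num)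
    refine ((h1.mul_left (2 * C)).add (h2.mul_left C)).congr fun j => ?_
    rw [show -(1 / 2 : ℝ) * j = -(j / 2) by ring]
    ring
  have hpt : ∀ x, ∑' j : ℕ, {x | c * j ≤ |h' x|}.indicator (fun _ => w j) x ≤
      ENNReal.ofReal ((|h' x| / c + 1) ^ 2) := by
    intro x
    set M := ⌊|h' x| / c⌋₊ + 1
    rw [tsum_eq_sum (s := Finset.range M)]
    · calc ∑ j ∈ Finset.range M, {x | c * j ≤ |h' x|}.indicator (fun _ => w j) x
          ≤ ∑ j ∈ Finset.range M, w j := Finset.sum_le_sum fun j _ =>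
            Set.indicator_le_self' (fun _ _ => zero_le) x
        _ = ENNReal.ofReal ((M : ℝ) ^ 2) := by
            rw [← ENNReal.ofReal_sum_of_nonneg fun j _ => by positivity, sum_range_two_mul_add_one]
        _ ≤ _ := by
            refine ENNReal.ofReal_le_ofReal ?_
            have : (M : ℝ) ≤ |h' x| / c + 1 := by
              simp only [M]; push_cast
              have := Nat.floor_le (show 0 ≤ |h' x| / c by positivity)
              linarith
            gcongr
    · intro j hj
      refine Set.indicator_of_notMem (fun hx => hj ?_) _
      rw [Finset.mem_range, Nat.lt_succ_iff]
      refine Nat.le_floor ?_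
      rw [le_div_iff₀ hc]
      linarith [show c * j ≤ |h' x| from hx]
  have hfin : ∫⁻ x, F2 x ∂μ ≠ ⊤ := by
    have hlt : ∫⁻ x, F2 x ∂μ ≤ (∑' j : ℕ, ENNReal.ofReal ((2 * j + 1) * (C * Real.exp (-(j / 2))))) +
        ∫⁻ x, ENNReal.ofReal ((|h' x| / c + 1) ^ 2) ∂μ := by
      calc ∫⁻ x, F2 x ∂μ = ∑' j, w j * μ (A j) := by
            rw [lintegral_tsum fun j =>
              (measurable_const.indicator (measurableSet_toMeasurable _ _)).aemeasurable]
            refine tsum_congr fun j => ?_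
            rw [lintegral_indicator_const (measurableSet_toMeasurable _ _), measure_toMeasurable]
        _ ≤ ∑' j : ℕ, (ENNReal.ofReal ((2 * j + 1) * (C * Real.exp (-(j / 2)))) +
            ∫⁻ x, {x | c * j ≤ |h' x|}.indicator (fun _ => w j) x ∂μ) := by
            refine ENNReal.tsum_le_tsum fun j => ?_
            rw [lintegral_indicator_const (measurableSet_le measurable_const hmeas),
              ENNReal.ofReal_mul (by positivity), ← mul_add]
            gcongr
            refine (hb j).trans_eq ?_
            congr 1
            refine measure_congr ?_
            filter_upwards [hae] with x hx
            exact congrArg (fun t : ℝ => c * j ≤ |t|) hx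
        _ = _ := by
            rw [ENNReal.tsum_add, ← lintegral_tsum fun j =>
              (measurable_const.indicator (measurableSet_le measurable_const hmeas)).aemeasurable]
        _ ≤ _ := by gcongr with x; exact hpt x
    refine ne_top_of_le_ne_top (ENNReal.add_ne_top.2 ⟨hsum.tsum_ofReal_ne_top, ?_⟩) hlt
    have : MemLp (fun x => |h' x| / c + 1) 2 μ :=
      (hh'.abs.mul_const c⁻¹).add (memLp_const 1)
    exact (this.integrable_sq).lintegral_lt_top.ne
  have hlt : ∀ᵐ x ∂μ, F2 x < ⊤ := ae_lt_top hF2m hfin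
  refine ⟨fun x => √(F2 x).toReal, ?_, fun x => Real.sqrt_nonneg _, ?_⟩
  · rw [memLp_two_iff_integrable_sq (hF2m.ennreal_toReal.sqrt).aestronglyMeasurable]
    simp_rw [Real.sq_sqrt ENNReal.toReal_nonneg]
    exact integrable_toReal_of_lintegral_ne_top hF2m.aemeasurable hfin
  · filter_upwards [hlt] with x hx j hj
    refine Real.le_sqrt_of_sq_le ?_
    rw [← ENNReal.ofReal_le_iff_le_toReal hx.ne]
    -- A point of `A j` lies in all earlier sets, so it collects the weights 1 + 3 + ⋯ + (2j + 1).
    calc ENNReal.ofReal (((j : ℝ) + 1) ^ 2) = ∑ i ∈ Finset.range (j + 1), w i := by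
          rw [← ENNReal.ofReal_sum_of_nonneg fun j _ => by positivity, sum_range_two_mul_add_one]
          push_cast; rfl
      _ = ∑ i ∈ Finset.range (j + 1), (toMeasurable μ (A i)).indicator (fun _ => w i) x := by
          refine Finset.sum_congr rfl fun i hi => ?_
          rw [Set.indicator_of_mem]
          exact subset_toMeasurable _ _ (hA (Nat.lt_succ_iff.1 (Finset.mem_range.1 hi)) hj)
      _ ≤ F2 x := ENNReal.sum_le_tsum _

/-! ### Maximal inequalities for the mean density of balls -/

section density

variable {d : ℕ}

/-- The volume of the Euclidean unit ball. -/
noncomputable def unitBallVol (d : ℕ) : ℝ := √Real.pi ^ d / Real.Gamma (d / 2 + 1)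

lemma unitBallVol_pos (d : ℕ) : 0 < unitBallVol d := by
  have : 0 < Real.Gamma ((d : ℝ) / 2 + 1) := Real.Gamma_pos_of_pos (by positivity)
  have := Real.pi_pos
  unfold unitBallVol
  positivity

lemma volume_closedBall_eq (hd : 1 ≤ d) (x : EuclideanSpace ℝ (Fin d)) {r : ℝ} (hr : 0 ≤ r) :
    volume (Metric.closedBall x r) = ENNReal.ofReal (unitBallVol d * r ^ d) := by
  have : Nonempty (Fin d) := ⟨⟨0, hd⟩⟩
  rw [EuclideanSpace.volume_closedBall, Fintype.card_fin, ← ENNReal.ofReal_pow hr,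
    ← ENNReal.ofReal_mul (by positivity), mul_comm]
  rfl

/-- The mean density of `G` on the ball with centre `x` and radius `r`. -/
noncomputable def meanDensity (G : Measure (EuclideanSpace ℝ (Fin d)))
    (x : EuclideanSpace ℝ (Fin d)) (r : ℝ) : ℝ :=
  G.real (Metric.closedBall x r) / (unitBallVol d * r ^ d)

variable {G : Measure (EuclideanSpace ℝ (Fin d))} [IsProbabilityMeasure G]
  {g : EuclideanSpace ℝ (Fin d) → ℝ}

/-- A weak-type maximal inequality: the points with a ball of mean density at least e^j have volume
at most N e^(-j). Where g < e^(j/2) this costs G-measure at most N e^(-j/2); elsewhere |log g| ≥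
j/2, and log g is square-integrable. -/
lemma exists_majorant_log_meanDensity (hd : 1 ≤ d) (hg_meas : Measurable g)
    (hG : G = volume.withDensity fun x => ENNReal.ofReal (g x))
    (hg_log : MemLp (fun x => Real.log (g x)) 2 G) :
    ∃ F : EuclideanSpace ℝ (Fin d) → ℝ, MemLp F 2 G ∧ (∀ x, 0 ≤ F x) ∧
      ∀ᵐ x ∂G, ∀ r, 0 < r → Real.log (meanDensity G x r) ≤ F x := by
  have hV := unitBallVol_pos d
  obtain ⟨N, hN⟩ := exists_besicovitch_measure_le (EuclideanSpace ℝ (Fin d))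
  let A : ℕ → Set (EuclideanSpace ℝ (Fin d)) := fun j =>
    {x | ∃ r, 0 < r ∧ Real.exp j * (unitBallVol d * r ^ d) ≤ G.real (Metric.closedBall x r)}
  have hA : Antitone A := by
    rintro i j hij x ⟨r, hr, h⟩
    refine ⟨r, hr, le_trans ?_ h⟩
    gcongr
  have hvol : ∀ j : ℕ, ENNReal.ofReal (Real.exp j) * volume (A j) ≤ N := by
    intro j
    -- The covering theorem needs bounded radii: the ball has mass at most 1, so r > 1 forces V r ≤
    -- V r^d ≤ 1 for the unit-ball volume V.
    have h := hN (ENNReal.ofReal (Real.exp j) • volume) G (A j) Set.univ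
      (max 1 (1 / unitBallVol d)) ?_
    · simpa using h
    rintro x ⟨r, hr, h⟩
    refine ⟨r, hr, ?_, Set.subset_univ _, ?_⟩
    · rcases le_or_gt r 1 with h1 | h1
      · exact h1.trans (le_max_left _ _)
      · refine le_trans ?_ (le_max_right _ _)
        rw [le_div_iff₀ hV]
        have h2 : r ≤ r ^ d := le_self_pow₀ h1.le (by omega)
        have h3 : G.real (Metric.closedBall x r) ≤ 1 := measureReal_le_one
        have h4 : (1 : ℝ) ≤ Real.exp j := Real.one_le_exp (by positivity)
        have h5 : unitBallVol d * r ^ d ≤ Real.exp j * (unitBallVol d * r ^ d) :=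
          le_mul_of_one_le_left (by positivity) h4
        nlinarith
    · rw [Measure.smul_apply, smul_eq_mul, volume_closedBall_eq hd x hr.le,
        ← ENNReal.ofReal_mul (Real.exp_nonneg _)]
      exact ENNReal.ofReal_le_of_le_toReal h
  have hb : ∀ j : ℕ, G (A j) ≤ ENNReal.ofReal (N * Real.exp (-(j / 2))) +
      G {x | 1 / 2 * (j : ℝ) ≤ |Real.log (g x)|} := by
    intro j
    set T := {x | g x < Real.exp (j / 2)}
    have hT : MeasurableSet T := measurableSet_lt hg_meas measurable_const
    have hsub : A j ⊆ (A j ∩ T) ∪ {x | 1 / 2 * (j : ℝ) ≤ |Real.log (g x)|} := by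
      intro x hx
      by_cases hxT : x ∈ T
      · exact Or.inl ⟨hx, hxT⟩
      · right
        have h1 : Real.exp (j / 2) ≤ g x := not_lt.1 hxT
        have h2 := (Real.le_log_iff_exp_le ((Real.exp_pos _).trans_le h1)).2 h1
        have h3 := le_abs_self (Real.log (g x))
        simp only [Set.mem_ofPred_eq]
        linarith
    refine (measure_mono hsub).trans ((measure_union_le _ _).trans ?_)
    gcongr
    have hle : G.restrict T ≤ ENNReal.ofReal (Real.exp (j / 2)) • volume := by
      calc G.restrict T = (volume.restrict T).withDensity fun x => ENNReal.ofReal (g x) := by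
            rw [← restrict_withDensity hT, ← hG]
        _ ≤ (volume.restrict T).withDensity fun _ => ENNReal.ofReal (Real.exp (j / 2)) := by
            refine withDensity_mono ?_
            filter_upwards [ae_restrict_mem hT] with x hx
            exact ENNReal.ofReal_le_ofReal (le_of_lt hx)
        _ = ENNReal.ofReal (Real.exp (j / 2)) • volume.restrict T := withDensity_const _
        _ ≤ _ := by gcongr; exact Measure.restrict_le_self
    calc G (A j ∩ T) = G.restrict T (A j) := (Measure.restrict_apply' hT).symm
      _ ≤ ENNReal.ofReal (Real.exp (j / 2)) * volume (A j) := hle _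
      _ = ENNReal.ofReal (Real.exp (-(j / 2))) * (ENNReal.ofReal (Real.exp j) * volume (A j)) := by
          rw [← mul_assoc, ← ENNReal.ofReal_mul (Real.exp_nonneg _), ← Real.exp_add]
          ring_nf
      _ ≤ ENNReal.ofReal (Real.exp (-(j / 2))) * N := by gcongr; exact hvol j
      _ = _ := by
          rw [ENNReal.ofReal_mul (by positivity), ENNReal.ofReal_natCast, mul_comm]
  obtain ⟨F, hF, hF0, hFA⟩ := exists_memLp_two_of_tail hA hg_log (by norm_num) hb
  refine ⟨F, hF, hF0, ?_⟩
  filter_upwards [hFA] with x hx r hr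
  set t := Real.log (meanDensity G x r)
  rcases le_or_gt t 0 with ht | ht
  · exact ht.trans (hF0 x)
  -- `Real.log 0 = 0`, so a positive logarithm excludes mean density zero.
  have hm : 0 < meanDensity G x r := by
    refine lt_of_le_of_ne (by unfold meanDensity; positivity) fun h0 => ?_
    simp only [t, ← h0, Real.log_zero, lt_irrefl] at ht
  -- With j < t ≤ j + 1 the point lies in `A j`, where the majorant is at least j + 1.
  obtain ⟨j, hj⟩ : ∃ j, ⌈t⌉₊ = j + 1 := ⟨⌈t⌉₊ - 1, by have := Nat.ceil_pos.2 ht; omega⟩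
  have h1 : t ≤ j + 1 := by have := Nat.le_ceil t; rw [hj] at this; exact_mod_cast this
  have h2 : (j : ℝ) < t := Nat.lt_ceil.1 (by omega)
  refine h1.trans (hx j ⟨r, hr, ?_⟩)
  rw [← le_div_iff₀ (by positivity)]
  exact ((Real.lt_log_iff_exp_lt hm).1 h2).le

/-- The covering argument with the roles of `G` and volume exchanged. Volume is infinite, so it is
applied only inside a ball about `y₀` of radius e^(j/(2d)), whose volume is of order e^(j/2) against
the gain e^(-j); the log-distance moment controls the outside. Radii at most 1 keep the covering
balls in a ball of comparable size. -/
lemma exists_majorant_neg_log_meanDensity (hd : 1 ≤ d) {y₀ : EuclideanSpace ℝ (Fin d)}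
    (hy : MemLp (fun x => Real.log (dist x y₀)) 2 G) :
    ∃ F : EuclideanSpace ℝ (Fin d) → ℝ, MemLp F 2 G ∧ (∀ x, 0 ≤ F x) ∧
      ∀ᵐ x ∂G, ∀ r, 0 < r → r ≤ 1 → -Real.log (meanDensity G x r) ≤ F x := by
  have hV := unitBallVol_pos d
  have hd0 : (0 : ℝ) < d := by exact_mod_cast hd
  obtain ⟨N, hN⟩ := exists_besicovitch_measure_le (EuclideanSpace ℝ (Fin d))
  let A : ℕ → Set (EuclideanSpace ℝ (Fin d)) := fun j =>
    {x | ∃ r, 0 < r ∧ r ≤ 1 ∧ G.real (Metric.closedBall x r) ≤ Real.exp (-j) * (unitBallVol d * r ^ d)}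
  have hA : Antitone A := by
    rintro i j hij x ⟨r, hr, hr1, h⟩
    refine ⟨r, hr, hr1, h.trans ?_⟩
    gcongr
  have hb : ∀ j : ℕ, G (A j) ≤ ENNReal.ofReal ((N * (unitBallVol d * 2 ^ d)) * Real.exp (-(j / 2))) +
      G {x | 1 / (2 * d) * (j : ℝ) ≤ |Real.log (dist x y₀)|} := by
    intro j
    set M := Real.exp (1 / (2 * d) * j)
    have hM1 : 1 ≤ M := Real.one_le_exp (by positivity)
    have hMd : M ^ d = Real.exp (j / 2) := by
      rw [← Real.exp_nat_mul]; congr 1; field_simp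
    have hsub : A j ⊆ (A j ∩ {x | dist x y₀ < M}) ∪
        {x | 1 / (2 * d) * (j : ℝ) ≤ |Real.log (dist x y₀)|} := by
      intro x hx
      rcases lt_or_ge (dist x y₀) M with h | h
      · exact Or.inl ⟨hx, h⟩
      · right
        have h2 := (Real.le_log_iff_exp_le ((Real.exp_pos _).trans_le h)).2 h
        exact h2.trans (le_abs_self _)
    refine (measure_mono hsub).trans ((measure_union_le _ _).trans ?_)
    gcongr
    have h := hN G (ENNReal.ofReal (Real.exp (-j)) • volume) (A j ∩ {x | dist x y₀ < M})
      (Metric.closedBall y₀ (M + 1)) 1 ?_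
    · refine h.trans ?_
      rw [Measure.smul_apply, smul_eq_mul, volume_closedBall_eq hd y₀ (by linarith),
        ← ENNReal.ofReal_mul (Real.exp_nonneg _), ← ENNReal.ofReal_natCast,
        ← ENNReal.ofReal_mul (by positivity)]
      refine ENNReal.ofReal_le_ofReal ?_
      calc (N : ℝ) * (Real.exp (-j) * (unitBallVol d * (M + 1) ^ d))
          ≤ N * (Real.exp (-j) * (unitBallVol d * (2 * M) ^ d)) := by
            gcongr; linarith
        _ = N * (unitBallVol d * 2 ^ d) * (Real.exp (-j) * Real.exp (j / 2)) := by
            rw [mul_pow, hMd]; ring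
        _ = _ := by rw [← Real.exp_add]; ring_nf
    rintro x ⟨⟨r, hr, hr1, h⟩, hx⟩
    refine ⟨r, hr, hr1, Metric.closedBall_subset_closedBall' ?_, ?_⟩
    · have : dist x y₀ < M := hx
      linarith
    · rw [Measure.smul_apply, smul_eq_mul, volume_closedBall_eq hd x hr.le,
        ← ENNReal.ofReal_mul (Real.exp_nonneg _)]
      rw [← ofReal_measureReal]
      exact ENNReal.ofReal_le_ofReal h
  obtain ⟨F, hF, hF0, hFA⟩ := exists_memLp_two_of_tail hA hy (by positivity) hb
  refine ⟨F, hF, hF0, ?_⟩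
  filter_upwards [hFA] with x hx r hr hr1
  set t := -Real.log (meanDensity G x r)
  rcases le_or_gt t 0 with ht | ht
  · exact ht.trans (hF0 x)
  have hm : 0 < meanDensity G x r := by
    refine lt_of_le_of_ne (by unfold meanDensity; positivity) fun h0 => ?_
    simp only [t, ← h0, Real.log_zero, neg_zero, lt_irrefl] at ht
  obtain ⟨j, hj⟩ : ∃ j, ⌈t⌉₊ = j + 1 := ⟨⌈t⌉₊ - 1, by have := Nat.ceil_pos.2 ht; omega⟩
  have h1 : t ≤ j + 1 := by have := Nat.le_ceil t; rw [hj] at this; exact_mod_cast this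
  have h2 : (j : ℝ) < t := Nat.lt_ceil.1 (by omega)
  refine h1.trans (hx j ⟨r, hr, hr1, ?_⟩)
  rw [← div_le_iff₀ (by positivity)]
  have h3 : Real.log (meanDensity G x r) < -j := by simp only [t] at h2; linarith
  exact ((Real.log_lt_iff_lt_exp hm).1 h3).le

end density

/-! ### Convergence of the mean density on the nearest-neighbour ball -/

lemma ProbabilityTheory.HasLaw.ae_comp {Ω α : Type*} [MeasurableSpace Ω] [MeasurableSpace α]
    {P : Measure Ω} {μ : Measure α} {X : Ω → α} (hX : HasLaw X μ P) {p : α → Prop}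
    (hp : ∀ᵐ x ∂μ, p x) : ∀ᵐ ω ∂P, p (X ω) :=
  ae_of_ae_map hX.aemeasurable (by rwa [hX.map_eq])

lemma measurable_finCons {E : Type*} [MeasurableSpace E] {n : ℕ} :
    Measurable fun p : E × (Fin n → E) => (Fin.cons p.1 p.2 : Fin (n + 1) → E) := by
  refine measurable_pi_lambda _ fun i => ?_
  refine Fin.cases ?_ (fun j => ?_) i
  · exact measurable_fst
  · exact (measurable_pi_apply j).comp measurable_snd

section generic

variable {E : Type*} [PseudoMetricSpace E] [MeasurableSpace E] [OpensMeasurableSpace E]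
  [SecondCountableTopology E]

lemma measurable_measureReal_closedBall (G : Measure E) [SFinite G] :
    Measurable fun p : E × ℝ => G.real (Metric.closedBall p.1 p.2) := by
  have hs : MeasurableSet {q : (E × ℝ) × E | dist q.2 q.1.1 ≤ q.1.2} :=
    measurableSet_le (measurable_snd.dist (measurable_fst.comp measurable_fst))
      (measurable_snd.comp measurable_fst)
  exact (measurable_measure_prodMk_left hs).ennreal_toReal

lemma measurable_knnMass (G : Measure E) [SFinite G] {k n : ℕ} (hk : 1 ≤ k) (hn : k ≤ n) :
    Measurable fun y : Fin (n + 1) → E => knnMass G k y :=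
  (measurable_measureReal_closedBall G).comp (f := fun y : Fin (n + 1) → E => (y 0, knnDist k y 0))
    ((measurable_pi_apply 0).prodMk (measurable_knnDist hk (Nat.lt_succ_of_le hn) 0))

/-- The mass of the nearest-neighbour ball of `y 0` is independent of `y 0`, and a uniform
order statistic. -/
lemma measurePreserving_knnMass (G : Measure E) [IsProbabilityMeasure G]
    (hs : ∀ x r, G (Metric.sphere x r) = 0) {k n : ℕ} (hk : 1 ≤ k) (hn : k ≤ n) :
    MeasurePreserving (fun y : Fin (n + 1) → E => (y 0, knnMass G k y))
      (Measure.pi fun _ => G) (G.prod (orderMeasure k n)) := by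
  have h1 := measurePreserving_piFinSuccAbove (fun _ : Fin (n + 1) => G) 0
  have hm := (measurable_knnMass G hk hn).comp measurable_finCons
  have h2 : MeasurePreserving (fun p : E × (Fin n → E) =>
      (id p.1, knnMass G k (Fin.cons p.1 p.2 : Fin (n + 1) → E)))
      (G.prod (Measure.pi fun _ => G)) (G.prod (orderMeasure k n)) := by
    refine (MeasurePreserving.id G).skew_product (g := fun x z =>
      knnMass G k (Fin.cons x z : Fin (n + 1) → E)) hm ?_
    filter_upwards with x
    exact map_knnMass_cons G hk hn x (hs x) (hm.comp (measurable_const.prodMk measurable_id))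
  have h3 := h2.comp h1
  have he : (fun y : Fin (n + 1) → E => (y 0, knnMass G k y)) =
      (fun p : E × (Fin n → E) => (id p.1, knnMass G k (Fin.cons p.1 p.2 : Fin (n + 1) → E))) ∘
        (MeasurableEquiv.piFinSuccAbove (fun _ => E) 0) := by
    funext y
    have hy : y = Fin.cons (y 0) (fun j => y (Fin.succ j)) := by
      rw [eq_comm]; exact Fin.cons_self_tail y
    exact Prod.ext rfl (congrArg (knnMass G k) hy)
  rw [he]
  exact h3

end generic

section base

variable {d : ℕ} {G : Measure (EuclideanSpace ℝ (Fin d))} [IsProbabilityMeasure G]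
  {g : EuclideanSpace ℝ (Fin d) → ℝ}

/-- Lebesgue differentiation along closed balls, in Besicovitch form; the set where `g` vanishes is
null for `G` by definition of the density. -/
lemma ae_pos_and_tendsto_meanDensity (hd : 1 ≤ d) (hg_meas : Measurable g)
    (hg_nonneg : ∀ x, 0 ≤ g x) (hG : G = volume.withDensity fun x => ENNReal.ofReal (g x)) :
    ∀ᵐ x ∂G, 0 < g x ∧ Tendsto (meanDensity G x) (𝓝[>] 0) (𝓝 (g x)) := by
  have hac : G ≪ volume := hG ▸ withDensity_absolutelyContinuous _ _
  have hpos : ∀ᵐ x ∂G, 0 < g x := by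
    rw [hG, ae_withDensity_iff hg_meas.ennreal_ofReal]
    filter_upwards with x hx
    exact ENNReal.ofReal_pos.1 (pos_iff_ne_zero.2 hx)
  have h1 := hac.ae_le (Besicovitch.ae_tendsto_rnDeriv G volume)
  have h2 : G.rnDeriv volume =ᵐ[volume] fun x => ENNReal.ofReal (g x) := by
    rw [hG]; exact Measure.rnDeriv_withDensity _ hg_meas.ennreal_ofReal
  filter_upwards [hpos, h1, hac.ae_le h2] with x hx ht he
  refine ⟨hx, ?_⟩
  rw [he] at ht
  have := (ENNReal.tendsto_toReal ENNReal.ofReal_ne_top).comp ht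
  rw [ENNReal.toReal_ofReal (hg_nonneg x)] at this
  refine this.congr' ?_
  filter_upwards [self_mem_nhdsWithin] with r hr
  have hr0 : 0 ≤ r := le_of_lt hr
  have := (unitBallVol_pos d).le
  simp only [Function.comp_apply, ENNReal.toReal_div, meanDensity, volume_closedBall_eq hd x hr0,
    measureReal_def]
  rw [ENNReal.toReal_ofReal (by positivity)]

lemma measureReal_closedBall_pos {x : EuclideanSpace ℝ (Fin d)}
    (hx : 0 < g x ∧ Tendsto (meanDensity G x) (𝓝[>] 0) (𝓝 (g x))) {r : ℝ} (hr : 0 < r) :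
    0 < G.real (Metric.closedBall x r) := by
  obtain ⟨s, hs, hsr⟩ := ((hx.2.eventually (lt_mem_nhds hx.1)).and (Ioc_mem_nhdsGT hr)).exists
  refine lt_of_lt_of_le (lt_of_le_of_ne measureReal_nonneg fun h0 => ?_)
    (measureReal_mono (Metric.closedBall_subset_closedBall hsr.2))
  simp [meanDensity, ← h0] at hs

end base

lemma measure_sphere_eq_zero {d : ℕ} {G : Measure (EuclideanSpace ℝ (Fin d))} (hd : 1 ≤ d)
    (hac : G ≪ volume) (x : EuclideanSpace ℝ (Fin d)) (r : ℝ) : G (Metric.sphere x r) = 0 := by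
  have : Nonempty (Fin d) := ⟨⟨0, hd⟩⟩
  exact hac (Measure.addHaar_sphere _ _ _)



/-! ### Masses, distances and mean densities along the random sample -/

section sample

variable {d : ℕ} {G : Measure (EuclideanSpace ℝ (Fin d))} {g : EuclideanSpace ℝ (Fin d) → ℝ}
  {Ω : Type*} [MeasurableSpace Ω] {P : Measure Ω} {Y : ℕ → Ω → EuclideanSpace ℝ (Fin d)}

lemma hasLaw_sample (hY_law : ∀ i, HasLaw (Y i) G P) (hY_indep : iIndepFun Y P) (N : ℕ) :
    HasLaw (fun ω (i : Fin N) => Y i ω) (Measure.pi fun _ => G) P :=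
  iIndepFun.hasLaw_pi (fun i : Fin N => hY_law i) (hY_indep.precomp Fin.val_injective)

lemma hasLaw_pair [IsProbabilityMeasure P] (hY_law : ∀ i, HasLaw (Y i) G P) (hY_indep : iIndepFun Y P) {i j : ℕ}
    (hij : i ≠ j) : HasLaw (fun ω => (Y i ω, Y j ω)) (G.prod G) P :=
  (indepFun_iff_hasLaw_prodMk_prod (hY_law i) (hY_law j)).1 (hY_indep.indepFun hij)

variable [IsProbabilityMeasure G]

lemma hasLaw_knnMass (hd : 1 ≤ d) (hac : G ≪ volume) (hY_law : ∀ i, HasLaw (Y i) G P)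
    (hY_indep : iIndepFun Y P) {k n : ℕ} (hk : 1 ≤ k) (hn : k ≤ n) :
    HasLaw (fun ω => (Y 0 ω, knnMass G k fun i : Fin (n + 1) => Y i ω))
      (G.prod (orderMeasure k n)) P :=
  (measurePreserving_knnMass G (measure_sphere_eq_zero hd hac) hk hn).fun_comp_hasLaw (hasLaw_sample hY_law hY_indep (n + 1))

lemma ae_prod_dist_pos (hd : 1 ≤ d) (hac : G ≪ volume) :
    ∀ᵐ p ∂(G.prod G), 0 < dist p.1 p.2 := by
  have hms : MeasurableSet {p : EuclideanSpace ℝ (Fin d) × EuclideanSpace ℝ (Fin d) |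
      0 < dist p.1 p.2} := measurableSet_lt measurable_const (measurable_fst.dist measurable_snd)
  refine (Measure.ae_prod_iff_ae_ae hms).2 (Eventually.of_forall fun x => ?_)
  have := measure_sphere_eq_zero hd hac x 0
  rw [Metric.sphere_zero] at this
  filter_upwards [(measure_eq_zero_iff_ae_notMem.1 this)] with y hy
  exact dist_pos.2 fun h => hy (by simp [h])

variable [IsProbabilityMeasure P]

lemma ae_dist_pos (hd : 1 ≤ d) (hac : G ≪ volume) (hY_law : ∀ i, HasLaw (Y i) G P)
    (hY_indep : iIndepFun Y P) : ∀ᵐ ω ∂P, ∀ i j, i ≠ j → 0 < dist (Y i ω) (Y j ω) := by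
  refine ae_all_iff.2 fun i => ae_all_iff.2 fun j => ?_
  by_cases hij : i = j
  · simp [hij]
  filter_upwards [(hasLaw_pair hY_law hY_indep hij).ae_comp (ae_prod_dist_pos hd hac)] with ω hω _
  exact hω

lemma ae_knnDist_pos (hd : 1 ≤ d) (hac : G ≪ volume) (hY_law : ∀ i, HasLaw (Y i) G P)
    (hY_indep : iIndepFun Y P) {k : ℕ} (hk : 1 ≤ k) :
    ∀ᵐ ω ∂P, ∀ n, k ≤ n → 0 < knnDist k (fun i : Fin (n + 1) => Y i ω) 0 := by
  filter_upwards [ae_dist_pos hd hac hY_law hY_indep] with ω hω n hn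
  refine knnDist_pos hk (by omega) _ _ fun j hj => hω _ _ fun h => hj (Fin.ext h)

lemma integral_knnMass (hd : 1 ≤ d) (hac : G ≪ volume) (hY_law : ∀ i, HasLaw (Y i) G P)
    (hY_indep : iIndepFun Y P) {k n : ℕ} (hk : 1 ≤ k) (hn : k ≤ n) :
    ∫ ω, knnMass G k (fun i : Fin (n + 1) => Y i ω) ∂P = k / (n + 1) := by
  have h := hasLaw_knnMass hd hac hY_law hY_indep hk hn
  have h2 := h.integral_comp (f := fun p => p.2) measurable_snd.aestronglyMeasurable
  simp only [Function.comp_def] at h2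
  rw [h2, integral_fun_snd (μ := G) (ν := orderMeasure k n) (fun v : ℝ => v), integral_orderMeasure]
  obtain ⟨l, rfl⟩ : ∃ l, k = l + 1 := ⟨k - 1, by omega⟩
  obtain ⟨m, rfl⟩ : ∃ m, n = l + 1 + m := ⟨n - (l + 1), by omega⟩
  rw [integral_orderDensity_mul_self]
  simp
  ring_nf

/-- Nearest-neighbour distances tend to zero. -/
lemma ae_tendsto_knnDist (hd : 1 ≤ d) (hg_meas : Measurable g) (hg_nonneg : ∀ x, 0 ≤ g x)
    (hG : G = volume.withDensity fun x => ENNReal.ofReal (g x))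
    (hY_law : ∀ i, HasLaw (Y i) G P) (hY_indep : iIndepFun Y P) {k : ℕ} (hk : 1 ≤ k) :
    ∀ᵐ ω ∂P, Tendsto (fun n => knnDist k (fun i : Fin (n + 1) => Y i ω) 0) atTop (𝓝 0) := by
  have hac : G ≪ volume := hG ▸ withDensity_absolutelyContinuous _ _
  have hgood := (hY_law 0).ae_comp (ae_pos_and_tendsto_meanDensity hd hg_meas hg_nonneg hG)
  have hUm : ∀ n, AEMeasurable
      (fun ω => ENNReal.ofReal (knnMass G k fun i : Fin (k + n + 1) => Y i ω)) P := fun n =>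
    ((measurable_snd.comp_aemeasurable
      (hasLaw_knnMass hd hac hY_law hY_indep hk (by omega : k ≤ k + n)).aemeasurable)).ennreal_ofReal
  -- The infimum over all sample sizes is below each mass, whose mean k/(k + n + 1) tends to 0; so
  -- it vanishes almost surely.
  have hzero : ∫⁻ ω, ⨅ n, ENNReal.ofReal (knnMass G k fun i : Fin (k + n + 1) => Y i ω) ∂P = 0 := by
    have hle : ∀ n : ℕ,
        ∫⁻ ω, ⨅ n, ENNReal.ofReal (knnMass G k fun i : Fin (k + n + 1) => Y i ω) ∂P ≤
          ENNReal.ofReal (k / ((k + n : ℕ) + 1)) := by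
      intro n
      rw [← integral_knnMass hd hac hY_law hY_indep hk (by omega : k ≤ k + n),
        ofReal_integral_eq_lintegral_ofReal]
      · exact lintegral_mono fun ω => iInf_le _ n
      · refine Integrable.of_bound ((measurable_snd.comp_aemeasurable
          (hasLaw_knnMass hd hac hY_law hY_indep hk
            (by omega : k ≤ k + n)).aemeasurable)).aestronglyMeasurable 1 (ae_of_all _ fun ω => ?_)
        rw [knnMass, Real.norm_of_nonneg measureReal_nonneg]
        exact measureReal_le_one
      · exact ae_of_all _ fun ω => measureReal_nonneg
    have ht : Tendsto (fun n : ℕ => (k : ℝ) / ((k + n : ℕ) + 1)) atTop (𝓝 0) := by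
      refine Tendsto.div_atTop tendsto_const_nhds (tendsto_atTop_add_const_right _ _ ?_)
      refine tendsto_natCast_atTop_atTop.comp ?_
      simpa only [add_comm] using tendsto_add_atTop_nat k
    have ht' := ENNReal.tendsto_ofReal ht
    rw [ENNReal.ofReal_zero] at ht'
    exact le_antisymm (ge_of_tendsto' ht' hle) zero_le
  have hae := (lintegral_eq_zero_iff' (AEMeasurable.iInf hUm)).1 hzero
  filter_upwards [hgood, hae] with ω hω h0
  refine tendsto_order.2 ⟨fun a ha => ?_, fun ε hε => ?_⟩
  · filter_upwards [eventually_ge_atTop k] with n hn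
    exact ha.trans_le (knnDist_nonneg hk (by omega) _ _)
  -- If every distance were at least ε, every mass would be at least the positive mass of the
  -- ε-ball. Once one distance is below ε, all later ones are.
  · have hp := measureReal_closedBall_pos hω hε
    have h1 : ⨅ n, ENNReal.ofReal (knnMass G k fun i : Fin (k + n + 1) => Y i ω) <
        ENNReal.ofReal (G.real (Metric.closedBall (Y 0 ω) ε)) := by
      rw [h0]; exact ENNReal.ofReal_pos.2 hp
    obtain ⟨m, hm⟩ := iInf_lt_iff.1 h1
    rw [ENNReal.ofReal_lt_ofReal_iff hp] at hm
    have hR : knnDist k (fun i : Fin (k + m + 1) => Y i ω) 0 < ε := by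
      by_contra h
      exact absurd (measureReal_mono (Metric.closedBall_subset_closedBall (not_lt.1 h)))
        (not_le.2 hm)
    filter_upwards [eventually_ge_atTop (k + m)] with n hn
    exact (knnDist_zero_antitone hk (by omega) hn fun i => Y i ω).trans_lt hR

/-- The logarithm of the mean density of `G` on the nearest-neighbour ball of `y 0`. -/
noncomputable def knnLogDensity (G : Measure (EuclideanSpace ℝ (Fin d))) (k : ℕ) {n : ℕ}
    (y : Fin (n + 1) → EuclideanSpace ℝ (Fin d)) : ℝ :=
  Real.log (meanDensity G (y 0) (knnDist k y 0))

lemma measurable_knnLogDensity {k n : ℕ} (hk : 1 ≤ k) (hn : k ≤ n) :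
    Measurable fun y : Fin (n + 1) → EuclideanSpace ℝ (Fin d) => knnLogDensity G k y := by
  unfold knnLogDensity meanDensity
  exact Real.measurable_log.comp ((measurable_knnMass G hk hn).div
    (((measurable_knnDist hk (by omega) 0).pow_const d).const_mul _))

lemma ae_tendsto_knnLogDensity (hd : 1 ≤ d) (hg_meas : Measurable g) (hg_nonneg : ∀ x, 0 ≤ g x)
    (hG : G = volume.withDensity fun x => ENNReal.ofReal (g x))
    (hY_law : ∀ i, HasLaw (Y i) G P) (hY_indep : iIndepFun Y P) {k : ℕ} (hk : 1 ≤ k) :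
    ∀ᵐ ω ∂P, Tendsto (fun n => knnLogDensity G k fun i : Fin (n + 1) => Y i ω) atTop
      (𝓝 (Real.log (g (Y 0 ω)))) := by
  have hac : G ≪ volume := hG ▸ withDensity_absolutelyContinuous _ _
  have hgood := (hY_law 0).ae_comp (ae_pos_and_tendsto_meanDensity hd hg_meas hg_nonneg hG)
  filter_upwards [hgood, ae_tendsto_knnDist hd hg_meas hg_nonneg hG hY_law hY_indep hk,
    ae_knnDist_pos hd hac hY_law hY_indep hk] with ω h1 h2 h3
  have h4 : Tendsto (fun n => knnDist k (fun i : Fin (n + 1) => Y i ω) 0) atTop (𝓝[>] 0) := by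
    refine tendsto_nhdsWithin_iff.2 ⟨h2, ?_⟩
    filter_upwards [eventually_ge_atTop k] with n hn
    exact h3 n hn
  exact (h1.2.comp h4).log h1.1.ne'

/-- The logarithms of the mean densities have a common square-integrable majorant. -/
lemma exists_majorant_knnLogDensity (hd : 1 ≤ d) (hg_meas : Measurable g)
    (hg_nonneg : ∀ x, 0 ≤ g x) (hG : G = volume.withDensity fun x => ENNReal.ofReal (g x))
    (hg_log : MemLp (fun x => Real.log (g x)) 2 G)
    (hdist_log : MemLp (fun p : EuclideanSpace ℝ (Fin d) × EuclideanSpace ℝ (Fin d) =>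
      Real.log (dist p.1 p.2)) 2 (G.prod G))
    (hY_law : ∀ i, HasLaw (Y i) G P) (hY_indep : iIndepFun Y P) {k : ℕ} (hk : 1 ≤ k) :
    ∃ Φ : Ω → ℝ, MemLp Φ 2 P ∧ ∀ᵐ ω ∂P, ∀ n, k ≤ n →
      |knnLogDensity G k fun i : Fin (n + 1) => Y i ω| ≤ Φ ω := by
  have hac : G ≪ volume := hG ▸ withDensity_absolutelyContinuous _ _
  -- By Fubini almost every slice is square-integrable; one reference point suffices.
  obtain ⟨y₀, hy₀⟩ : ∃ y₀, MemLp (fun x => Real.log (dist x y₀)) 2 G := by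
    obtain ⟨y, hy⟩ := hdist_log.integrable_sq.prod_left_ae.exists
    refine ⟨y, (memLp_two_iff_integrable_sq ?_).2 hy⟩
    exact (Real.measurable_log.comp (measurable_id.dist measurable_const)).aestronglyMeasurable
  obtain ⟨F₁, hF₁, hF₁0, hF₁le⟩ := exists_majorant_log_meanDensity hd hg_meas hG hg_log
  obtain ⟨F₂, hF₂, hF₂0, hF₂le⟩ := exists_majorant_neg_log_meanDensity hd hy₀
  have hmap : ∀ {F : EuclideanSpace ℝ (Fin d) → ℝ}, MemLp F 2 G → MemLp (fun ω => F (Y 0 ω)) 2 P :=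
    fun {F} hF => by
      have hF' : MemLp F 2 (P.map (Y 0)) := by rwa [(hY_law 0).map_eq]
      exact (memLp_map_measure_iff hF'.1 (hY_law 0).aemeasurable).1 hF'
  have hdist : ∀ j : ℕ, MemLp (fun ω => |Real.log (dist (Y (j + 1) ω) (Y 0 ω))|) 2 P := fun j => by
    have hlaw := hasLaw_pair hY_law hY_indep (show j + 1 ≠ 0 by omega)
    rw [← hlaw.map_eq] at hdist_log
    exact ((memLp_map_measure_iff hdist_log.1 hlaw.aemeasurable).1 hdist_log).abs
  -- `F₁` bounds from above at every radius, `F₂` from below at radii up to 1, and the sum over the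
  -- first `k` further points pays for radii above 1.
  refine ⟨fun ω => F₁ (Y 0 ω) + F₂ (Y 0 ω) +
    d * ∑ j ∈ Finset.range k, |Real.log (dist (Y (j + 1) ω) (Y 0 ω))|,
    ((hmap hF₁).add (hmap hF₂)).add ((memLp_finsetSum _ fun j _ => hdist j).const_mul _), ?_⟩
  have hV := unitBallVol_pos d
  filter_upwards [(hY_law 0).ae_comp (ae_pos_and_tendsto_meanDensity hd hg_meas hg_nonneg hG),
    (hY_law 0).ae_comp hF₁le,
    (hY_law 0).ae_comp hF₂le,
    ae_knnDist_pos hd hac hY_law hY_indep hk] with ω hgood h1 h2 h3 n hn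
  set S := ∑ j ∈ Finset.range k, |Real.log (dist (Y (j + 1) ω) (Y 0 ω))|
  have hS0 : 0 ≤ S := Finset.sum_nonneg fun _ _ => abs_nonneg _
  have hdS0 : 0 ≤ d * S := by positivity
  set R := knnDist k (fun i : Fin (n + 1) => Y i ω) 0
  have hR : 0 < R := h3 n hn
  have hF10 := hF₁0 (Y 0 ω)
  have hF20 := hF₂0 (Y 0 ω)
  change |Real.log (meanDensity G (Y 0 ω) R)| ≤ _
  refine abs_le'.2 ⟨(h1 R hR).trans (by linarith), ?_⟩
  rcases le_or_gt R 1 with hR1 | hR1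
  · exact (h2 R hR hR1).trans (by linarith)
  · have hlogR : Real.log R ≤ S := by
      obtain ⟨j, hj, hmax⟩ := Finset.exists_max_image (Finset.range k)
        (fun j => dist (Y (j + 1) ω) (Y 0 ω)) ⟨0, Finset.mem_range.2 hk⟩
      have hRj : R ≤ dist (Y (j + 1) ω) (Y 0 ω) :=
        knnDist_zero_le_of_forall hk hn (fun i => Y i ω) fun i hi => hmax i (by simpa using hi)
      calc Real.log R ≤ Real.log (dist (Y (j + 1) ω) (Y 0 ω)) := Real.log_le_log hR hRj
        _ ≤ |Real.log (dist (Y (j + 1) ω) (Y 0 ω))| := le_abs_self _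
        _ ≤ S := Finset.single_le_sum (f := fun j => |Real.log (dist (Y (j + 1) ω) (Y 0 ω))|)
            (fun _ _ => abs_nonneg _) hj
    have hm1 : 0 < meanDensity G (Y 0 ω) 1 :=
      div_pos (measureReal_closedBall_pos hgood one_pos) (by positivity)
    -- Growing the unit ball to radius R dilutes the mean density by at most the volume ratio R^d.
    have hle : meanDensity G (Y 0 ω) 1 / R ^ d ≤ meanDensity G (Y 0 ω) R := by
      unfold meanDensity
      rw [one_pow, mul_one, div_div]
      exact div_le_div_of_nonneg_right (measureReal_mono
        (Metric.closedBall_subset_closedBall hR1.le)) (by positivity)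
    have hlog := Real.log_le_log (by positivity) hle
    rw [Real.log_div hm1.ne' (by positivity), Real.log_pow] at hlog
    have h4 := h2 1 one_pos le_rfl
    have h5 : d * Real.log R ≤ d * S := by gcongr
    linarith

end sample

/-! ### The variance of the logarithmic volume -/

section general

variable {Ω : Type*} [MeasurableSpace Ω] {P : Measure Ω} [IsProbabilityMeasure P]

/-- Cauchy–Schwarz, as the discriminant of the nonnegative quadratic t ↦ Var(X - tZ). -/
lemma sq_covariance_le {X Z : Ω → ℝ} (hX : MemLp X 2 P) (hZ : MemLp Z 2 P) :
    cov[X, Z; P] ^ 2 ≤ Var[X; P] * Var[Z; P] := by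
  have h := discrim_le_zero (a := Var[Z; P]) (b := -2 * cov[X, Z; P]) (c := Var[X; P]) fun t => by
    have h1 := variance_nonneg (fun ω => X ω - t * Z ω) P
    rw [variance_fun_sub hX (hZ.const_mul t), variance_const_mul, covariance_const_mul_right] at h1
    linarith
  unfold discrim at h
  linarith

lemma abs_covariance_le {X Z : Ω → ℝ} (hX : MemLp X 2 P) (hZ : MemLp Z 2 P) :
    |cov[X, Z; P]| ≤ √(Var[X; P]) * √(Var[Z; P]) := by
  rw [← Real.sqrt_mul (variance_nonneg _ _)]
  exact Real.abs_le_sqrt (sq_covariance_le hX hZ)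

lemma tendsto_variance_sub {X D : ℕ → Ω → ℝ} {v : ℝ} (hX : ∀ᶠ n in atTop, MemLp (X n) 2 P)
    (hD : ∀ᶠ n in atTop, MemLp (D n) 2 P)
    (hv : Tendsto (fun n => Var[X n; P]) atTop (𝓝 v))
    (h0 : Tendsto (fun n => Var[D n; P]) atTop (𝓝 0)) :
    Tendsto (fun n => Var[fun ω => X n ω - D n ω; P]) atTop (𝓝 v) := by
  have hc : Tendsto (fun n => cov[X n, D n; P]) atTop (𝓝 0) := by
    refine squeeze_zero_norm' (a := fun n => √(Var[X n; P]) * √(Var[D n; P])) ?_ ?_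
    · filter_upwards [hX, hD] with n h1 h2
      exact abs_covariance_le h1 h2
    · have := hv.sqrt.mul h0.sqrt
      simpa using this
  have := (hv.sub (hc.const_mul 2)).add h0
  rw [mul_zero, sub_zero, add_zero] at this
  refine this.congr' ?_
  filter_upwards [hX, hD] with n h1 h2
  exact (variance_fun_sub h1 h2).symm

end general

section

variable {d : ℕ} {G : Measure (EuclideanSpace ℝ (Fin d))} {g : EuclideanSpace ℝ (Fin d) → ℝ}

/-- Volume is mass over mean density. This separates a universal term, independent of the centre,
from one that converges to log g at the centre. -/
lemma knnLogVol_eq {k n : ℕ} (hk : 1 ≤ k) (hn : k ≤ n)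
    {y : Fin (n + 1) → EuclideanSpace ℝ (Fin d)} (hR : 0 < knnDist k y 0)
    (hU : 0 < knnMass G k y) :
    knnLogVol k y 0 = Real.log (n / k * knnMass G k y) - knnLogDensity G k y := by
  have hn0 : (0 : ℝ) < n := by exact_mod_cast (by omega : 0 < n)
  have hk0 : (0 : ℝ) < k := by exact_mod_cast hk
  have hV := unitBallVol_pos d
  have hm : meanDensity G (y 0) (knnDist k y 0) =
      knnMass G k y / (unitBallVol d * knnDist k y 0 ^ d) := rfl
  rw [knnLogDensity, hm, ← Real.log_div (by positivity) (by positivity), knnLogVol]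
  congr 1
  have hpi : Real.pi ^ ((d : ℝ) / 2) = √Real.pi ^ d := by
    rw [Real.sqrt_eq_rpow, ← Real.rpow_natCast, ← Real.rpow_mul Real.pi_pos.le]
    ring_nf
  have hG : 0 < Real.Gamma ((d : ℝ) / 2 + 1) := Real.Gamma_pos_of_pos (by positivity)
  rw [hpi, unitBallVol]
  push_cast
  field_simp
  ring

lemma measurable_knnLogVol {k N : ℕ} (hk : 1 ≤ k) (hN : k < N) (i : Fin N) :
    Measurable fun y : Fin N → EuclideanSpace ℝ (Fin d) => knnLogVol k y i := by
  unfold knnLogVol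
  exact Real.measurable_log.comp
    ((((measurable_knnDist hk hN i).pow_const d).const_mul _).div_const _)

end

lemma tendsto_recipSum (k : ℕ) (hk : 1 ≤ k) :
    Tendsto (fun n => recipSum 2 (k - 1) (n - k)) atTop (𝓝 (inverseSquareTail k)) := by
  have hs : Summable fun j : ℕ => 1 / ((k + j : ℕ) : ℝ) ^ 2 := by
    have := (summable_nat_add_iff (f := fun j : ℕ => 1 / (j : ℝ) ^ 2) k).2
      (Real.summable_one_div_nat_pow.2 one_lt_two)
    refine this.congr fun j => ?_
    rw [add_comm]
  have h1 := (tendsto_add_atTop_iff_nat 1).2 hs.hasSum.tendsto_sum_nat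
  have h2 := h1.comp (tendsto_sub_atTop_nat k)
  refine h2.congr fun n => ?_
  obtain ⟨l, rfl⟩ : ∃ l, k = l + 1 := ⟨k - 1, by omega⟩
  simp [recipSum]

/-- Truncation of a real number to the interval `[-M, M]`. -/
noncomputable def clip (M t : ℝ) : ℝ := max (-M) (min M t)

lemma abs_sub_clip_le {M : ℝ} (hM : 0 < M) (t : ℝ) : |t - clip M t| ≤ max (|t| - M) 0 := by
  unfold clip
  rcases le_total t M with h1 | h1
  · rw [min_eq_right h1]
    rcases le_total (-M) t with h2 | h2
    · rw [max_eq_right h2, sub_self, abs_zero]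
      exact le_max_right _ _
    · rw [max_eq_left h2, abs_of_nonpos (by linarith : t ≤ 0), abs_of_nonpos (by linarith)]
      exact le_max_of_le_left (by linarith)
  · rw [min_eq_left h1, max_eq_right (by linarith), abs_of_nonneg (by linarith : 0 ≤ t),
      abs_of_nonneg (by linarith)]
    exact le_max_left _ _

/-- An excess of |w - l| over M splits into excesses of |w| and of b over M/2. The first is at most
2w²/M, so a fourth moment of w controls its square; the second is left for dominated convergence. -/
lemma sq_sub_clip_le {M w l b : ℝ} (hM : 0 < M) (hl : |l| ≤ b) :
    (w - l - clip M (w - l)) ^ 2 ≤ 8 / M ^ 2 * w ^ 4 + 2 * max (b - M / 2) 0 ^ 2 := by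
  have h1 : |w - l - clip M (w - l)| ≤ max (|w| - M / 2) 0 + max (b - M / 2) 0 := by
    refine (abs_sub_clip_le hM _).trans (max_le ?_ (by positivity))
    have h2 := le_max_left (|w| - M / 2) 0
    have h3 := le_max_left (b - M / 2) 0
    have h4 := abs_sub w l
    linarith
  have h2 : max (|w| - M / 2) 0 ≤ 2 * w ^ 2 / M := by
    rcases le_total (|w| - M / 2) 0 with h | h
    · rw [max_eq_right h]; positivity
    · rw [max_eq_left h, le_div_iff₀ hM, ← sq_abs w]
      nlinarith [abs_nonneg w]
  have h3 : 0 ≤ max (|w| - M / 2) 0 := le_max_right _ _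
  have h4 : max (|w| - M / 2) 0 ^ 2 ≤ 4 / M ^ 2 * w ^ 4 := by
    calc max (|w| - M / 2) 0 ^ 2 ≤ (2 * w ^ 2 / M) ^ 2 := by gcongr
      _ = _ := by ring
  calc (w - l - clip M (w - l)) ^ 2 = |w - l - clip M (w - l)| ^ 2 := (sq_abs _).symm
    _ ≤ (max (|w| - M / 2) 0 + max (b - M / 2) 0) ^ 2 := by gcongr
    _ ≤ 2 * max (|w| - M / 2) 0 ^ 2 + 2 * max (b - M / 2) 0 ^ 2 := by
        nlinarith [sq_nonneg (max (|w| - M / 2) 0 - max (b - M / 2) 0)]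
    _ ≤ 2 * (4 / M ^ 2 * w ^ 4) + 2 * max (b - M / 2) 0 ^ 2 := by gcongr
    _ = _ := by ring

/-! ### Limit variance and uniform truncation of the logarithmic volume -/

section sample

variable {d : ℕ} {G : Measure (EuclideanSpace ℝ (Fin d))} [IsProbabilityMeasure G]
  {g : EuclideanSpace ℝ (Fin d) → ℝ}
  {Ω : Type*} [MeasurableSpace Ω] {P : Measure Ω} [IsProbabilityMeasure P]
  {Y : ℕ → Ω → EuclideanSpace ℝ (Fin d)}

/-- The law of the mass of the nearest-neighbour ball. -/
lemma hasLaw_knnMass_snd (hd : 1 ≤ d) (hac : G ≪ volume) (hY_law : ∀ i, HasLaw (Y i) G P)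
    (hY_indep : iIndepFun Y P) {k n : ℕ} (hk : 1 ≤ k) (hn : k ≤ n) :
    HasLaw (fun ω => knnMass G k fun i : Fin (n + 1) => Y i ω) (orderMeasure k n) P := by
  have h := hasLaw_knnMass hd hac hY_law hY_indep hk hn
  have h2 : MeasurePreserving Prod.snd (G.prod (orderMeasure k n)) (orderMeasure k n) :=
    measurePreserving_snd
  exact h2.fun_comp_hasLaw h

lemma indepFun_knnMass (hd : 1 ≤ d) (hac : G ≪ volume) (hY_law : ∀ i, HasLaw (Y i) G P)
    (hY_indep : iIndepFun Y P) {k n : ℕ} (hk : 1 ≤ k) (hn : k ≤ n) :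
    IndepFun (fun ω => knnMass G k fun i : Fin (n + 1) => Y i ω) (Y 0) P :=
  ((indepFun_iff_hasLaw_prodMk_prod (hY_law 0)
    (hasLaw_knnMass_snd hd hac hY_law hY_indep hk hn)).2
      (hasLaw_knnMass hd hac hY_law hY_indep hk hn)).symm

lemma ae_orderMeasure_pos (k n : ℕ) : ∀ᵐ v ∂(orderMeasure k n), 0 < v := by
  refine (withDensity_absolutelyContinuous _ _).ae_le ?_
  filter_upwards [ae_restrict_mem measurableSet_Ioc] with v hv
  exact hv.1

lemma ae_knnMass_pos (hd : 1 ≤ d) (hac : G ≪ volume) (hY_law : ∀ i, HasLaw (Y i) G P)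
    (hY_indep : iIndepFun Y P) {k n : ℕ} (hk : 1 ≤ k) (hn : k ≤ n) :
    ∀ᵐ ω ∂P, 0 < knnMass G k fun i : Fin (n + 1) => Y i ω :=
  (hasLaw_knnMass_snd hd hac hY_law hY_indep hk hn).ae_comp (ae_orderMeasure_pos k n)

lemma integrable_log_knnMass_pow (hd : 1 ≤ d) (hac : G ≪ volume)
    (hY_law : ∀ i, HasLaw (Y i) G P) (hY_indep : iIndepFun Y P) {k n : ℕ} (hk : 1 ≤ k)
    (hn : k ≤ n) {c : ℝ} (hc : 0 < c) :
    Integrable (fun ω => Real.log (c * knnMass G k fun i : Fin (n + 1) => Y i ω) ^ 4) P := by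
  have h := hasLaw_knnMass_snd hd hac hY_law hY_indep hk hn
  have hi := integrable_log_mul_pow k n hc
  rw [← h.map_eq] at hi
  exact hi.comp_aemeasurable h.aemeasurable

lemma integral_log_knnMass_pow_le (hd : 1 ≤ d) (hac : G ≪ volume)
    (hY_law : ∀ i, HasLaw (Y i) G P) (hY_indep : iIndepFun Y P) {k n : ℕ} (hk : 1 ≤ k)
    (hn : k ≤ n) :
    ∫ ω, Real.log (n / k * knnMass G k fun i : Fin (n + 1) => Y i ω) ^ 4 ∂P ≤
      24 + 8 ^ 4 * 2 * k ^ k := by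
  have h := hasLaw_knnMass_snd hd hac hY_law hY_indep hk hn
  have h2 := h.integral_comp (f := fun v => Real.log (n / k * v) ^ 4)
    (Measurable.aestronglyMeasurable (by fun_prop))
  simp only [Function.comp_def] at h2
  rw [h2]
  exact integral_log_pow_four_le hk hn

lemma memLp_log_knnMass (hd : 1 ≤ d) (hac : G ≪ volume)
    (hY_law : ∀ i, HasLaw (Y i) G P) (hY_indep : iIndepFun Y P) {k n : ℕ} (hk : 1 ≤ k)
    (hn : k ≤ n) {c : ℝ} (hc : 0 < c) :
    MemLp (fun ω => Real.log (c * knnMass G k fun i : Fin (n + 1) => Y i ω)) 2 P := by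
  have h := hasLaw_knnMass_snd hd hac hY_law hY_indep hk hn
  have hm : AEMeasurable
      (fun ω => Real.log (c * knnMass G k fun i : Fin (n + 1) => Y i ω)) P :=
    Real.measurable_log.comp_aemeasurable (h.aemeasurable.const_mul c)
  rw [memLp_two_iff_integrable_sq hm.aestronglyMeasurable]
  refine ((integrable_const (1 : ℝ)).add
    (integrable_log_knnMass_pow hd hac hY_law hY_indep hk hn hc)).mono'
    (hm.pow_const 2).aestronglyMeasurable (ae_of_all _ fun ω => ?_)
  rw [Real.norm_of_nonneg (sq_nonneg _)]
  simp only [Pi.add_apply]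
  nlinarith [sq_nonneg (Real.log (c * knnMass G k fun i : Fin (n + 1) => Y i ω) ^ 2 - 1),
    sq_nonneg (Real.log (c * knnMass G k fun i : Fin (n + 1) => Y i ω))]

/-- The factor `c` only shifts the logarithm, and the value is ∑ 1/j² over k ≤ j ≤ n. -/
lemma variance_log_knnMass (hd : 1 ≤ d) (hac : G ≪ volume)
    (hY_law : ∀ i, HasLaw (Y i) G P) (hY_indep : iIndepFun Y P) {k n : ℕ} (hk : 1 ≤ k)
    (hn : k ≤ n) {c : ℝ} (hc : 0 < c) :
    Var[fun ω => Real.log (c * knnMass G k fun i : Fin (n + 1) => Y i ω); P] =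
      recipSum 2 (k - 1) (n - k) := by
  have h := hasLaw_knnMass_snd hd hac hY_law hY_indep hk hn
  have h1 : (fun ω => Real.log (c * knnMass G k fun i : Fin (n + 1) => Y i ω)) =ᵐ[P]
      fun ω => Real.log c + Real.log (1 * knnMass G k fun i : Fin (n + 1) => Y i ω) := by
    filter_upwards [ae_knnMass_pos hd hac hY_law hY_indep hk hn] with ω hω
    rw [Real.log_mul hc.ne' hω.ne', one_mul]
  have hL := memLp_log_knnMass hd hac hY_law hY_indep hk hn one_pos
  have hint : ∀ j : ℕ, ∫ ω, Real.log (1 * knnMass G k fun i : Fin (n + 1) => Y i ω) ^ j ∂P =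
      ∫ v in (0 : ℝ)..1, orderDensity k n v * Real.log v ^ j := by
    intro j
    have h2 := h.integral_comp (f := fun v => Real.log (1 * v) ^ j)
      (Measurable.aestronglyMeasurable (by fun_prop))
    simp only [Function.comp_def] at h2
    rw [h2, integral_orderMeasure]
    simp only [one_mul]
  have h1' := hint 1
  have h2' := hint 2
  rw [variance_congr h1, variance_const_add hL.1, variance_eq_sub hL]
  simp only [pow_one] at h1'
  simp only [Pi.pow_apply]
  rw [h1', h2']
  obtain ⟨l, rfl⟩ : ∃ l, k = l + 1 := ⟨k - 1, by omega⟩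
  obtain ⟨m, rfl⟩ : ∃ m, n = l + 1 + m := ⟨n - (l + 1), by omega⟩
  have e1 := integral_orderDensity_mul_log l m
  simp only [pow_one] at e1
  rw [integral_orderDensity_mul_log_sq, e1]
  simp

lemma memLp_comp_zero (hY_law : ∀ i, HasLaw (Y i) G P)
    {f : EuclideanSpace ℝ (Fin d) → ℝ} (hf : MemLp f 2 G) : MemLp (fun ω => f (Y 0 ω)) 2 P := by
  have hf' : MemLp f 2 (P.map (Y 0)) := by rwa [(hY_law 0).map_eq]
  exact (memLp_map_measure_iff hf'.1 (hY_law 0).aemeasurable).1 hf'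

lemma ae_knnLogVol_eq (hd : 1 ≤ d) (hac : G ≪ volume)
    (hY_law : ∀ i, HasLaw (Y i) G P) (hY_indep : iIndepFun Y P) {k n : ℕ} (hk : 1 ≤ k)
    (hn : k ≤ n) :
    (fun ω => knnLogVol k (fun i : Fin (n + 1) => Y i ω) 0) =ᵐ[P] fun ω =>
      Real.log (n / k * knnMass G k fun i : Fin (n + 1) => Y i ω) -
        knnLogDensity G k fun i : Fin (n + 1) => Y i ω := by
  filter_upwards [ae_knnMass_pos hd hac hY_law hY_indep hk hn,
    ae_knnDist_pos hd hac hY_law hY_indep hk] with ω h1 h2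
  exact knnLogVol_eq hk hn (h2 n hn) h1

variable (hd : 1 ≤ d) (hg_meas : Measurable g)
  (hg_nonneg : ∀ x, 0 ≤ g x) (hG : G = volume.withDensity fun x => ENNReal.ofReal (g x))
  (hg_log : MemLp (fun x => Real.log (g x)) 2 G)
  (hdist_log : MemLp (fun p : EuclideanSpace ℝ (Fin d) × EuclideanSpace ℝ (Fin d) =>
    Real.log (dist p.1 p.2)) 2 (G.prod G))
  (hY_law : ∀ i, HasLaw (Y i) G P) (hY_indep : iIndepFun Y P)

include hd hg_meas hg_nonneg hG hg_log hdist_log hY_law hY_indep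

lemma memLp_knnLogDensity {k n : ℕ} (hk : 1 ≤ k) (hn : k ≤ n) :
    MemLp (fun ω => knnLogDensity G k fun i : Fin (n + 1) => Y i ω) 2 P := by
  obtain ⟨Φ, hΦ, hle⟩ := exists_majorant_knnLogDensity hd hg_meas hg_nonneg hG hg_log hdist_log
    hY_law hY_indep hk
  refine hΦ.mono' ((measurable_knnLogDensity hk hn).comp_aemeasurable
    (hasLaw_sample hY_law hY_indep (n + 1)).aemeasurable).aestronglyMeasurable ?_
  filter_upwards [hle] with ω hω
  exact hω n hn

lemma memLp_knnLogVol {k n : ℕ} (hk : 1 ≤ k) (hn : k ≤ n) :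
    MemLp (fun ω => knnLogVol k (fun i : Fin (n + 1) => Y i ω) 0) 2 P := by
  have hac : G ≪ volume := hG ▸ withDensity_absolutelyContinuous _ _
  have hn0 : (0 : ℝ) < n := by exact_mod_cast (by omega : 0 < n)
  have hk0 : (0 : ℝ) < k := by exact_mod_cast hk
  exact ((memLp_log_knnMass hd hac hY_law hY_indep hk hn (div_pos hn0 hk0)).sub
    (memLp_knnLogDensity hd hg_meas hg_nonneg hG hg_log hdist_log hY_law hY_indep hk hn)).ae_eq
      (ae_knnLogVol_eq hd hac hY_law hY_indep hk hn).symm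

/-- Decompose into X - D, where X = log(nU/k) - log g(Y_0) has independent terms, hence a variance
that is a sum, and D is the error of the log mean density, which tends to 0 in L² by dominated
convergence. -/
lemma tendsto_variance_knnLogVol {k : ℕ} (hk : 1 ≤ k) :
    Tendsto (fun n => Var[fun ω => knnLogVol k (fun i : Fin (n + 1) => Y i ω) 0; P]) atTop
      (𝓝 (inverseSquareTail k + Var[fun x => Real.log (g x); G])) := by
  have hac : G ≪ volume := hG ▸ withDensity_absolutelyContinuous _ _
  have hk0 : (0 : ℝ) < k := by exact_mod_cast hk
  have hℓ := memLp_comp_zero hY_law hg_log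
  set X : ℕ → Ω → ℝ := fun n ω =>
    Real.log (n / k * knnMass G k fun i : Fin (n + 1) => Y i ω) - Real.log (g (Y 0 ω))
  set D : ℕ → Ω → ℝ := fun n ω =>
    (knnLogDensity G k fun i : Fin (n + 1) => Y i ω) - Real.log (g (Y 0 ω))
  have hpos : ∀ {n : ℕ}, k ≤ n → (0 : ℝ) < n / k := fun {n} hn =>
    div_pos (by exact_mod_cast (by omega : 0 < n)) hk0
  have hX : ∀ n, k ≤ n → MemLp (X n) 2 P := fun n hn =>
    (memLp_log_knnMass hd hac hY_law hY_indep hk hn (hpos hn)).sub hℓ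
  have hD : ∀ n, k ≤ n → MemLp (D n) 2 P := fun n hn =>
    (memLp_knnLogDensity hd hg_meas hg_nonneg hG hg_log hdist_log hY_law hY_indep hk hn).sub hℓ
  have hvarX : ∀ n, k ≤ n → Var[X n; P] =
      recipSum 2 (k - 1) (n - k) + Var[fun x => Real.log (g x); G] := by
    intro n hn
    have hW := memLp_log_knnMass hd hac hY_law hY_indep hk hn (hpos hn)
    rw [variance_fun_sub hW hℓ, variance_log_knnMass hd hac hY_law hY_indep hk hn (hpos hn)]
    have hind := (indepFun_knnMass hd hac hY_law hY_indep hk hn).comp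
      (φ := fun v => Real.log (n / k * v)) (ψ := fun x => Real.log (g x))
      (by fun_prop) (Real.measurable_log.comp hg_meas)
    have hcov := hind.covariance_eq_zero hW hℓ
    simp only [Function.comp_def] at hcov
    rw [hcov, mul_zero, sub_zero]
    congr 1
    have hlm : Measurable fun x => Real.log (g x) := Real.measurable_log.comp hg_meas
    rw [← (hY_law 0).map_eq, variance_map hlm.aemeasurable (hY_law 0).aemeasurable]
    rfl
  have hvX : Tendsto (fun n => Var[X n; P]) atTop
      (𝓝 (inverseSquareTail k + Var[fun x => Real.log (g x); G])) := by
    refine ((tendsto_recipSum k hk).add_const _).congr' ?_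
    filter_upwards [eventually_ge_atTop k] with n hn
    exact (hvarX n hn).symm
  have hDsq : Tendsto (fun n => ∫ ω, D n ω ^ 2 ∂P) atTop (𝓝 0) := by
    obtain ⟨Φ, hΦ, hle⟩ := exists_majorant_knnLogDensity hd hg_meas hg_nonneg hG hg_log hdist_log
      hY_law hY_indep hk
    have hB : MemLp (fun ω => Φ ω + |Real.log (g (Y 0 ω))|) 2 P := hΦ.add hℓ.abs
    have := tendsto_integral_filter_of_dominated_convergence (μ := P) (l := atTop)
      (F := fun n ω => D n ω ^ 2) (f := fun _ => (0 : ℝ))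
      (fun ω => (Φ ω + |Real.log (g (Y 0 ω))|) ^ 2) ?_ ?_ hB.integrable_sq ?_
    · simpa using this
    · filter_upwards [eventually_ge_atTop k] with n hn
      exact (hD n hn).1.pow 2
    · filter_upwards [eventually_ge_atTop k] with n hn
      filter_upwards [hle] with ω hω
      rw [norm_pow, Real.norm_eq_abs]
      gcongr
      exact (abs_sub _ _).trans (by gcongr; exact hω n hn)
    · filter_upwards [ae_tendsto_knnLogDensity hd hg_meas hg_nonneg hG hY_law hY_indep hk] with ω hω
      have := (hω.sub_const (Real.log (g (Y 0 ω)))).pow 2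
      simpa [D] using this
  have hvD : Tendsto (fun n => Var[D n; P]) atTop (𝓝 0) := by
    refine squeeze_zero' (Eventually.of_forall fun n => variance_nonneg _ _) ?_ hDsq
    filter_upwards [eventually_ge_atTop k] with n hn
    exact variance_le_expectation_sq (hD n hn).1
  refine (tendsto_variance_sub ((eventually_ge_atTop k).mono hX)
    ((eventually_ge_atTop k).mono hD) hvX hvD).congr' ?_
  filter_upwards [eventually_ge_atTop k] with n hn
  refine variance_congr ?_
  filter_upwards [ae_knnLogVol_eq hd hac hY_law hY_indep hk hn] with ω hω
  rw [hω]
  simp only [X, D]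
  ring

/-- The logarithmic volumes are uniformly square-integrable. -/
lemma exists_clip_knnLogVol {k : ℕ} (hk : 1 ≤ k) {ε : ℝ} (hε : 0 < ε) :
    ∃ M : ℝ, 0 < M ∧ ∀ n, k ≤ n →
      ∫ ω, (knnLogVol k (fun i : Fin (n + 1) => Y i ω) 0
        - clip M (knnLogVol k (fun i : Fin (n + 1) => Y i ω) 0)) ^ 2 ∂P ≤ ε := by
  have hac : G ≪ volume := hG ▸ withDensity_absolutelyContinuous _ _
  have hk0 : (0 : ℝ) < k := by exact_mod_cast hk
  obtain ⟨Φ, hΦ, hle⟩ := exists_majorant_knnLogDensity hd hg_meas hg_nonneg hG hg_log hdist_log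
    hY_law hY_indep hk
  have hΦm : ∀ M : ℝ, AEStronglyMeasurable (fun ω => max (Φ ω - M / 2) 0 ^ 2) P := fun M =>
    ((hΦ.1.aemeasurable.sub_const _).max aemeasurable_const).pow_const 2 |>.aestronglyMeasurable
  have hΦle : ∀ {M : ℝ}, 0 ≤ M → ∀ ω, ‖max (Φ ω - M / 2) 0 ^ 2‖ ≤ Φ ω ^ 2 := by
    intro M hM ω
    rw [Real.norm_of_nonneg (sq_nonneg _)]
    refine sq_le_sq.2 ?_
    rw [abs_of_nonneg (le_max_right _ _)]
    refine max_le ?_ (abs_nonneg _)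
    have := le_abs_self (Φ ω)
    linarith
  have htend : Tendsto (fun M : ℝ => ∫ ω, max (Φ ω - M / 2) 0 ^ 2 ∂P) atTop (𝓝 0) := by
    have := tendsto_integral_filter_of_dominated_convergence (μ := P) (l := atTop)
      (F := fun (M : ℝ) ω => max (Φ ω - M / 2) 0 ^ 2) (f := fun _ => (0 : ℝ))
      (fun ω => Φ ω ^ 2) (Eventually.of_forall hΦm) ?_ hΦ.integrable_sq ?_
    · simpa using this
    · filter_upwards [eventually_ge_atTop 0] with M hM
      exact ae_of_all _ (hΦle hM)
    · filter_upwards with ω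
      refine tendsto_const_nhds.congr' ?_
      filter_upwards [eventually_ge_atTop (2 * Φ ω)] with M hM
      rw [max_eq_right (by linarith)]
      norm_num
  set C : ℝ := 24 + 8 ^ 4 * 2 * k ^ k
  have htend2 : Tendsto (fun M : ℝ => 8 * C / M ^ 2) atTop (𝓝 0) :=
    tendsto_const_nhds.div_atTop (tendsto_pow_atTop two_ne_zero)
  -- The two terms of `sq_sub_clip_le` are each given ε/2; the second carries a factor 2, hence ε/4.
  obtain ⟨M, hM1, hM2, hM0⟩ := ((htend.eventually (gt_mem_nhds (show (0 : ℝ) < ε / 4 by linarith))).and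
    ((htend2.eventually (gt_mem_nhds (show (0 : ℝ) < ε / 2 by linarith))).and
      (eventually_gt_atTop 0))).exists
  refine ⟨M, hM0, fun n hn => ?_⟩
  have hpos : (0 : ℝ) < n / k := div_pos (by exact_mod_cast (by omega : 0 < n)) hk0
  set W : Ω → ℝ := fun ω => Real.log (n / k * knnMass G k fun i : Fin (n + 1) => Y i ω)
  have hW4 : Integrable (fun ω => W ω ^ 4) P :=
    integrable_log_knnMass_pow hd hac hY_law hY_indep hk hn hpos
  have hΦi : Integrable (fun ω => max (Φ ω - M / 2) 0 ^ 2) P :=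
    hΦ.integrable_sq.mono' (hΦm M) (ae_of_all _ (hΦle hM0.le))
  calc ∫ ω, (knnLogVol k (fun i : Fin (n + 1) => Y i ω) 0
        - clip M (knnLogVol k (fun i : Fin (n + 1) => Y i ω) 0)) ^ 2 ∂P
      ≤ ∫ ω, (8 / M ^ 2 * W ω ^ 4 + 2 * max (Φ ω - M / 2) 0 ^ 2) ∂P := by
        refine integral_mono_of_nonneg (ae_of_all _ fun ω => sq_nonneg _)
          ((hW4.const_mul _).add (hΦi.const_mul _)) ?_
        filter_upwards [hle, ae_knnLogVol_eq hd hac hY_law hY_indep hk hn] with ω h1 h2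
        have h1 := h1 n hn
        simp only [h2]
        exact sq_sub_clip_le hM0 h1
    _ = 8 / M ^ 2 * ∫ ω, W ω ^ 4 ∂P + 2 * ∫ ω, max (Φ ω - M / 2) 0 ^ 2 ∂P := by
        rw [integral_add (hW4.const_mul _) (hΦi.const_mul _), integral_const_mul,
          integral_const_mul]
    _ ≤ 8 / M ^ 2 * C + 2 * (ε / 4) := by
        gcongr
        exact integral_log_knnMass_pow_le hd hac hY_law hY_indep hk hn
    _ ≤ ε := by
        rw [div_mul_eq_mul_div]
        linarith

end sample

/-! ### Asymptotic independence of the logarithmic volumes at two points -/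

lemma measurable_clip (M : ℝ) : Measurable (clip M) :=
  measurable_const.max (measurable_const.min measurable_id)

lemma abs_clip_le {M : ℝ} (hM : 0 ≤ M) (t : ℝ) : |clip M t| ≤ M :=
  abs_le.2 ⟨le_max_left _ _, max_le (by linarith) (min_le_left _ _)⟩

section pi

variable {E : Type*} [MeasurableSpace E] (G : Measure E) [IsProbabilityMeasure G]

lemma measurePreserving_comp_perm {N : ℕ} (σ : Equiv.Perm (Fin N)) :
    MeasurePreserving (fun y : Fin N → E => y ∘ σ) (Measure.pi fun _ => G)
      (Measure.pi fun _ => G) := by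
  have h := measurePreserving_piCongrLeft (fun _ : Fin N => G) σ.symm
  convert h using 1
  ext y i
  have := MeasurableEquiv.piCongrLeft_apply_apply (β := fun _ : Fin N => E) σ.symm y (σ i)
  simp only [Equiv.symm_apply_apply] at this
  exact this.symm

lemma measurePreserving_finCons {n : ℕ} :
    MeasurePreserving (fun p : E × (Fin n → E) => (Fin.cons p.1 p.2 : Fin (n + 1) → E))
      (G.prod (Measure.pi fun _ => G)) (Measure.pi fun _ => G) := by
  have h := (measurePreserving_piFinSuccAbove (fun _ : Fin (n + 1) => G) 0).symm
  convert h using 1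
  funext p
  simp [MeasurableEquiv.piFinSuccAbove_symm_apply, Fin.insertNthEquiv]

lemma integral_pi_succ {n : ℕ} {f : (Fin (n + 1) → E) → ℝ}
    (hf : Integrable f (Measure.pi fun _ => G)) :
    ∫ y, f y ∂(Measure.pi fun _ => G) =
      ∫ x, ∫ z, f (Fin.cons x z) ∂(Measure.pi fun _ : Fin n => G) ∂G := by
  have h := measurePreserving_finCons G (n := n)
  rw [← integral_prod (fun p : E × (Fin n → E) => f (Fin.cons p.1 p.2))
    (h.integrable_comp_of_integrable hf), ← h.map_eq, integral_map h.measurable.aemeasurable]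
  rw [h.map_eq]
  exact hf.1

lemma integrable_of_abs_le {α : Type*} [MeasurableSpace α] {μ : Measure α} [IsFiniteMeasure μ]
    {f : α → ℝ} (hf : Measurable f) {C : ℝ} (hC : ∀ x, |f x| ≤ C) : Integrable f μ :=
  Integrable.of_bound hf.aestronglyMeasurable C (ae_of_all _ hC)

lemma abs_integral_le {α : Type*} [MeasurableSpace α] {μ : Measure α} [IsProbabilityMeasure μ]
    {f : α → ℝ} {C : ℝ} (hC : ∀ x, |f x| ≤ C) : |∫ x, f x ∂μ| ≤ C := by
  have := norm_integral_le_of_norm_le_const (μ := μ) (f := f) (ae_of_all _ hC)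
  simpa using this

variable {G} in
lemma abs_integral_le_of_eq_zero {A : Set E} {f : E → ℝ} {C : ℝ}
    (hC : ∀ x, |f x| ≤ C) (h0 : ∀ x ∉ A, f x = 0) : |∫ x, f x ∂G| ≤ C * G.real A := by
  rw [← setIntegral_eq_integral_of_forall_compl_eq_zero h0]
  exact norm_setIntegral_le_of_norm_le_const (f := f) (measure_lt_top _ _) fun x _ => hC x

variable {G} in
/-- Functions of a single point that are constant off disjoint sets are nearly uncorrelated. -/
lemma abs_integral_mul_sub_le {A B : Set E}
    (hAB : Disjoint A B) {f h : E → ℝ} (hf : Measurable f) (hh : Measurable h) {M : ℝ}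
    (hfM : ∀ x, |f x| ≤ M) (hhM : ∀ x, |h x| ≤ M)
    (hfA : ∀ x ∉ A, ∀ y ∉ A, f x = f y) (hhB : ∀ x ∉ B, ∀ y ∉ B, h x = h y) :
    |∫ x, f x * h x ∂G - (∫ x, f x ∂G) * ∫ x, h x ∂G| ≤ 4 * M ^ 2 * (G.real A * G.real B) := by
  have hne : Nonempty E := nonempty_of_isProbabilityMeasure G
  have hM0 : 0 ≤ M := (abs_nonneg _).trans (hfM hne.some)
  have key : ∀ {A : Set E} {f : E → ℝ}, (∀ x, |f x| ≤ M) → (∀ x ∉ A, ∀ y ∉ A, f x = f y) →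
      ∃ c, |c| ≤ M ∧ ∀ x ∉ A, f x - c = 0 := by
    intro A f hM hA
    by_cases h : ∃ x, x ∉ A
    · obtain ⟨x, hx⟩ := h
      exact ⟨f x, hM x, fun y hy => by rw [hA y hy x hx, sub_self]⟩
    · push Not at h
      exact ⟨0, by simpa using hM0, fun y hy => absurd (h y) hy⟩
  obtain ⟨c, hc, hfc⟩ := key hfM hfA
  obtain ⟨e, he, hhe⟩ := key hhM hhB
  have hfi : Integrable f G := integrable_of_abs_le hf hfM
  have hhi : Integrable h G := integrable_of_abs_le hh hhM
  -- With c and e the values of f and h off their sets, (f - c)(h - e) vanishes everywhere by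
  -- disjointness. The covariance is therefore -E(f - c) E(h - e), and each factor lives on its set
  -- only.
  have hprod : ∀ x, f x * h x = c * h x + e * f x - c * e := by
    intro x
    have : (f x - c) * (h x - e) = 0 := by
      by_cases hx : x ∈ A
      · rw [hhe x (Set.disjoint_left.1 hAB hx), mul_zero]
      · rw [hfc x hx, zero_mul]
    linarith
  have hI : ∫ x, f x * h x ∂G = c * ∫ x, h x ∂G + e * ∫ x, f x ∂G - c * e := by
    simp_rw [hprod]
    have hs : Integrable (fun x => c * h x + e * f x) G := (hhi.const_mul c).add (hfi.const_mul e)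
    rw [integral_sub hs (integrable_const _),
      integral_add (hhi.const_mul c) (hfi.const_mul e), integral_const_mul, integral_const_mul]
    simp
  have h1 : |∫ x, (f x - c) ∂G| ≤ 2 * M * G.real A :=
    abs_integral_le_of_eq_zero (fun x => (abs_sub _ _).trans (by linarith [hfM x])) hfc
  have h2 : |∫ x, (h x - e) ∂G| ≤ 2 * M * G.real B :=
    abs_integral_le_of_eq_zero (fun x => (abs_sub _ _).trans (by linarith [hhM x])) hhe
  rw [integral_sub hfi (integrable_const _)] at h1
  rw [integral_sub hhi (integrable_const _)] at h2
  simp only [integral_const, probReal_univ, one_smul] at h1 h2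
  calc |∫ x, f x * h x ∂G - (∫ x, f x ∂G) * ∫ x, h x ∂G|
      = |∫ x, f x ∂G - c| * |∫ x, h x ∂G - e| := by
        rw [hI, ← abs_mul, ← abs_neg]; congr 1; ring
    _ ≤ (2 * M * G.real A) * (2 * M * G.real B) := by gcongr
    _ = _ := by ring

/-- Functions of an i.i.d. sample that only depend on the points in disjoint sets are nearly
uncorrelated. -/
lemma abs_integral_pi_mul_sub_le {A B : Set E}
    (hAB : Disjoint A B) {M : ℝ} {n : ℕ} {f h : (Fin n → E) → ℝ} (hf : Measurable f)
    (hh : Measurable h) (hfM : ∀ x, |f x| ≤ M) (hhM : ∀ x, |h x| ≤ M)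
    (hfA : ∀ y z, (∀ j, y j = z j ∨ (y j ∉ A ∧ z j ∉ A)) → f y = f z)
    (hhB : ∀ y z, (∀ j, y j = z j ∨ (y j ∉ B ∧ z j ∉ B)) → h y = h z) :
    |∫ y, f y * h y ∂(Measure.pi fun _ => G) -
      (∫ y, f y ∂(Measure.pi fun _ => G)) * ∫ y, h y ∂(Measure.pi fun _ => G)| ≤
        n * (4 * M ^ 2 * (G.real A * G.real B)) := by
  have hne : Nonempty E := nonempty_of_isProbabilityMeasure G
  have hM0 : 0 ≤ M := (abs_nonneg _).trans (hfM fun _ => hne.some)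
  induction n with
  | zero =>
    have : ∀ φ : (Fin 0 → E) → ℝ, ∫ y, φ y ∂(Measure.pi fun _ => G) = φ default := by
      intro φ
      have : φ = fun _ => φ default := funext fun y => congrArg φ (Subsingleton.elim _ _)
      rw [this]
      simp
    simp [this]
  | succ n ih =>
    set π := Measure.pi fun _ : Fin n => G
    have hfc : Measurable fun p : E × (Fin n → E) => f (Fin.cons p.1 p.2) :=
      hf.comp measurable_finCons
    have hhc : Measurable fun p : E × (Fin n → E) => h (Fin.cons p.1 p.2) :=
      hh.comp measurable_finCons
    have hfhM : ∀ y, |f y * h y| ≤ M * M := fun y => by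
      rw [abs_mul]; exact mul_le_mul (hfM y) (hhM y) (abs_nonneg _) hM0
    -- Condition on the first point. Given it, the other points contribute at most the induction
    -- bound; the conditional means are functions of one point, again constant off `A` and `B`, and
    -- contribute one further term.
    set f' : E → ℝ := fun x => ∫ z, f (Fin.cons x z) ∂π
    set h' : E → ℝ := fun x => ∫ z, h (Fin.cons x z) ∂π
    set q : E → ℝ := fun x => ∫ z, f (Fin.cons x z) * h (Fin.cons x z) ∂π
    have hf' : Measurable f' := hfc.stronglyMeasurable.integral_prod_right.measurable
    have hh' : Measurable h' := hhc.stronglyMeasurable.integral_prod_right.measurable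
    have hq : Measurable q := (hfc.mul hhc).stronglyMeasurable.integral_prod_right.measurable
    have hf'M : ∀ x, |f' x| ≤ M := fun x => abs_integral_le fun z => hfM _
    have hh'M : ∀ x, |h' x| ≤ M := fun x => abs_integral_le fun z => hhM _
    have hqM : ∀ x, |q x| ≤ M * M := fun x => abs_integral_le fun z => hfhM _
    have hf'h'M : ∀ x, |f' x * h' x| ≤ M * M := fun x => by
      rw [abs_mul]; exact mul_le_mul (hf'M x) (hh'M x) (abs_nonneg _) hM0
    have hstep : ∀ x, |q x - f' x * h' x| ≤ n * (4 * M ^ 2 * (G.real A * G.real B)) := by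
      intro x
      refine ih (hfc.comp (measurable_const.prodMk measurable_id))
        (hhc.comp (measurable_const.prodMk measurable_id)) (fun z => hfM _) (fun z => hhM _) ?_ ?_
      · intro y z hyz
        refine hfA _ _ (Fin.cases (Or.inl rfl) fun j => ?_)
        simpa using hyz j
      · intro y z hyz
        refine hhB _ _ (Fin.cases (Or.inl rfl) fun j => ?_)
        simpa using hyz j
    have hone : |∫ x, f' x * h' x ∂G - (∫ x, f' x ∂G) * ∫ x, h' x ∂G| ≤
        4 * M ^ 2 * (G.real A * G.real B) := by
      refine abs_integral_mul_sub_le hAB hf' hh' hf'M hh'M ?_ ?_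
      · intro x hx y hy
        refine integral_congr_ae (ae_of_all _ fun z => hfA _ _ (Fin.cases ?_ fun j => Or.inl ?_))
        · exact Or.inr ⟨hx, hy⟩
        · simp
      · intro x hx y hy
        refine integral_congr_ae (ae_of_all _ fun z => hhB _ _ (Fin.cases ?_ fun j => Or.inl ?_))
        · exact Or.inr ⟨hx, hy⟩
        · simp
    have hint : |∫ x, q x ∂G - ∫ x, f' x * h' x ∂G| ≤ n * (4 * M ^ 2 * (G.real A * G.real B)) := by
      have hi : Integrable (fun x => f' x * h' x) G := integrable_of_abs_le (hf'.mul hh') hf'h'M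
      rw [← integral_sub (integrable_of_abs_le hq hqM) hi]
      exact abs_integral_le hstep
    have hi : Integrable (fun y => f y * h y) (Measure.pi fun _ => G) :=
      integrable_of_abs_le (hf.mul hh) hfhM
    rw [integral_pi_succ G hi,
      integral_pi_succ G (integrable_of_abs_le hf hfM),
      integral_pi_succ G (integrable_of_abs_le hh hhM)]
    calc _ = |(∫ x, q x ∂G - ∫ x, f' x * h' x ∂G) +
          (∫ x, f' x * h' x ∂G - (∫ x, f' x ∂G) * ∫ x, h' x ∂G)| := by congr 1; ring
      _ ≤ n * (4 * M ^ 2 * (G.real A * G.real B)) + 4 * M ^ 2 * (G.real A * G.real B) :=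
          (abs_add_le _ _).trans (add_le_add hint hone)
      _ = _ := by push_cast; ring

end pi

/-! ### The covariance of the logarithmic volumes at two points -/

section trunc

variable {d : ℕ}

/-- The factor `(N - 1) V / k` in the logarithmic volume, with `N - 1 = n`. -/
noncomputable def volFactor (d k n : ℕ) : ℝ := n * unitBallVol d / k

/-- The radius at which the logarithmic volume is `M`. -/
noncomputable def truncRadius (d k n : ℕ) (M : ℝ) : ℝ :=
  (Real.exp M / volFactor d k n) ^ (1 / (d : ℝ))

lemma volFactor_pos {k n : ℕ} (hk : 1 ≤ k) (hn : k ≤ n) : 0 < volFactor d k n := by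
  have hn0 : (0 : ℝ) < n := by exact_mod_cast (by omega : 0 < n)
  have hk0 : (0 : ℝ) < k := by exact_mod_cast hk
  have := unitBallVol_pos d
  unfold volFactor
  positivity

lemma truncRadius_pos {k n : ℕ} (hk : 1 ≤ k) (hn : k ≤ n) (M : ℝ) : 0 < truncRadius d k n M :=
  Real.rpow_pos_of_pos (div_pos (Real.exp_pos _) (volFactor_pos hk hn)) _

lemma truncRadius_pow (hd : 1 ≤ d) {k n : ℕ} (hk : 1 ≤ k) (hn : k ≤ n) (M : ℝ) :
    truncRadius d k n M ^ d = Real.exp M / volFactor d k n := by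
  have := volFactor_pos (d := d) hk hn
  rw [truncRadius, one_div, Real.rpow_inv_natCast_pow (by positivity) (by omega)]

lemma tendsto_truncRadius (hd : 1 ≤ d) {k : ℕ} (hk : 1 ≤ k) (M : ℝ) :
    Tendsto (fun n => truncRadius d k n M) atTop (𝓝[>] 0) := by
  refine tendsto_nhdsWithin_iff.2 ⟨?_, ?_⟩
  · have hV := unitBallVol_pos d
    have hk0 : (0 : ℝ) < k := by exact_mod_cast hk
    have h1 : Tendsto (fun n => volFactor d k n) atTop atTop :=
      (tendsto_natCast_atTop_atTop.atTop_mul_const hV).atTop_div_const hk0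
    have h2 : Tendsto (fun n => Real.exp M / volFactor d k n) atTop (𝓝 0) :=
      tendsto_const_nhds.div_atTop h1
    have hd0 : (0 : ℝ) < 1 / d := by positivity
    have h3 := h2.rpow_const (p := 1 / (d : ℝ)) (Or.inr hd0.le)
    rwa [Real.zero_rpow hd0.ne'] at h3
  · filter_upwards [eventually_ge_atTop k] with n hn
    exact truncRadius_pos hk hn M

lemma knnLogVol_eq_log_volFactor {k n : ℕ} (y : Fin (n + 1) → EuclideanSpace ℝ (Fin d))
    (i : Fin (n + 1)) : knnLogVol k y i = Real.log (volFactor d k n * knnDist k y i ^ d) := by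
  have hpi : Real.pi ^ ((d : ℝ) / 2) = √Real.pi ^ d := by
    rw [Real.sqrt_eq_rpow, ← Real.rpow_natCast, ← Real.rpow_mul Real.pi_pos.le]
    ring_nf
  rw [knnLogVol, hpi, volFactor, unitBallVol]
  push_cast
  congr 1
  ring

/-- Truncated logarithmic volumes only depend on the points close by. -/
lemma clip_knnLogVol_congr (hd : 1 ≤ d) {k n : ℕ} (hk : 1 ≤ k) (hn : k ≤ n) {M : ℝ} (hM : 0 < M)
    {y y' : Fin (n + 1) → EuclideanSpace ℝ (Fin d)} {i : Fin (n + 1)} (hi : y i = y' i)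
    (h : ∀ j, y j = y' j ∨ (truncRadius d k n M ≤ dist (y j) (y i) ∧
      truncRadius d k n M ≤ dist (y' j) (y' i))) :
    clip M (knnLogVol k y i) = clip M (knnLogVol k y' i) := by
  have hmin := min_knnDist_eq hk (by omega) hi h
  rw [knnLogVol_eq_log_volFactor, knnLogVol_eq_log_volFactor]
  have hc := volFactor_pos (d := d) hk hn
  have hρ := truncRadius_pos (d := d) hk hn M
  set ρ := truncRadius d k n M
  -- Any nearest-neighbour distance beyond ρ gives the clipped value M, so only distances truncated
  -- at ρ matter.
  have hbig : ∀ r, ρ ≤ r → clip M (Real.log (volFactor d k n * r ^ d)) = M := by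
    intro r hr
    have h1 : Real.exp M ≤ volFactor d k n * r ^ d := by
      have h2 : Real.exp M / volFactor d k n ≤ r ^ d := by
        rw [← truncRadius_pow hd hk hn]; gcongr
      rwa [div_le_iff₀' hc] at h2
    have h2 := (Real.le_log_iff_exp_le ((Real.exp_pos _).trans_le h1)).2 h1
    rw [clip, min_eq_left h2, max_eq_right (by linarith)]
  rcases lt_or_ge (knnDist k y i) ρ with h1 | h1
  · rw [min_eq_left h1.le] at hmin
    rcases lt_or_ge (knnDist k y' i) ρ with h2 | h2
    · rw [min_eq_left h2.le] at hmin
      rw [hmin]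
    · rw [min_eq_right h2] at hmin
      exact absurd h1 (by rw [hmin]; exact lt_irrefl _)
  · rw [min_eq_right h1] at hmin
    have h2 : ρ ≤ knnDist k y' i := hmin ▸ min_le_left _ _
    rw [hbig _ h1, hbig _ h2]

lemma knnLogVol_comp_perm {k N : ℕ} (y : Fin N → EuclideanSpace ℝ (Fin d))
    (σ : Equiv.Perm (Fin N)) (i : Fin N) : knnLogVol k (y ∘ σ) i = knnLogVol k y (σ i) := by
  unfold knnLogVol
  rw [knnDist_comp_perm]

/-- Turns the volume at the second point into the volume at the first with the two points exchanged,
so that one function `clipVol` serves both. -/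
lemma cons_cons_comp_swap {E : Type*} {n : ℕ} (x x' : E) (z : Fin n → E) :
    (Fin.cons x (Fin.cons x' z : Fin (n + 1) → E) : Fin (n + 2) → E) ∘ Equiv.swap 0 1 =
      Fin.cons x' (Fin.cons x z : Fin (n + 1) → E) := by
  funext i
  refine Fin.cases ?_ (fun j => Fin.cases ?_ (fun l => ?_) j) i
  · simp
  · rw [Fin.succ_zero_eq_one, Function.comp_apply, Equiv.swap_apply_right]
    rfl
  · have h0 : l.succ.succ ≠ (0 : Fin (n + 2)) := Fin.succ_ne_zero _
    have h1 : l.succ.succ ≠ (1 : Fin (n + 2)) := by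
      intro h
      simp [Fin.ext_iff] at h
    simp [Equiv.swap_apply_of_ne_of_ne h0 h1]

end trunc

section cov

variable {d : ℕ} {G : Measure (EuclideanSpace ℝ (Fin d))} [IsProbabilityMeasure G]

/-- The truncated logarithmic volume at the first of two points and a further sample. -/
noncomputable def clipVol (k n : ℕ) (M : ℝ)
    (p : EuclideanSpace ℝ (Fin d) × EuclideanSpace ℝ (Fin d)) (z : Fin n → EuclideanSpace ℝ (Fin d)) : ℝ :=
  clip M (knnLogVol k (Fin.cons p.1 (Fin.cons p.2 z : Fin (n + 1) → EuclideanSpace ℝ (Fin d)) :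
    Fin (n + 2) → EuclideanSpace ℝ (Fin d)) 0)

lemma clipVol_swap (k n : ℕ) (M : ℝ) (x x' : EuclideanSpace ℝ (Fin d))
    (z : Fin n → EuclideanSpace ℝ (Fin d)) :
    clip M (knnLogVol k (Fin.cons x (Fin.cons x' z : Fin (n + 1) → EuclideanSpace ℝ (Fin d)) :
      Fin (n + 2) → EuclideanSpace ℝ (Fin d)) 1) = clipVol k n M (x', x) z := by
  rw [clipVol, ← cons_cons_comp_swap x x' z, knnLogVol_comp_perm, Equiv.swap_apply_left]

lemma measurable_clipVol {k n : ℕ} (hk : 1 ≤ k) (hn : k ≤ n + 1) (M : ℝ) :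
    Measurable (Function.uncurry (clipVol (d := d) k n M)) := by
  have h1 : Measurable fun q : (EuclideanSpace ℝ (Fin d) × EuclideanSpace ℝ (Fin d)) ×
      (Fin n → EuclideanSpace ℝ (Fin d)) =>
      (Fin.cons q.1.1 (Fin.cons q.1.2 q.2 : Fin (n + 1) → EuclideanSpace ℝ (Fin d)) :
        Fin (n + 2) → EuclideanSpace ℝ (Fin d)) :=
    measurable_finCons.comp ((measurable_fst.comp measurable_fst).prodMk
      (measurable_finCons.comp ((measurable_snd.comp measurable_fst).prodMk measurable_snd)))
  exact ((measurable_clip M).comp (measurable_knnLogVol hk (by omega) 0)).comp h1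

/-- The conditional expectation of the truncated logarithmic volume, given two points. -/
noncomputable def meanClipVol (G : Measure (EuclideanSpace ℝ (Fin d))) (k n : ℕ) (M : ℝ)
    (p : EuclideanSpace ℝ (Fin d) × EuclideanSpace ℝ (Fin d)) : ℝ :=
  ∫ z, clipVol k n M p z ∂(Measure.pi fun _ => G)

lemma measurable_meanClipVol {k n : ℕ} (hk : 1 ≤ k) (hn : k ≤ n + 1) (M : ℝ) :
    Measurable (meanClipVol G k n M) :=
  (measurable_clipVol hk hn M).stronglyMeasurable.integral_prod_right.measurable

lemma abs_meanClipVol_le {k n : ℕ} {M : ℝ} (hM : 0 ≤ M)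
    (p : EuclideanSpace ℝ (Fin d) × EuclideanSpace ℝ (Fin d)) : |meanClipVol G k n M p| ≤ M :=
  abs_integral_le fun _ => abs_clip_le hM _

/-- At separation 2ρ the balls of radius ρ are disjoint, and each clipped volume sees the remaining
sample only inside its own ball. -/
lemma abs_integral_clipVol_mul_sub_le (hd : 1 ≤ d) {k n : ℕ} (hk : 1 ≤ k) (hn : k ≤ n + 1) {M : ℝ}
    (hM : 0 < M) {x x' : EuclideanSpace ℝ (Fin d)}
    (hx : 2 * truncRadius d k (n + 1) M ≤ dist x x') :
    |∫ z, clipVol k n M (x, x') z * clipVol k n M (x', x) z ∂(Measure.pi fun _ => G) -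
      meanClipVol G k n M (x, x') * meanClipVol G k n M (x', x)| ≤
      n * (4 * M ^ 2 * (G.real (Metric.ball x (truncRadius d k (n + 1) M)) *
        G.real (Metric.ball x' (truncRadius d k (n + 1) M)))) := by
  have hmeas : ∀ p, Measurable (clipVol (d := d) k n M p) := fun p =>
    (measurable_clipVol hk hn M).of_uncurry_left
  have hloc : ∀ p : EuclideanSpace ℝ (Fin d) × EuclideanSpace ℝ (Fin d),
      ∀ y z : Fin n → EuclideanSpace ℝ (Fin d),
      (∀ j, y j = z j ∨ (y j ∉ Metric.ball p.1 (truncRadius d k (n + 1) M) ∧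
        z j ∉ Metric.ball p.1 (truncRadius d k (n + 1) M))) →
      clipVol k n M p y = clipVol k n M p z := by
    rintro ⟨x, x'⟩ y z h
    have hx : (Fin.cons x (Fin.cons x' y : Fin (n + 1) → EuclideanSpace ℝ (Fin d)) :
        Fin (n + 2) → EuclideanSpace ℝ (Fin d)) 0 =
        (Fin.cons x (Fin.cons x' z : Fin (n + 1) → EuclideanSpace ℝ (Fin d)) :
          Fin (n + 2) → EuclideanSpace ℝ (Fin d)) 0 := rfl
    refine clip_knnLogVol_congr hd hk hn hM hx fun j => ?_
    induction j using Fin.cases with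
    | zero => exact Or.inl rfl
    | succ j =>
      induction j using Fin.cases with
      | zero => exact Or.inl rfl
      | succ l =>
        rcases h l with h | h
        · exact Or.inl h
        · exact Or.inr ⟨not_lt.1 h.1, not_lt.1 h.2⟩
  refine abs_integral_pi_mul_sub_le G ?_ (hmeas _) (hmeas _) (fun z => abs_clip_le hM.le _)
    (fun z => abs_clip_le hM.le _) (hloc (x, x')) (hloc (x', x))
  exact Metric.ball_disjoint_ball (by linarith)

/-- A second point outside the ρ-ball of x has no influence, so averaging over it matters only when
the averaged point falls in that ball. -/
lemma abs_meanClipVol_sub_le (hd : 1 ≤ d) {k n : ℕ} (hk : 1 ≤ k) (hn : k ≤ n + 1) {M : ℝ}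
    (hM : 0 < M) {x x' : EuclideanSpace ℝ (Fin d)} (hx : truncRadius d k (n + 1) M ≤ dist x' x) :
    |meanClipVol G k n M (x, x') - ∫ w, meanClipVol G k n M (x, w) ∂G| ≤
      2 * M * G.real (Metric.ball x (truncRadius d k (n + 1) M)) := by
  have hmeas : Measurable fun w => meanClipVol G k n M (x, w) :=
    (measurable_meanClipVol hk hn M).comp (measurable_const.prodMk measurable_id)
  have hi : Integrable (fun w => meanClipVol G k n M (x, w)) G :=
    integrable_of_abs_le hmeas fun w => abs_meanClipVol_le hM.le _
  have h : |∫ w, (meanClipVol G k n M (x, x') - meanClipVol G k n M (x, w)) ∂G| ≤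
      2 * M * G.real (Metric.ball x (truncRadius d k (n + 1) M)) := by
    refine abs_integral_le_of_eq_zero (fun w => ?_) fun w hw => ?_
    · refine (abs_sub _ _).trans ?_
      linarith [abs_meanClipVol_le (G := G) (k := k) (n := n) hM.le (x, x'),
        abs_meanClipVol_le (G := G) (k := k) (n := n) hM.le (x, w)]
    · rw [sub_eq_zero]
      refine integral_congr_ae (ae_of_all _ fun z => ?_)
      refine clip_knnLogVol_congr (y := Fin.cons x (Fin.cons x' z :
          Fin (n + 1) → EuclideanSpace ℝ (Fin d)))
        (y' := Fin.cons x (Fin.cons w z : Fin (n + 1) → EuclideanSpace ℝ (Fin d))) (i := 0)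
        hd hk hn hM rfl fun j => ?_
      induction j using Fin.cases with
      | zero => exact Or.inl rfl
      | succ j =>
        induction j using Fin.cases with
        | zero => exact Or.inr ⟨hx, not_lt.1 hw⟩
        | succ l => exact Or.inl rfl
  rwa [integral_sub (integrable_const _) hi, integral_const, probReal_univ, one_smul] at h

end cov

section cov

variable {d : ℕ} {G : Measure (EuclideanSpace ℝ (Fin d))} [IsProbabilityMeasure G]

/-- The mean of the product of the truncated logarithmic volumes at two given points. -/
noncomputable def meanClipVolMul (G : Measure (EuclideanSpace ℝ (Fin d))) (k n : ℕ) (M : ℝ)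
    (p : EuclideanSpace ℝ (Fin d) × EuclideanSpace ℝ (Fin d)) : ℝ :=
  ∫ z, clipVol k n M p z * clipVol k n M p.swap z ∂(Measure.pi fun _ => G)

/-- The mean of the truncated logarithmic volume at a given point. -/
noncomputable def condClipVol (G : Measure (EuclideanSpace ℝ (Fin d))) (k n : ℕ) (M : ℝ)
    (x : EuclideanSpace ℝ (Fin d)) : ℝ :=
  ∫ w, meanClipVol G k n M (x, w) ∂G

lemma measurable_meanClipVolMul {k n : ℕ} (hk : 1 ≤ k) (hn : k ≤ n + 1) (M : ℝ) :
    Measurable (meanClipVolMul G k n M) := by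
  have h := measurable_clipVol (d := d) hk hn M
  have h2 : Measurable fun q : (EuclideanSpace ℝ (Fin d) × EuclideanSpace ℝ (Fin d)) ×
      (Fin n → EuclideanSpace ℝ (Fin d)) => Function.uncurry (clipVol k n M) (q.1.swap, q.2) :=
    h.comp ((measurable_swap.comp measurable_fst).prodMk measurable_snd)
  exact (h.mul h2).stronglyMeasurable.integral_prod_right.measurable

lemma measurable_condClipVol {k n : ℕ} (hk : 1 ≤ k) (hn : k ≤ n + 1) (M : ℝ) :
    Measurable (condClipVol G k n M) :=
  (measurable_meanClipVol hk hn M).stronglyMeasurable.integral_prod_right'.measurable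

lemma abs_meanClipVolMul_le {k n : ℕ} {M : ℝ} (hM : 0 ≤ M)
    (p : EuclideanSpace ℝ (Fin d) × EuclideanSpace ℝ (Fin d)) :
    |meanClipVolMul G k n M p| ≤ M * M :=
  abs_integral_le fun _ => by
    rw [abs_mul]
    exact mul_le_mul (abs_clip_le hM _) (abs_clip_le hM _) (abs_nonneg _) hM

lemma abs_condClipVol_le {k n : ℕ} {M : ℝ} (hM : 0 ≤ M) (x : EuclideanSpace ℝ (Fin d)) :
    |condClipVol G k n M x| ≤ M :=
  abs_integral_le fun _ => abs_meanClipVol_le hM _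

lemma measurable_clip_knnLogVol {k N : ℕ} (hk : 1 ≤ k) (hN : k < N) (M : ℝ) (i : Fin N) :
    Measurable fun y : Fin N → EuclideanSpace ℝ (Fin d) => clip M (knnLogVol k y i) :=
  (measurable_clip M).comp (measurable_knnLogVol hk hN i)

/-- Integrate out the last n points first, then the two centres; by exchangeability both means are
the integral of the same `condClipVol`. -/
lemma covariance_clip_knnLogVol {k n : ℕ} (hk : 1 ≤ k) (hn : k ≤ n + 1) {M : ℝ} (hM : 0 ≤ M) :
    cov[fun y : Fin (n + 2) → EuclideanSpace ℝ (Fin d) => clip M (knnLogVol k y 0),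
      fun y => clip M (knnLogVol k y 1); Measure.pi fun _ => G] =
    ∫ p, (meanClipVolMul G k n M p - condClipVol G k n M p.1 * condClipVol G k n M p.2)
      ∂(G.prod G) := by
  have hN : k < n + 2 := by omega
  have hm0 := measurable_clip_knnLogVol (d := d) hk hN M 0
  have hm1 := measurable_clip_knnLogVol (d := d) hk hN M 1
  have hb0 : ∀ i, ∀ y : Fin (n + 2) → EuclideanSpace ℝ (Fin d), |clip M (knnLogVol k y i)| ≤ M :=
    fun i y => abs_clip_le hM _
  have hcons : ∀ x : EuclideanSpace ℝ (Fin d), Measurable fun w : Fin (n + 1) → EuclideanSpace ℝ (Fin d) =>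
      (Fin.cons x w : Fin (n + 2) → EuclideanSpace ℝ (Fin d)) := fun x =>
    measurable_finCons.comp (measurable_const.prodMk measurable_id)
  have hbm : ∀ y : Fin (n + 2) → EuclideanSpace ℝ (Fin d),
      |clip M (knnLogVol k y 0) * clip M (knnLogVol k y 1)| ≤ M * M := fun y => by
    rw [abs_mul]
    exact mul_le_mul (hb0 _ _) (hb0 _ _) (abs_nonneg _) hM
  have hLp : ∀ i, MemLp (fun y : Fin (n + 2) → EuclideanSpace ℝ (Fin d) => clip M (knnLogVol k y i))
      2 (Measure.pi fun _ => G) := fun i =>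
    MemLp.of_bound (measurable_clip_knnLogVol hk hN M i).aestronglyMeasurable M
      (ae_of_all _ (hb0 i))
  have hprod : ∫ y : Fin (n + 2) → EuclideanSpace ℝ (Fin d),
      clip M (knnLogVol k y 0) * clip M (knnLogVol k y 1) ∂(Measure.pi fun _ => G) =
      ∫ p, meanClipVolMul G k n M p ∂(G.prod G) := by
    have hi : Integrable (fun y : Fin (n + 2) → EuclideanSpace ℝ (Fin d) =>
        clip M (knnLogVol k y 0) * clip M (knnLogVol k y 1)) (Measure.pi fun _ => G) :=
      integrable_of_abs_le (hm0.mul hm1) hbm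
    rw [integral_pi_succ G hi, integral_prod _ (integrable_of_abs_le
      (measurable_meanClipVolMul hk hn M) (abs_meanClipVolMul_le hM))]
    refine integral_congr_ae (ae_of_all _ fun x => ?_)
    have hi' : Integrable (fun w : Fin (n + 1) → EuclideanSpace ℝ (Fin d) =>
        clip M (knnLogVol k (Fin.cons x w : Fin (n + 2) → EuclideanSpace ℝ (Fin d)) 0) *
        clip M (knnLogVol k (Fin.cons x w : Fin (n + 2) → EuclideanSpace ℝ (Fin d)) 1))
        (Measure.pi fun _ => G) :=
      integrable_of_abs_le ((hm0.comp (hcons x)).mul (hm1.comp (hcons x))) fun w => hbm _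
    refine (integral_pi_succ G hi').trans ?_
    refine integral_congr_ae (ae_of_all _ fun x' => ?_)
    refine integral_congr_ae (ae_of_all _ fun z => ?_)
    simp only [clipVol_swap]
    rfl
  have hmean : ∫ y : Fin (n + 2) → EuclideanSpace ℝ (Fin d),
      clip M (knnLogVol k y 0) ∂(Measure.pi fun _ => G) = ∫ x, condClipVol G k n M x ∂G := by
    rw [integral_pi_succ G (integrable_of_abs_le hm0 (hb0 0))]
    refine integral_congr_ae (ae_of_all _ fun x => ?_)
    have hi' : Integrable (fun w : Fin (n + 1) → EuclideanSpace ℝ (Fin d) =>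
        clip M (knnLogVol k (Fin.cons x w : Fin (n + 2) → EuclideanSpace ℝ (Fin d)) 0))
        (Measure.pi fun _ => G) :=
      integrable_of_abs_le (hm0.comp (hcons x)) fun w => hb0 _ _
    exact integral_pi_succ G hi'
  have hmean1 : ∫ y : Fin (n + 2) → EuclideanSpace ℝ (Fin d),
      clip M (knnLogVol k y 1) ∂(Measure.pi fun _ => G) = ∫ x, condClipVol G k n M x ∂G := by
    rw [← hmean]
    have hσ := measurePreserving_comp_perm G (Equiv.swap (0 : Fin (n + 2)) 1)
    conv_rhs => rw [← hσ.map_eq]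
    rw [integral_map hσ.measurable.aemeasurable hm0.aestronglyMeasurable]
    simp only [knnLogVol_comp_perm, Equiv.swap_apply_left]
  rw [covariance_eq_sub (hLp 0) (hLp 1)]
  simp only [Pi.mul_apply]
  rw [hprod, hmean, hmean1, integral_sub, integral_prod_mul]
  · exact integrable_of_abs_le (measurable_meanClipVolMul hk hn M) (abs_meanClipVolMul_le hM)
  · refine integrable_of_abs_le (C := M * M) (((measurable_condClipVol hk hn M).comp measurable_fst).mul
      ((measurable_condClipVol hk hn M).comp measurable_snd)) fun p => ?_
    rw [abs_mul]
    exact mul_le_mul (abs_condClipVol_le hM _) (abs_condClipVol_le hM _) (abs_nonneg _) hM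

/-- The ρ-ball has volume k e^M/(n+1). Since mean densities converge at almost every centre, its
mass there is O(1/n). -/
lemma succ_mul_measureReal_ball_le (hd : 1 ≤ d) {k n : ℕ} (hk : 1 ≤ k) (hn : k ≤ n + 1) (M : ℝ)
    (x : EuclideanSpace ℝ (Fin d)) :
    ((n : ℝ) + 1) * G.real (Metric.ball x (truncRadius d k (n + 1) M)) ≤
      meanDensity G x (truncRadius d k (n + 1) M) * (k * Real.exp M) := by
  have hV := unitBallVol_pos d
  have hk0 : (0 : ℝ) < k := by exact_mod_cast hk
  have hn0 : (0 : ℝ) < n + 1 := by positivity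
  have h1 : G.real (Metric.ball x (truncRadius d k (n + 1) M)) ≤
      G.real (Metric.closedBall x (truncRadius d k (n + 1) M)) :=
    measureReal_mono Metric.ball_subset_closedBall
  have h2 : unitBallVol d * truncRadius d k (n + 1) M ^ d = k * Real.exp M / (n + 1) := by
    rw [truncRadius_pow hd hk hn, volFactor]
    push_cast
    field_simp
  have h3 : (k * Real.exp M / (n + 1)) ≠ 0 := by positivity
  calc ((n : ℝ) + 1) * G.real (Metric.ball x (truncRadius d k (n + 1) M))
      ≤ (n + 1) * G.real (Metric.closedBall x (truncRadius d k (n + 1) M)) := by gcongr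
    _ = _ := by rw [meanDensity, h2]; field_simp

/-- Pass from the mean of the product to the product of means given both centres, then replace each
of these by its average over the other centre. -/
lemma abs_meanClipVolMul_sub_le (hd : 1 ≤ d) {k n : ℕ} (hk : 1 ≤ k) (hn : k ≤ n + 1) {M : ℝ}
    (hM : 0 < M) {x x' : EuclideanSpace ℝ (Fin d)}
    (hx : 2 * truncRadius d k (n + 1) M ≤ dist x x') :
    |meanClipVolMul G k n M (x, x') - condClipVol G k n M x * condClipVol G k n M x'| ≤
      4 * M ^ 2 * (n * G.real (Metric.ball x (truncRadius d k (n + 1) M)) *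
        G.real (Metric.ball x' (truncRadius d k (n + 1) M))) +
      2 * M ^ 2 * (G.real (Metric.ball x (truncRadius d k (n + 1) M)) +
        G.real (Metric.ball x' (truncRadius d k (n + 1) M))) := by
  have hρ := truncRadius_pos (d := d) hk hn M
  have h1 := abs_integral_clipVol_mul_sub_le (G := G) hd hk hn hM hx
  have h2 := abs_meanClipVol_sub_le (G := G) hd hk hn hM (x := x) (x' := x')
    (by rw [dist_comm]; linarith)
  have h3 := abs_meanClipVol_sub_le (G := G) hd hk hn hM (x := x') (x' := x) (by linarith)
  have h4 := abs_meanClipVol_le (G := G) (k := k) (n := n) hM.le (x', x)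
  have h5 := abs_condClipVol_le (G := G) (k := k) (n := n) hM.le x
  set p := G.real (Metric.ball x (truncRadius d k (n + 1) M))
  set p' := G.real (Metric.ball x' (truncRadius d k (n + 1) M))
  set m := meanClipVol G k n M (x, x')
  set m' := meanClipVol G k n M (x', x)
  set a := condClipVol G k n M x
  set a' := condClipVol G k n M x'
  have h2' : |m - a| ≤ 2 * M * p := h2
  have h3' : |m' - a'| ≤ 2 * M * p' := h3
  calc |meanClipVolMul G k n M (x, x') - a * a'|
      = |(meanClipVolMul G k n M (x, x') - m * m') + ((m - a) * m' + a * (m' - a'))| := by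
        congr 1; ring
    _ ≤ |meanClipVolMul G k n M (x, x') - m * m'| + (|m - a| * |m'| + |a| * |m' - a'|) := by
        refine (abs_add_le _ _).trans (add_le_add le_rfl ((abs_add_le _ _).trans ?_))
        rw [abs_mul, abs_mul]
    _ ≤ n * (4 * M ^ 2 * (p * p')) + (2 * M * p * M + M * (2 * M * p')) := by
        gcongr
        exact h1
    _ = _ := by ring

variable {g : EuclideanSpace ℝ (Fin d) → ℝ}

/-- For almost every pair of centres the bounds are n · O(1/n) · O(1/n) + O(1/n); the integrands are
bounded by 2M², so dominated convergence over pairs applies. -/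
lemma tendsto_covariance_clip_knnLogVol (hd : 1 ≤ d) (hg_meas : Measurable g)
    (hg_nonneg : ∀ x, 0 ≤ g x) (hG : G = volume.withDensity fun x => ENNReal.ofReal (g x))
    {k : ℕ} (hk : 1 ≤ k) {M : ℝ} (hM : 0 < M) :
    Tendsto (fun n => cov[fun y : Fin (n + 2) → EuclideanSpace ℝ (Fin d) => clip M (knnLogVol k y 0),
      fun y => clip M (knnLogVol k y 1); Measure.pi fun _ => G]) atTop (𝓝 0) := by
  have hac : G ≪ volume := hG ▸ withDensity_absolutelyContinuous _ _
  have hgood := ae_pos_and_tendsto_meanDensity hd hg_meas hg_nonneg hG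
  have h1 : ∀ᵐ p ∂(G.prod G), 0 < g p.1 ∧ Tendsto (meanDensity G p.1) (𝓝[>] 0) (𝓝 (g p.1)) :=
    Measure.quasiMeasurePreserving_fst.ae hgood
  have h2 : ∀ᵐ p ∂(G.prod G), 0 < g p.2 ∧ Tendsto (meanDensity G p.2) (𝓝[>] 0) (𝓝 (g p.2)) :=
    Measure.quasiMeasurePreserving_snd.ae hgood
  have h3 : ∀ᵐ p ∂(G.prod G), 0 < dist p.1 p.2 := ae_prod_dist_pos hd hac
  have hρ : Tendsto (fun n => truncRadius d k (n + 1) M) atTop (𝓝[>] 0) :=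
    (tendsto_truncRadius hd hk M).comp (tendsto_add_atTop_nat 1)
  have hlim := tendsto_integral_filter_of_dominated_convergence (μ := G.prod G) (l := atTop)
    (F := fun n p => meanClipVolMul G k n M p - condClipVol G k n M p.1 * condClipVol G k n M p.2)
    (f := fun _ => (0 : ℝ)) (fun _ => M * M + M * M) ?_ ?_ (integrable_const _) ?_
  · rw [integral_zero] at hlim
    refine hlim.congr' ?_
    filter_upwards [eventually_ge_atTop k] with n hn
    exact (covariance_clip_knnLogVol hk (by omega) hM.le).symm
  · filter_upwards [eventually_ge_atTop k] with n hn
    have hc := measurable_condClipVol (G := G) hk (by omega : k ≤ n + 1) M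
    exact ((measurable_meanClipVolMul hk (by omega) M).sub
      ((hc.comp measurable_fst).mul (hc.comp measurable_snd))).aestronglyMeasurable
  · filter_upwards with n
    refine ae_of_all _ fun p => ?_
    refine (abs_sub _ _).trans (add_le_add (abs_meanClipVolMul_le hM.le _) ?_)
    rw [abs_mul]
    exact mul_le_mul (abs_condClipVol_le hM.le _) (abs_condClipVol_le hM.le _) (abs_nonneg _) hM.le
  · filter_upwards [h1, h2, h3] with ⟨x, x'⟩ hx hx' hne
    simp only at hx hx' hne
    set s : ℕ → ℝ := fun n => meanDensity G x (truncRadius d k (n + 1) M) * (k * Real.exp M)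
    set s' : ℕ → ℝ := fun n => meanDensity G x' (truncRadius d k (n + 1) M) * (k * Real.exp M)
    have hs : Tendsto s atTop (𝓝 (g x * (k * Real.exp M))) := (hx.2.comp hρ).mul_const _
    have hs' : Tendsto s' atTop (𝓝 (g x' * (k * Real.exp M))) := (hx'.2.comp hρ).mul_const _
    have hinv : Tendsto (fun n : ℕ => ((n : ℝ) + 1)⁻¹) atTop (𝓝 0) := by
      simpa [one_div] using tendsto_one_div_add_atTop_nhds_zero_nat (𝕜 := ℝ)
    have hbound : Tendsto (fun n : ℕ => 4 * M ^ 2 * (s n * (s' n * ((n : ℝ) + 1)⁻¹)) +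
        2 * M ^ 2 * (s n * ((n : ℝ) + 1)⁻¹ + s' n * ((n : ℝ) + 1)⁻¹)) atTop (𝓝 0) := by
      have := ((hs.mul (hs'.mul hinv)).const_mul (4 * M ^ 2)).add
        (((hs.mul hinv).add (hs'.mul hinv)).const_mul (2 * M ^ 2))
      simpa using this
    refine squeeze_zero_norm' ?_ hbound
    have hsmall : ∀ᶠ n in atTop, truncRadius d k (n + 1) M < dist x x' / 2 :=
      (hρ.mono_right nhdsWithin_le_nhds).eventually (gt_mem_nhds (by linarith))
    filter_upwards [eventually_ge_atTop k, hsmall] with n hn hlt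
    refine (abs_meanClipVolMul_sub_le hd hk (by omega) hM (by linarith)).trans ?_
    have hb : ∀ y, G.real (Metric.ball y (truncRadius d k (n + 1) M)) ≤
        meanDensity G y (truncRadius d k (n + 1) M) * (k * Real.exp M) * ((n : ℝ) + 1)⁻¹ := by
      intro y
      rw [← div_eq_mul_inv, le_div_iff₀ (by positivity), mul_comm]
      exact succ_mul_measureReal_ball_le hd hk (by omega) M y
    have hb' : n * G.real (Metric.ball x (truncRadius d k (n + 1) M)) ≤ s n := by
      refine le_trans ?_ (succ_mul_measureReal_ball_le hd hk (by omega) M x)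
      gcongr
      linarith
    have hs0 : 0 ≤ s n := le_trans (mul_nonneg (Nat.cast_nonneg n) measureReal_nonneg) hb'
    have h6 := hb x
    have h7 := hb x'
    refine add_le_add (mul_le_mul_of_nonneg_left ?_ (by positivity))
      (mul_le_mul_of_nonneg_left (add_le_add h6 h7) (by positivity))
    exact mul_le_mul hb' h7 measureReal_nonneg hs0

end cov

/-! ### Asymptotic uncorrelatedness of the logarithmic volumes -/

section approx

variable {Ω : Type*} [MeasurableSpace Ω] {P : Measure Ω} [IsProbabilityMeasure P]

/-- By bilinearity cov(X,Z) = cov(C,D) + cov(X-C,Z) + cov(X,Z-D) - cov(X-C,Z-D), and Cauchy–Schwarz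
bounds the last three; no bound on the variances of C and D is needed. -/
lemma abs_covariance_le_of_approx {X Z C D : Ω → ℝ} (hX : MemLp X 2 P) (hZ : MemLp Z 2 P)
    (hC : MemLp C 2 P) (hD : MemLp D 2 P) {s δ : ℝ} (hs : 0 ≤ s) (hδ : 0 ≤ δ)
    (hXs : Var[X; P] ≤ s ^ 2) (hZs : Var[Z; P] ≤ s ^ 2)
    (hXC : ∫ ω, (X ω - C ω) ^ 2 ∂P ≤ δ ^ 2) (hZD : ∫ ω, (Z ω - D ω) ^ 2 ∂P ≤ δ ^ 2) :
    |cov[X, Z; P]| ≤ |cov[C, D; P]| + (2 * s * δ + δ ^ 2) := by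
  have hA : MemLp (fun ω => X ω - C ω) 2 P := hX.sub hC
  have hB : MemLp (fun ω => Z ω - D ω) 2 P := hZ.sub hD
  have hbound : ∀ {A B : Ω → ℝ} {p q : ℝ}, MemLp A 2 P → MemLp B 2 P → 0 ≤ p → 0 ≤ q →
      Var[A; P] ≤ p ^ 2 → Var[B; P] ≤ q ^ 2 → |cov[A, B; P]| ≤ p * q := by
    intro A B p q h1 h2 hp hq h3 h4
    exact (abs_covariance_le h1 h2).trans (mul_le_mul ((Real.sqrt_le_left hp).2 h3)
      ((Real.sqrt_le_left hq).2 h4) (Real.sqrt_nonneg _) hp)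
  have hvA : Var[fun ω => X ω - C ω; P] ≤ δ ^ 2 :=
    (variance_le_expectation_sq hA.1).trans hXC
  have hvB : Var[fun ω => Z ω - D ω; P] ≤ δ ^ 2 :=
    (variance_le_expectation_sq hB.1).trans hZD
  have e1 := covariance_fun_sub_left hX hC hZ
  have e2 := covariance_fun_sub_right hC hZ hD
  have e3 := covariance_fun_sub_left hX hC hB
  have h1 := hbound hA hZ hδ hs hvA hZs
  have h2 := hbound hX hB hs hδ hXs hvB
  have h3 := hbound hA hB hδ hδ hvA hvB
  have h4 := abs_le.1 h1
  have h5 := abs_le.1 h2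
  have h6 := abs_le.1 h3
  have h7 := neg_abs_le (cov[C, D; P])
  have h8 := le_abs_self (cov[C, D; P])
  rw [abs_le]
  constructor <;> nlinarith

end approx

section exchangeable

variable {d : ℕ} {G : Measure (EuclideanSpace ℝ (Fin d))} [IsProbabilityMeasure G]

lemma covariance_knnLogVol_comp_perm {k N : ℕ} (hk : 1 ≤ k) (hN : k < N) (σ : Equiv.Perm (Fin N))
    (i j : Fin N) :
    cov[fun y => knnLogVol k y (σ i), fun y => knnLogVol k y (σ j); Measure.pi fun _ => G] =
      cov[fun y => knnLogVol k y i, fun y => knnLogVol k y j; Measure.pi fun _ => G] := by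
  have h := (measurePreserving_comp_perm G σ).hasLaw.covariance_fun_comp
    (measurable_knnLogVol hk hN i).aemeasurable (measurable_knnLogVol hk hN j).aemeasurable
  simpa only [knnLogVol_comp_perm] using h

lemma covariance_knnLogVol {k n : ℕ} (hk : 1 ≤ k) (hn : k < n + 2) (i j : Fin (n + 2)) :
    cov[fun y => knnLogVol k y i, fun y => knnLogVol k y j; Measure.pi fun _ => G] =
      if i = j then Var[fun y => knnLogVol k y (0 : Fin (n + 2)); Measure.pi fun _ => G]
      else cov[fun y => knnLogVol k y (0 : Fin (n + 2)), fun y => knnLogVol k y (1 : Fin (n + 2));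
        Measure.pi fun _ => G] := by
  split_ifs with hij
  · subst hij
    have h := covariance_knnLogVol_comp_perm (G := G) hk hn (Equiv.swap 0 i) 0 0
    rw [Equiv.swap_apply_left] at h
    rw [h, covariance_self (measurable_knnLogVol hk hn 0).aemeasurable]
  · obtain ⟨σ, h0, h1⟩ : ∃ σ : Equiv.Perm (Fin (n + 2)), σ 0 = i ∧ σ 1 = j := by
      -- The last swap sends 0 to i and the index `swap 0 i j`, which is not 0, to j; the first swap
      -- moves 1 to that index while fixing 0.
      refine ⟨(Equiv.swap 1 ((Equiv.swap 0 i) j)).trans (Equiv.swap 0 i), ?_, ?_⟩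
      · have h0 : (0 : Fin (n + 2)) ≠ 1 := by simp
        have h1 : (0 : Fin (n + 2)) ≠ (Equiv.swap 0 i) j := by
          intro h
          apply hij
          have := congrArg (Equiv.swap 0 i) h
          simpa using this
        simp [Equiv.swap_apply_of_ne_of_ne h0 h1]
      · simp
    rw [← covariance_knnLogVol_comp_perm (G := G) hk hn σ 0 1, h0, h1]

variable {g : EuclideanSpace ℝ (Fin d) → ℝ}
  {Ω : Type*} [MeasurableSpace Ω] {P : Measure Ω} [IsProbabilityMeasure P]
  {Y : ℕ → Ω → EuclideanSpace ℝ (Fin d)}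

lemma integral_sq_knnLogVol_sub_clip {k N : ℕ} (hk : 1 ≤ k) (hN : k < N) (M : ℝ)
    (σ : Equiv.Perm (Fin N)) (i : Fin N) :
    ∫ y, (knnLogVol k y (σ i) - clip M (knnLogVol k y (σ i))) ^ 2 ∂(Measure.pi fun _ => G) =
      ∫ y, (knnLogVol k y i - clip M (knnLogVol k y i)) ^ 2 ∂(Measure.pi fun _ => G) := by
  have h := (measurePreserving_comp_perm G σ).hasLaw.integral_comp
    (f := fun y => (knnLogVol k y i - clip M (knnLogVol k y i)) ^ 2)
    (((measurable_knnLogVol (d := d) hk hN i).sub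
      (measurable_clip_knnLogVol hk hN M i)).pow_const 2).aestronglyMeasurable
  simp only [Function.comp_apply, knnLogVol_comp_perm] at h
  exact h

variable (hd : 1 ≤ d) (hg_meas : Measurable g)
  (hg_nonneg : ∀ x, 0 ≤ g x) (hG : G = volume.withDensity fun x => ENNReal.ofReal (g x))
  (hg_log : MemLp (fun x => Real.log (g x)) 2 G)
  (hdist_log : MemLp (fun p : EuclideanSpace ℝ (Fin d) × EuclideanSpace ℝ (Fin d) =>
    Real.log (dist p.1 p.2)) 2 (G.prod G))
  (hY_law : ∀ i, HasLaw (Y i) G P) (hY_indep : iIndepFun Y P)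

include hd hg_meas hg_nonneg hG hg_log hdist_log hY_law hY_indep

lemma memLp_pi_knnLogVol {k N : ℕ} (hk : 1 ≤ k) (hN : k < N) (i : Fin N) :
    MemLp (fun y => knnLogVol k y i) 2 (Measure.pi fun _ => G) := by
  obtain ⟨n, rfl⟩ : ∃ n, N = n + 1 := ⟨N - 1, by omega⟩
  have h0 : MemLp (fun y : Fin (n + 1) → EuclideanSpace ℝ (Fin d) => knnLogVol k y 0) 2
      (Measure.pi fun _ => G) := by
    have hl := hasLaw_sample hY_law hY_indep (n + 1)
    rw [← hl.map_eq, memLp_map_measure_iff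
      (measurable_knnLogVol hk hN 0).aestronglyMeasurable hl.aemeasurable]
    exact memLp_knnLogVol hd hg_meas hg_nonneg hG hg_log hdist_log hY_law hY_indep hk (by omega)
  refine (memLp_congr_ae (ae_of_all _ fun y => ?_)).1
    (h0.comp_measurePreserving (measurePreserving_comp_perm G (Equiv.swap 0 i)))
  rw [Function.comp_apply, knnLogVol_comp_perm, Equiv.swap_apply_left]

lemma tendsto_variance_pi_knnLogVol {k : ℕ} (hk : 1 ≤ k) :
    Tendsto (fun n => Var[fun y => knnLogVol k y (0 : Fin (n + 2)); Measure.pi fun _ => G]) atTop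
      (𝓝 (inverseSquareTail k + Var[fun x => Real.log (g x); G])) := by
  refine ((tendsto_variance_knnLogVol hd hg_meas hg_nonneg hG hg_log hdist_log hY_law hY_indep
    hk).comp (tendsto_add_atTop_nat 1)).congr' ?_
  filter_upwards [eventually_ge_atTop k] with n hn
  have hl := hasLaw_sample hY_law hY_indep (n + 2)
  rw [← hl.map_eq, variance_map (measurable_knnLogVol hk (by omega) 0).aemeasurable hl.aemeasurable]
  rfl

lemma tendsto_covariance_knnLogVol {k : ℕ} (hk : 1 ≤ k) :
    Tendsto (fun n => cov[fun y => knnLogVol k y (0 : Fin (n + 2)),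
      fun y => knnLogVol k y (1 : Fin (n + 2)); Measure.pi fun _ => G]) atTop (𝓝 0) := by
  have hvar := tendsto_variance_pi_knnLogVol hd hg_meas hg_nonneg hG hg_log hdist_log hY_law
    hY_indep hk
  set v := inverseSquareTail k + Var[fun x => Real.log (g x); G]
  set s : ℝ := √(v + 1) with hs
  have hv0 : 0 ≤ v := ge_of_tendsto' hvar fun n => variance_nonneg _ _
  have hs0 : 0 ≤ s := Real.sqrt_nonneg _
  have hs2 : s ^ 2 = v + 1 := Real.sq_sqrt (by linarith)
  rw [Metric.tendsto_atTop']
  intro η hη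
  -- Makes 2sδ + δ² ≤ δ(2s + 1) ≤ η/2; the truncated covariance takes up the other half. Here s² = v
  -- + 1 bounds both variances eventually.
  set δ : ℝ := min 1 (η / (4 * (s + 1)))
  have hδ0 : 0 < δ := lt_min one_pos (by positivity)
  have hδ1 : δ ≤ 1 := min_le_left _ _
  have hδη : δ * (4 * (s + 1)) ≤ η := (le_div_iff₀ (by positivity)).1 (min_le_right _ _)
  obtain ⟨M, hM, hclip⟩ := exists_clip_knnLogVol hd hg_meas hg_nonneg hG hg_log hdist_log hY_law
    hY_indep hk (pow_pos hδ0 2)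
  have hcov := tendsto_covariance_clip_knnLogVol hd hg_meas hg_nonneg hG hk hM
  have hcov' := hcov.abs
  rw [abs_zero] at hcov'
  have hev := ((hcov'.eventually (gt_mem_nhds (half_pos hη))).and
    (hvar.eventually (gt_mem_nhds (lt_add_one v)))).and (eventually_ge_atTop k)
  obtain ⟨n₀, hn₀⟩ := eventually_atTop.1 hev
  refine ⟨n₀, fun n hn => ?_⟩
  obtain ⟨⟨h1, h2⟩, h3⟩ := hn₀ n hn.le
  have hN : k < n + 2 := by omega
  have hLp := memLp_pi_knnLogVol hd hg_meas hg_nonneg hG hg_log hdist_log hY_law hY_indep hk hN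
  have hcl : ∀ i : Fin (n + 2), MemLp (fun y => clip M (knnLogVol k y i)) 2
      (Measure.pi fun _ => G) := fun i =>
    MemLp.of_bound (measurable_clip_knnLogVol hk hN M i).aestronglyMeasurable M
      (ae_of_all _ fun y => abs_clip_le hM.le _)
  have hvar1 : Var[fun y => knnLogVol k y (1 : Fin (n + 2)); Measure.pi fun _ => G] ≤ s ^ 2 := by
    rw [← covariance_self (measurable_knnLogVol hk hN 1).aemeasurable, covariance_knnLogVol hk hN,
      if_pos rfl, hs2]
    exact h2.le
  have he0 : ∫ y, (knnLogVol k y (0 : Fin (n + 2)) - clip M (knnLogVol k y 0)) ^ 2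
      ∂(Measure.pi fun _ => G) ≤ δ ^ 2 := by
    refine le_trans (le_of_eq ?_) (hclip (n + 1) (by omega))
    exact ((hasLaw_sample hY_law hY_indep (n + 2)).integral_comp
      (((measurable_knnLogVol (d := d) hk hN 0).sub
        (measurable_clip_knnLogVol hk hN M 0)).pow_const 2).aestronglyMeasurable).symm
  have he1 : ∫ y, (knnLogVol k y (1 : Fin (n + 2)) - clip M (knnLogVol k y 1)) ^ 2
      ∂(Measure.pi fun _ => G) ≤ δ ^ 2 := by
    have h := integral_sq_knnLogVol_sub_clip (G := G) hk hN M (Equiv.swap 0 1) 0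
    rw [Equiv.swap_apply_left] at h
    rw [h]
    exact he0
  have h := abs_covariance_le_of_approx (hLp 0) (hLp 1) (hcl 0) (hcl 1) hs0 hδ0.le
    (by rw [hs2]; exact h2.le) hvar1 he0 he1
  rw [Real.dist_eq, sub_zero]
  nlinarith

end exchangeable

/-! ### Moments of the Dirichlet distribution -/

section dirichlet

lemma measurable_gammaPDF (a r : ℝ) : Measurable (gammaPDF a r) :=
  (measurable_gammaPDFReal a r).ennreal_ofReal

lemma ae_gammaMeasure_pos (a r : ℝ) : ∀ᵐ x ∂(gammaMeasure a r), 0 < x := by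
  have h : ∀ᵐ x ∂(gammaMeasure a r), x ≠ 0 :=
    (withDensity_absolutelyContinuous volume (gammaPDF a r)).ae_le
      (Measure.ae_ne volume 0)
  have h2 : ∀ᵐ x ∂(gammaMeasure a r), 0 ≤ x := by
    rw [gammaMeasure, ae_withDensity_iff (measurable_gammaPDF a r)]
    refine ae_of_all _ fun x hx => ?_
    by_contra hlt
    exact hx (gammaPDF_of_neg (not_le.1 hlt))
  filter_upwards [h, h2] with x h3 h4
  exact lt_of_le_of_ne h4 h3.symm

lemma integral_gammaMeasure_pow_mul_exp {a : ℝ} (ha : 0 < a) (m : ℕ) {l : ℝ} (hl : 0 ≤ l) :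
    ∫ x, x ^ m * Real.exp (-(l * x)) ∂(gammaMeasure a 1) =
      Real.Gamma (a + m) / Real.Gamma a * (1 + l) ^ (-(a + m)) := by
  have h1 : ∫ x, x ^ m * Real.exp (-(l * x)) ∂(gammaMeasure a 1) =
      ∫ x in Set.Ioi 0, (Real.Gamma a)⁻¹ * (x ^ (a + m - 1) * Real.exp (-((1 + l) * x))) := by
    rw [gammaMeasure, integral_withDensity_eq_integral_toReal_smul
      (measurable_gammaPDF a 1) (ae_of_all _ fun x => ENNReal.ofReal_lt_top),
      ← setIntegral_eq_integral_of_ae_compl_eq_zero (s := Set.Ioi 0)]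
    · refine setIntegral_congr_fun measurableSet_Ioi fun x hx => ?_
      have hx : 0 < x := hx
      simp only [gammaPDF, smul_eq_mul]
      rw [ENNReal.toReal_ofReal (gammaPDFReal_nonneg ha one_pos x), gammaPDFReal, if_pos hx.le,
        show a + m - 1 = (a - 1) + m by ring, Real.rpow_add_natCast hx.ne',
        show -((1 + l) * x) = -(1 * x) + -(l * x) by ring, Real.exp_add, Real.one_rpow]
      ring
    · filter_upwards [Measure.ae_ne volume (0 : ℝ)] with x hx hx'
      rw [gammaPDF_of_neg (lt_of_le_of_ne (not_lt.1 hx') hx), ENNReal.toReal_zero, zero_smul]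
  rw [h1, integral_const_mul, Real.integral_rpow_mul_exp_neg_mul_Ioi (by positivity) (by positivity),
    one_div, Real.inv_rpow (by positivity), ← Real.rpow_neg (by positivity)]
  ring

/-- The integral over the Laplace parameter that remains after Fubini; it produces the denominator
of the Dirichlet second moment. -/
lemma integral_Ioi_mul_one_add_rpow {a : ℝ} (ha : 0 < a) :
    IntegrableOn (fun l : ℝ => l * (1 + l) ^ (-(a + 2))) (Set.Ioi 0) ∧
      ∫ l in Set.Ioi (0 : ℝ), l * (1 + l) ^ (-(a + 2)) = 1 / (a * (a + 1)) := by
  set F : ℝ → ℝ := fun l => (1 + l) ^ (-(a + 1)) / (a + 1) - (1 + l) ^ (-a) / a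
  have hderiv : ∀ l ∈ Set.Ici (0 : ℝ), HasDerivAt F (l * (1 + l) ^ (-(a + 2))) l := by
    intro l hl
    have hl0 : 0 < 1 + l := by linarith [Set.mem_Ici.1 hl]
    have hadd : HasDerivAt (fun l : ℝ => 1 + l) 1 l := (hasDerivAt_id l).const_add 1
    have h1 := (hadd.rpow_const (p := -(a + 1)) (Or.inl hl0.ne')).div_const (a + 1)
    have h2 := (hadd.rpow_const (p := -a) (Or.inl hl0.ne')).div_const a
    refine (h1.sub h2).congr_deriv ?_
    rw [show -a - 1 = -(a + 2) + 1 by ring, show -(a + 1) - 1 = -(a + 2) by ring,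
      Real.rpow_add_one hl0.ne']
    field_simp
    ring
  have hpos : ∀ l ∈ Set.Ioi (0 : ℝ), 0 ≤ l * (1 + l) ^ (-(a + 2)) := fun l hl =>
    mul_nonneg (le_of_lt hl) (Real.rpow_nonneg (by linarith [Set.mem_Ioi.1 hl]) _)
  have htop : Tendsto (fun l : ℝ => 1 + l) atTop atTop := tendsto_atTop_add_const_left _ _ tendsto_id
  have hlim : Tendsto F atTop (𝓝 0) := by
    have h1 := ((tendsto_rpow_neg_atTop (by linarith : 0 < a + 1)).comp htop).div_const (a + 1)
    have h2 := ((tendsto_rpow_neg_atTop ha).comp htop).div_const a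
    have h3 := h1.sub h2
    rw [zero_div, zero_div, sub_zero] at h3
    exact h3
  refine ⟨integrableOn_Ioi_deriv_of_nonneg' hderiv hpos hlim, ?_⟩
  rw [integral_Ioi_of_hasDerivAt_of_nonneg' hderiv hpos hlim]
  simp only [F, add_zero, Real.one_rpow]
  field_simp
  ring

variable {ι : Type*} [Fintype ι] {α : ι → ℝ}

lemma ae_pi_gammaMeasure_pos (hα : ∀ i, 0 < α i) :
    ∀ᵐ x ∂(Measure.pi fun i => gammaMeasure (α i) 1), ∀ i, 0 < x i := by
  have := fun i => isProbabilityMeasure_gammaMeasure (hα i) one_pos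
  refine ae_all_iff.2 fun i => ?_
  exact (measurePreserving_eval (fun i => gammaMeasure (α i) 1) i).quasiMeasurePreserving.ae
    (ae_gammaMeasure_pos _ _)

lemma measurable_div_sum : Measurable fun (x : ι → ℝ) i => x i / ∑ j, x j :=
  measurable_pi_lambda _ fun i => (measurable_pi_apply i).div
    (Finset.measurable_sum _ fun j _ => measurable_pi_apply j)

lemma ae_dirichletMeasure_mem_stdSimplex [Nonempty ι] (hα : ∀ i, 0 < α i) :
    ∀ᵐ x ∂(dirichletMeasure α), x ∈ stdSimplex ℝ ι := by
  refine (ae_map_iff measurable_div_sum.aemeasurable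
    (isClosed_stdSimplex ℝ ι).measurableSet).2 ?_
  filter_upwards [ae_pi_gammaMeasure_pos hα] with x hx
  have hS : 0 < ∑ j, x j := Finset.sum_pos (fun j _ => hx j) Finset.univ_nonempty
  refine ⟨fun i => (div_pos (hx i) hS).le, ?_⟩
  rw [← Finset.sum_div, div_self hS.ne']

/-- The exponential of the sum factors over the independent coordinates; only coordinate `i` carries
the extra power 2. -/
lemma integral_pi_gammaMeasure_sq_mul_exp (hα : ∀ i, 0 < α i) (i : ι) {l : ℝ} (hl : 0 ≤ l) :
    ∫ x, x i ^ 2 * Real.exp (-(l * ∑ j, x j)) ∂(Measure.pi fun i => gammaMeasure (α i) 1) =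
      α i * (α i + 1) * (1 + l) ^ (-(∑ j, α j + 2)) := by
  classical
  have := fun i => isProbabilityMeasure_gammaMeasure (hα i) one_pos
  have hl1 : 0 < 1 + l := by linarith
  have hm : ∀ x : ι → ℝ, x i ^ 2 * Real.exp (-(l * ∑ j, x j)) =
      ∏ j, (x j ^ (Pi.single i 2 : ι → ℕ) j * Real.exp (-(l * x j))) := by
    intro x
    rw [Finset.prod_mul_distrib, Finset.prod_eq_single i (fun j _ hj => by simp [hj]) (by simp),
      ← Real.exp_sum, Pi.single_eq_same, Finset.sum_neg_distrib, Finset.mul_sum]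
  simp_rw [hm]
  rw [integral_fintype_prod_eq_prod
    (f := fun j t => t ^ (Pi.single i 2 : ι → ℕ) j * Real.exp (-(l * t)))]
  simp_rw [fun j => integral_gammaMeasure_pow_mul_exp (hα j) ((Pi.single i 2 : ι → ℕ) j) hl]
  rw [Finset.prod_mul_distrib, Finset.prod_eq_single i, ← Real.rpow_sum_of_pos hl1]
  · congr 1
    · rw [Pi.single_eq_same, Nat.cast_two, show α i + 2 = α i + 1 + 1 by ring,
        Real.Gamma_add_one (by linarith [hα i]), Real.Gamma_add_one (hα i).ne']
      have := (Real.Gamma_pos_of_pos (hα i)).ne'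
      field_simp
    · congr 1
      rw [Finset.sum_neg_distrib, Finset.sum_add_distrib, ← Nat.cast_sum]
      simp
  · intro j _ hj
    simp [hj, (Real.Gamma_pos_of_pos (hα j)).ne']
  · simp

/-- The second moments of the coordinates of a Dirichlet random vector. -/
lemma integral_dirichletMeasure_sq (hα : ∀ i, 0 < α i) (i : ι) :
    ∫ x, x i ^ 2 ∂(dirichletMeasure α) =
      α i * (α i + 1) / ((∑ j, α j) * (∑ j, α j + 1)) := by
  have := fun i => isProbabilityMeasure_gammaMeasure (hα i) one_pos
  have hne : Nonempty ι := ⟨i⟩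
  have hA : 0 < ∑ j, α j := Finset.sum_pos (fun j _ => hα j) Finset.univ_nonempty
  have hαi := hα i
  set A := ∑ j, α j
  set μ := Measure.pi fun i => gammaMeasure (α i) 1
  have hF : Measurable (Function.uncurry fun (x : ι → ℝ) (l : ℝ) =>
      ENNReal.ofReal (l * (x i ^ 2 * Real.exp (-(l * ∑ j, x j))))) := by
    simp only [Function.uncurry_def]
    fun_prop
  -- The identity S^(-2) = ∫ l e^(-lS) dl over l > 0 removes the random denominator, so that after
  -- Fubini only products of gamma Laplace transforms remain.
  have h1 : ∀ᵐ x ∂μ, ENNReal.ofReal ((x i / ∑ j, x j) ^ 2) =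
      ∫⁻ l in Set.Ioi 0, ENNReal.ofReal (l * (x i ^ 2 * Real.exp (-(l * ∑ j, x j)))) := by
    filter_upwards [ae_pi_gammaMeasure_pos hα] with x hx
    have hS : 0 < ∑ j, x j := Finset.sum_pos (fun j _ => hx j) Finset.univ_nonempty
    have hI : ∫ l in Set.Ioi 0, l * (x i ^ 2 * Real.exp (-(l * ∑ j, x j))) =
        (x i / ∑ j, x j) ^ 2 := by
      have h := Real.integral_rpow_mul_exp_neg_mul_Ioi (a := 2) two_pos hS
      have h2 : Real.Gamma 2 = 1 := Real.Gamma_two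
      rw [h2, mul_one, Real.rpow_two] at h
      rw [div_pow, div_eq_mul_one_div, ← one_div_pow, ← h, ← integral_const_mul]
      refine setIntegral_congr_fun measurableSet_Ioi fun l _ => ?_
      simp only [show (2 : ℝ) - 1 = 1 by norm_num, Real.rpow_one, mul_comm l (∑ j, x j)]
      ring
    rw [← hI, ofReal_integral_eq_lintegral_ofReal]
    -- A non-integrable function has integral 0 by convention, but the value found is positive.
    · by_contra h
      rw [integral_undef h] at hI
      exact (pow_pos (div_pos (hx i) hS) 2).ne hI
    · filter_upwards [ae_restrict_mem measurableSet_Ioi] with l hl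
      exact mul_nonneg (le_of_lt hl) (by positivity)
  have h2 : ∀ l ∈ Set.Ioi (0 : ℝ),
      ∫⁻ x, ENNReal.ofReal (l * (x i ^ 2 * Real.exp (-(l * ∑ j, x j)))) ∂μ =
      ENNReal.ofReal (α i * (α i + 1) * (l * (1 + l) ^ (-(A + 2)))) := by
    intro l hl
    have hl : 0 < l := hl
    have hI := integral_pi_gammaMeasure_sq_mul_exp hα i hl.le
    have hint : Integrable (fun x : ι → ℝ => x i ^ 2 * Real.exp (-(l * ∑ j, x j))) μ := by
      by_contra h
      rw [integral_undef h] at hI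
      have : 0 < α i * (α i + 1) * (1 + l) ^ (-(A + 2)) := by positivity
      exact this.ne hI
    rw [← ofReal_integral_eq_lintegral_ofReal (hint.const_mul l)
      (ae_of_all _ fun x => by positivity), integral_const_mul, hI]
    congr 1
    ring
  have h3 := integral_Ioi_mul_one_add_rpow hA
  have h4 : ∫⁻ x, ENNReal.ofReal ((x i / ∑ j, x j) ^ 2) ∂μ =
      ENNReal.ofReal (α i * (α i + 1) / (A * (A + 1))) := by
    rw [lintegral_congr_ae h1, lintegral_lintegral_swap hF.aemeasurable,
      setLIntegral_congr_fun measurableSet_Ioi h2,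
      ← ofReal_integral_eq_lintegral_ofReal (h3.1.const_mul _), integral_const_mul, h3.2,
      mul_one_div]
    filter_upwards [ae_restrict_mem measurableSet_Ioi] with l hl
    have hl : 0 < l := hl
    positivity
  have hmeas : Measurable fun x : ι → ℝ => (x i / ∑ j, x j) ^ 2 :=
    ((measurable_pi_apply i).comp measurable_div_sum).pow_const 2
  have h5 : ∫ x, x i ^ 2 ∂(dirichletMeasure α) = ∫ x, (x i / ∑ j, x j) ^ 2 ∂μ :=
    integral_map measurable_div_sum.aemeasurable
      ((measurable_pi_apply i).pow_const 2).aestronglyMeasurable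
  rw [h5, integral_eq_lintegral_of_nonneg_ae (ae_of_all _ fun x => sq_nonneg _)
    hmeas.aestronglyMeasurable, h4, ENNReal.toReal_ofReal (by positivity)]

end dirichlet

/-! ### The variance of randomly weighted means -/

section weighted

variable {Ω ι : Type*} [MeasurableSpace Ω] {P : Measure Ω} [Fintype ι]
  {J T : ι → Ω → ℝ}

lemma ae_abs_le_one_of_mem_stdSimplex (hJ : ∀ᵐ ω ∂P, (fun i => J i ω) ∈ stdSimplex ℝ ι) (i : ι) :
    ∀ᵐ ω ∂P, |J i ω| ≤ 1 := by
  filter_upwards [hJ] with ω h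
  rw [abs_of_nonneg (h.1 i), ← h.2]
  exact Finset.single_le_sum (f := fun i => J i ω) (fun j _ => h.1 j) (Finset.mem_univ i)

lemma memLp_weight_mul (hJm : ∀ i, AEMeasurable (J i) P)
    (hJ : ∀ᵐ ω ∂P, (fun i => J i ω) ∈ stdSimplex ℝ ι) {i : ι} {X : Ω → ℝ} (hX : MemLp X 2 P) :
    MemLp (fun ω => J i ω * X ω) 2 P := by
  refine hX.of_le ((hJm i).aestronglyMeasurable.mul hX.1) ?_
  filter_upwards [ae_abs_le_one_of_mem_stdSimplex hJ i] with ω h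
  rw [norm_mul]
  exact mul_le_of_le_one_left (norm_nonneg _) h

/-- The variance of a randomly weighted mean of exchangeable square integrable variables, with
weights independent of these. -/
lemma variance_sum_weight_mul [IsProbabilityMeasure P] [DecidableEq ι] (hJm : ∀ i, AEMeasurable (J i) P)
    (hJ : ∀ᵐ ω ∂P, (fun i => J i ω) ∈ stdSimplex ℝ ι) (hT : ∀ i, MemLp (T i) 2 P)
    (hind : IndepFun (fun ω i => J i ω) (fun ω i => T i ω) P) {m v c : ℝ}
    (hm : ∀ i, ∫ ω, T i ω ∂P = m)
    (hcov : ∀ i j, cov[T i, T j; P] = c + if i = j then v - c else 0) :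
    Var[fun ω => ∑ i, J i ω * T i ω; P] = c + (v - c) * ∑ i, ∫ ω, J i ω ^ 2 ∂P := by
  -- The weights sum to one, so centring each T i shifts the weighted mean by the constant m.
  set Z : ι → Ω → ℝ := fun i ω => T i ω - m
  have hZ : ∀ i, MemLp (Z i) 2 P := fun i => (hT i).sub (memLp_const m)
  have hJLp : ∀ i, MemLp (J i) 2 P := fun i =>
    MemLp.of_bound (hJm i).aestronglyMeasurable 1 (ae_abs_le_one_of_mem_stdSimplex hJ i)
  have hU : ∀ i, MemLp (fun ω => J i ω * Z i ω) 2 P := fun i => memLp_weight_mul hJm hJ (hZ i)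
  have hUsum : MemLp (fun ω => ∑ i, J i ω * Z i ω) 2 P := memLp_finsetSum _ fun i _ => hU i
  have hZ0 : ∀ i, ∫ ω, Z i ω ∂P = 0 := fun i => by
    rw [integral_sub ((hT i).integrable one_le_two) (integrable_const _), hm, integral_const]
    simp
  have hmean : ∫ ω, ∑ i, J i ω * Z i ω ∂P = 0 := by
    rw [integral_finsetSum _ fun i _ => (hU i).integrable one_le_two]
    refine Finset.sum_eq_zero fun i _ => ?_
    have h : IndepFun (J i) (Z i) P :=
      hind.comp (φ := fun x : ι → ℝ => x i) (ψ := fun x : ι → ℝ => x i - m)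
        (measurable_pi_apply i) ((measurable_pi_apply i).sub measurable_const)
    rw [h.integral_fun_mul_eq_mul_integral (hJLp i).1 (hZ i).1, hZ0, mul_zero]
  have hprod : ∀ i j, Integrable (fun ω => (J i ω * Z i ω) * (J j ω * Z j ω)) P := fun i j =>
    (hU i).integrable_mul (hU j)
  have hterm : ∀ i j, ∫ ω, (J i ω * Z i ω) * (J j ω * Z j ω) ∂P =
      (∫ ω, J i ω * J j ω ∂P) * cov[T i, T j; P] := by
    intro i j
    have h : IndepFun (fun ω => J i ω * J j ω) (fun ω => Z i ω * Z j ω) P :=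
      hind.comp (φ := fun x : ι → ℝ => x i * x j) (ψ := fun x : ι → ℝ => (x i - m) * (x j - m))
        (by fun_prop) (by fun_prop)
    rw [covariance, hm, hm,
      ← h.integral_fun_mul_eq_mul_integral ((hJLp i).1.mul (hJLp j).1) ((hZ i).1.mul (hZ j).1)]
    exact integral_congr_ae (ae_of_all _ fun ω => mul_mul_mul_comm _ _ _ _)
  -- Expand (∑ J i)² = 1; the common part c of all covariances then contributes exactly c.
  have hone : ∑ i, ∑ j, ∫ ω, J i ω * J j ω ∂P = 1 := by
    have hi : ∀ i j, Integrable (fun ω => J i ω * J j ω) P := fun i j =>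
      (hJLp i).integrable_mul (hJLp j)
    simp_rw [← integral_finsetSum _ fun j _ => hi _ j]
    rw [← integral_finsetSum _ fun i _ => integrable_finsetSum _ fun j _ => hi i j]
    have : (fun ω => ∑ i, ∑ j, J i ω * J j ω) =ᵐ[P] fun _ => 1 := by
      filter_upwards [hJ] with ω h
      rw [← Finset.sum_mul_sum, h.2, one_mul]
    rw [integral_congr_ae this]
    simp
  have hae : (fun ω => ∑ i, J i ω * T i ω) =ᵐ[P] fun ω => (∑ i, J i ω * Z i ω) + m := by
    filter_upwards [hJ] with ω h
    simp only [Z, mul_sub, Finset.sum_sub_distrib, ← Finset.sum_mul, h.2]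
    ring
  rw [variance_congr hae, variance_add_const hUsum.1,
    variance_of_integral_eq_zero hUsum.1.aemeasurable hmean]
  simp_rw [sq, Finset.sum_mul_sum]
  rw [integral_finsetSum _ fun i _ => integrable_finsetSum _ fun j _ => hprod i j]
  simp_rw [integral_finsetSum _ fun j _ => hprod _ j, hterm, hcov, mul_add, Finset.sum_add_distrib,
    ← Finset.sum_mul, hone]
  simp only [mul_ite, mul_zero, Finset.sum_ite_eq, Finset.mem_univ, if_true]
  rw [← Finset.sum_mul]
  ring

end weighted

/-! ### The variance of the entropy prior and its limit -/

lemma tendsto_inverseSquareTail : Tendsto inverseSquareTail atTop (𝓝 0) := by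
  refine (tendsto_sum_nat_add fun n : ℕ => 1 / (n : ℝ) ^ 2).congr fun k => ?_
  exact tsum_congr fun j => by rw [add_comm]

section exchangeable

variable {d : ℕ} {G : Measure (EuclideanSpace ℝ (Fin d))} [IsProbabilityMeasure G]

lemma integral_pi_knnLogVol {k n : ℕ} (hk : 1 ≤ k) (hn : k < n + 1) (i : Fin (n + 1)) :
    ∫ y, knnLogVol k y i ∂(Measure.pi fun _ => G) =
      ∫ y, knnLogVol k y (0 : Fin (n + 1)) ∂(Measure.pi fun _ => G) := by
  have h := (measurePreserving_comp_perm G (Equiv.swap 0 i)).hasLaw.integral_comp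
    (measurable_knnLogVol (d := d) hk hn 0).aestronglyMeasurable
  simpa only [Function.comp_apply, knnLogVol_comp_perm, Equiv.swap_apply_left] using h

variable {Ω : Type*} [MeasurableSpace Ω] {P : Measure Ω}
  {Y : ℕ → Ω → EuclideanSpace ℝ (Fin d)} {a : ℝ}

lemma sum_integral_sq_dirichlet (ha : 0 < a) {N : ℕ} (hN : 0 < N) {J : Fin N → Ω → ℝ}
    (hJ : HasLaw (fun ω i => J i ω) (dirichletMeasure fun _ : Fin N => a / (N : ℝ)) P) :
    ∑ i, ∫ ω, J i ω ^ 2 ∂P = (a / N + 1) / (a + 1) := by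
  have hN0 : (0 : ℝ) < N := by exact_mod_cast hN
  have h : ∀ i, ∫ ω, J i ω ^ 2 ∂P = a / N * (a / N + 1) / (a * (a + 1)) := by
    intro i
    have h1 := hJ.integral_comp (f := fun x => x i ^ 2)
      ((measurable_pi_apply i).pow_const 2).aestronglyMeasurable
    refine h1.trans ?_
    rw [integral_dirichletMeasure_sq (fun _ => by positivity) i]
    simp only [Finset.sum_const, Finset.card_univ, Fintype.card_fin, nsmul_eq_mul]
    rw [mul_div_cancel₀ _ hN0.ne']
  simp_rw [h]
  simp only [Finset.sum_const, Finset.card_univ, Fintype.card_fin, nsmul_eq_mul]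
  field_simp

lemma ae_mem_stdSimplex_of_hasLaw_dirichlet (ha : 0 < a) {N : ℕ} (hN : 0 < N) {J : Fin N → Ω → ℝ}
    (hJ : HasLaw (fun ω i => J i ω) (dirichletMeasure fun _ : Fin N => a / (N : ℝ)) P) :
    ∀ᵐ ω ∂P, (fun i => J i ω) ∈ stdSimplex ℝ (Fin N) := by
  have hN0 : (0 : ℝ) < N := by exact_mod_cast hN
  have : Nonempty (Fin N) := ⟨⟨0, hN⟩⟩
  exact hJ.ae_comp (ae_dirichletMeasure_mem_stdSimplex fun _ => by positivity)

lemma aemeasurable_of_hasLaw_pi {N : ℕ} {J : Fin N → Ω → ℝ} {μ : Measure (Fin N → ℝ)}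
    (hJ : HasLaw (fun ω i => J i ω) μ P) (i : Fin N) : AEMeasurable (J i) P :=
  (measurable_pi_apply i).comp_aemeasurable hJ.aemeasurable

/-- The deterministic corrections drop out and exchangeability supplies the common mean and the two
covariance values. Sample size n + 2 guarantees two distinct indices 0 and 1. -/
lemma variance_entropyPrior [IsProbabilityMeasure P] (ha : 0 < a)
    (hY_law : ∀ i, HasLaw (Y i) G P) (hY_indep : iIndepFun Y P)
    {k n : ℕ} (hk : 1 ≤ k) (hn : k < n + 2) {J : Fin (n + 2) → Ω → ℝ}
    (hJ : HasLaw (fun ω i => J i ω) (dirichletMeasure fun _ => a / ((n + 2 : ℕ) : ℝ)) P)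
    (hJY : IndepFun (fun ω i => J i ω) (fun ω (i : ℕ) => Y i ω) P)
    (hLp : ∀ i : Fin (n + 2), MemLp (fun ω => knnLogVol k (fun i : Fin (n + 2) => Y i ω) i) 2 P) :
    Var[fun ω => entropyPrior k (fun i => J i ω) (fun i : Fin (n + 2) => Y i ω); P] =
      cov[fun y => knnLogVol k y (0 : Fin (n + 2)), fun y => knnLogVol k y (1 : Fin (n + 2));
        Measure.pi fun _ => G] +
      (Var[fun y => knnLogVol k y (0 : Fin (n + 2)); Measure.pi fun _ => G] -
        cov[fun y => knnLogVol k y (0 : Fin (n + 2)), fun y => knnLogVol k y (1 : Fin (n + 2));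
          Measure.pi fun _ => G]) * ((a / ((n + 2 : ℕ) : ℝ) + 1) / (a + 1)) := by
  have hS := hasLaw_sample hY_law hY_indep (n + 2)
  have hJm := aemeasurable_of_hasLaw_pi hJ
  have hJs := ae_mem_stdSimplex_of_hasLaw_dirichlet ha (Nat.succ_pos _) hJ
  have hind : IndepFun (fun ω i => J i ω)
      (fun ω i => knnLogVol k (fun i : Fin (n + 2) => Y i ω) i) P :=
    hJY.comp (φ := id)
      (ψ := fun (y : ℕ → EuclideanSpace ℝ (Fin d)) i => knnLogVol k (fun i : Fin (n + 2) => y i) i)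
      measurable_id (measurable_pi_lambda _ fun i => (measurable_knnLogVol hk hn i).comp
        (measurable_pi_lambda _ fun j => measurable_pi_apply _))
  have hsum : MemLp (fun ω => ∑ i, J i ω * knnLogVol k (fun i : Fin (n + 2) => Y i ω) i) 2 P :=
    memLp_finsetSum _ fun i _ => memLp_weight_mul hJm hJs (hLp i)
  rw [← sum_integral_sq_dirichlet ha (Nat.succ_pos _) hJ,
    ← variance_sum_weight_mul hJm hJs hLp hind (fun i => ?_) (fun i j => ?_)
      (m := ∫ y, knnLogVol k y (0 : Fin (n + 2)) ∂(Measure.pi fun _ => G))]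
  · simp only [entropyPrior, sub_eq_add_neg, add_assoc]
    exact variance_add_const hsum.1 _
  · rw [← integral_pi_knnLogVol hk hn i]
    exact hS.integral_comp (measurable_knnLogVol (d := d) hk hn i).aestronglyMeasurable
  · have h := hS.covariance_fun_comp (measurable_knnLogVol (d := d) hk hn i).aemeasurable
      (measurable_knnLogVol (d := d) hk hn j).aemeasurable
    rw [h, covariance_knnLogVol hk hn]
    split_ifs <;> ring

end exchangeable

theorem corollary1
    {d : ℕ} (hd : 1 ≤ d) {a : ℝ} (ha : 0 < a)
    -- the base distribution `G` on `ℝ^d`, with density `g`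
    (G : Measure (EuclideanSpace ℝ (Fin d))) [IsProbabilityMeasure G]
    (g : EuclideanSpace ℝ (Fin d) → ℝ) (hg_meas : Measurable g) (hg_nonneg : ∀ x, 0 ≤ g x)
    (hG : G = (volume : Measure (EuclideanSpace ℝ (Fin d))).withDensity
      fun x => ENNReal.ofReal (g x))
    -- finite second moments of `log g(Y)` and of `log ‖Y - Y'‖` for independent `Y, Y' ∼ G`
    (hg_log : MemLp (fun x => Real.log (g x)) 2 G)
    (hdist_log : MemLp (fun p : EuclideanSpace ℝ (Fin d) × EuclideanSpace ℝ (Fin d) =>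
      Real.log (dist p.1 p.2)) 2 (G.prod G))
    -- the i.i.d. sample `Y` and, for each `N`, independent Dirichlet weights
    {Ω : Type*} [MeasurableSpace Ω] (P : Measure Ω) [IsProbabilityMeasure P]
    (Y : ℕ → Ω → EuclideanSpace ℝ (Fin d)) (J : (N : ℕ) → Fin N → Ω → ℝ)
    (hY_law : ∀ i, HasLaw (Y i) G P) (hY_indep : iIndepFun Y P)
    (hJ_law : ∀ N, HasLaw (fun ω (i : Fin N) => J N i ω)
      (dirichletMeasure fun _ : Fin N => a / (N : ℝ)) P)
    (hJY_indep : ∀ N, IndepFun (fun ω (i : Fin N) => J N i ω) (fun ω (i : ℕ) => Y i ω) P) :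
    -- every `H_{N,a,k}` with `1 ≤ k ≤ N - 1` has a finite variance
    (∀ k N : ℕ, 1 ≤ k → k < N →
      MemLp (fun ω => entropyPrior k (fun i : Fin N => J N i ω) (fun i : Fin N => Y i ω)) 2 P) ∧
    -- the limit of the variance as `N → ∞`, for each fixed `k`
    (∀ k : ℕ, 1 ≤ k →
      Tendsto (fun N : ℕ => Var[fun ω =>
          entropyPrior k (fun i : Fin N => J N i ω) (fun i : Fin N => Y i ω); P]) atTop
        (𝓝 ((inverseSquareTail k + Var[fun x => Real.log (g x); G]) / (a + 1)))) ∧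
    -- and the limit of this as `k → ∞`
    Tendsto inverseSquareTail atTop (𝓝 0) ∧
    Tendsto (fun k : ℕ => (inverseSquareTail k + Var[fun x => Real.log (g x); G]) / (a + 1))
      atTop (𝓝 (Var[fun x => Real.log (g x); G] / (a + 1))) := by
  have hLp : ∀ {k N : ℕ}, 1 ≤ k → k < N → ∀ i : Fin N,
      MemLp (fun ω => knnLogVol k (fun i : Fin N => Y i ω) i) 2 P := by
    intro k N hk hN i
    have hS := hasLaw_sample hY_law hY_indep N
    have h := memLp_pi_knnLogVol hd hg_meas hg_nonneg hG hg_log hdist_log hY_law hY_indep hk hN i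
    rw [← hS.map_eq, memLp_map_measure_iff
      (measurable_knnLogVol hk hN i).aestronglyMeasurable hS.aemeasurable] at h
    exact h
  refine ⟨fun k N hk hN => ?_, fun k hk => ?_, tendsto_inverseSquareTail, ?_⟩
  · have hJm := aemeasurable_of_hasLaw_pi (hJ_law N)
    have hJs := ae_mem_stdSimplex_of_hasLaw_dirichlet ha (by omega) (hJ_law N)
    exact (((memLp_finsetSum _ fun i _ => memLp_weight_mul hJm hJs (hLp hk hN i)).sub
      (memLp_const _)).add (memLp_const _)).add (memLp_const _)
  · set v := inverseSquareTail k + Var[fun x => Real.log (g x); G]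
    have hv := tendsto_variance_pi_knnLogVol hd hg_meas hg_nonneg hG hg_log hdist_log hY_law
      hY_indep hk
    have hc := tendsto_covariance_knnLogVol hd hg_meas hg_nonneg hG hg_log hdist_log hY_law
      hY_indep hk
    have hN : Tendsto (fun n : ℕ => (a / ((n + 2 : ℕ) : ℝ) + 1) / (a + 1)) atTop
        (𝓝 ((0 + 1) / (a + 1))) :=
      (((tendsto_const_div_atTop_nhds_zero_nat a).comp (tendsto_add_atTop_nat 2)).add_const
        1).div_const _
    have hlim := hc.add ((hv.sub hc).mul hN)
    rw [show 0 + (v - 0) * ((0 + 1) / (a + 1)) = v / (a + 1) by ring] at hlim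
    -- The variance formula is indexed by N = n + 2.
    refine (tendsto_add_atTop_iff_nat 2).1 (hlim.congr' ?_)
    filter_upwards [eventually_ge_atTop k] with n hn
    exact (variance_entropyPrior ha hY_law hY_indep hk (by omega) (hJ_law (n + 2))
      (hJY_indep (n + 2)) (hLp hk (by omega))).symm
  · simpa using (tendsto_inverseSquareTail.add_const
      Var[fun x => Real.log (g x); G]).div_const (a + 1)
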